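/- Let $G$ be the $n\times n$ grid with periodic boundary conditions, $N=n^2$ vertices and four directions at each vertex. Its rotation map sends $(u,g)$ to $(v,h)$ if the edge labelled $g$ at $u$ leads to $v$ and is labelled $h$ there. For $t\ge 1$ let $S_t$ act on $\mathbb C^N\otimes\mathbb C^{4^t}$ by $S_t|u,g_1,\dots,g_t\rangle=|v,h_1,\dots,h_t\rangle$, where the path from $u$ with labels $g_1,\dots,g_t$ ends at $v$ and has labels $h_1,\dots,h_t$ when walked back from $v$ to $u$. Put $|\psi_u^t\rangle=4^{-t/2}\sum_{\mathbf g}|u,\mathbf g\rangle$, $C_t=2\sum_u|\psi_u^t\rangle\langle\psi_u^t|-\mathbb I$, $W_t=S_tC_t$, $|\Phi_0^t\rangle=N^{-1/2}\sum_u|\psi^t_u\rangle$ and, for a marked vertex $m$, $O_t=\mathbb I-2|\psi_m^t\rangle\langle\psi_m^t|$. Adjoin an ancilla qubit, and for real $\delta$ with $\cos\delta\neq0$ put $|\delta\rangle=\cos\delta|0\rangle+\sin\delta|1\rangle$, $\tilde W_t=W_t\otimes|0\rangle\langle 0|-\mathbb I\otimes|1\rangle\langle1|$, $\tilde O_t(\delta)=\mathbb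 I-2|\psi_m^t\rangle|\delta\rangle\langle\psi_m^t|\langle\delta|$ and $\tilde U_t=\tilde W_t\tilde O_t(\delta)$. Let $\alpha_\delta$ be the smallest absolute value of a nonzero eigenphase of $\tilde U_t$ and $Q_\delta=\lfloor \pi/(2\alpha_\delta)\rfloor$. One application of $\tilde U_t$ is performed by Tulsi's circuit: rotate the ancilla by $X_\delta=\begin{pmatrix}\cos\delta&\sin\delta\\-\sin\delta&\cos\delta\end{pmatrix}$; apply $O_t$ if the ancilla is $|0\rangle$; apply $X_\delta^\dagger$; apply $W_t$ if the ancilla is $|0\rangle$, by means of $C_t$, one application of the rotation map to the vertex and each of the $t$ edge labels in turn, and reversal of the order of the edge labels; apply $Z=\mathrm{diag}(1,-1)$ to the ancilla. The algorithm starts in $|\Phi_0^t\rangle|0\rangle$ and runs this circuit $Q_\delta$ times. Let $p_s(\delta)=|\langle\psi_m^t|\langle\delta|\,\tilde U_t^{Q_\delta}\,|\Phi_0^t\rangle|0\rangle|^2$ be its success probability, and let $Q_O$ and $Q_G$ be the numbers of calls it makes to the target oracle $O_t$ and to the rotation map of $G$, respectively. Then for odd $t=O(\log N)$, as $N\to\infty$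 and uniformly in $m$, $t$ and $\delta$ (the implied constants depend only on the constants in the hypotheses): 1. $\alpha_\delta=\Theta\Big(1\big/\sqrt{\tfrac{N\log N}{t}+\tfrac N4\tan^2\delta}\Big)$ and $p_s(\delta)=\Omega\Big(\min\Big\{1,\ \dfrac{t(1+\tan^2\delta)}{\log N}\Big\}\Big)$. 2. If $t\tan^2\delta=\Theta(\log N)$, then $p_s(\delta)=\Theta(1)$, $Q_O=\Theta(\sqrt{N\log N/t})$, $Q_G=\Theta(\sqrt{N\,t\log N})$ and $Q_O\,Q_G=\Theta(N\log N)$. 3. In particular, for $t=1$ and $\tan^2\delta=\Theta(\log N)$ one has $p_s(\delta)=\Theta(1)$ and $Q_O=Q_G=\Theta(\sqrt{N\log N})$; for $t=\Theta(\log N)$ and $\tan^2\delta=\Theta(1)$ one has $p_s(\delta)=\Theta(1)$, $Q_O=\Theta(\sqrt N)$ and $Q_G=\Theta(\sqrt N\log N)$. -/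

import Mathlib

open scoped Matrix

namespace GridSearch

/-- The four directions at a vertex of the two-dimensional grid. -/
inductive Dir
  | right | left | up | down
  deriving DecidableEq

instance : Fintype Dir where
  elems := {Dir.right, Dir.left, Dir.up, Dir.down}
  complete := by intro x; cases x <;> simp

/-- Vertices of the `n × n` grid with periodic boundary conditions (so `N = n ^ 2`). -/
abbrev Vertex (n : ℕ) : Type := ZMod n × ZMod n

/-- The rotation map of the grid: it moves along the edge labelled `g` at `u` and returns the other
end point together with the label that this edge carries there. -/
def gridRot (n : ℕ) : Vertex n × Dir → Vertex n × Dir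
  | ((x, y), Dir.right) => ((x + 1, y), Dir.left)
  | ((x, y), Dir.left) => ((x - 1, y), Dir.right)
  | ((x, y), Dir.up) => ((x, y + 1), Dir.down)
  | ((x, y), Dir.down) => ((x, y - 1), Dir.up)

/-- The rotation map of the `t`-th power of a graph with rotation map `R`: it sends
`(u, g₁, …, g_t)` to `(v, h₁, …, h_t)`, where the path that starts at `u` and follows the labels
`g₁, …, g_t` ends at `v`, and `h₁, …, h_t` are the labels of the same path walked
from `v` back to `u`. -/
def powRot {V D : Type} (R : V × D → V × D) : (t : ℕ) → V × (Fin t → D) → V × (Fin t → D)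
  | 0, p => p
  | t + 1, (u, g) =>
    let q := R (u, g 0)
    let r := powRot R t (q.1, Fin.tail g)
    (r.1, Fin.snoc (α := fun _ => D) r.2 q.2)

/-- Labels of the standard basis of `ℂ^N ⊗ ℂ^(4^t)`. -/
abbrev Idx (n t : ℕ) : Type := Vertex n × (Fin t → Dir)

/-- The operator `|p⟩ ↦ |f p⟩`. -/
def basisMap {I : Type} [DecidableEq I] (f : I → I) : Matrix I I ℂ :=
  Matrix.of fun i j => if f j = i then 1 else 0

/-- The rank-one operator `|v⟩⟨v|`. -/
def proj {I : Type} (v : I → ℂ) : Matrix I I ℂ := Matrix.vecMulVec v (star v)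

section Walk

variable (n : ℕ) [NeZero n] (t : ℕ)

/-- `|ψ_u^t⟩`, the uniform superposition of the `4 ^ t` paths of length `t` from `u`. -/
noncomputable def psi (u : Vertex n) : Idx n t → ℂ :=
  fun p => if p.1 = u then ((1 / Real.sqrt (4 ^ t) : ℝ) : ℂ) else 0

/-- The shift operator `S_t` of the `t`-th power of the grid. -/
def shiftOp : Matrix (Idx n t) (Idx n t) ℂ := basisMap (powRot (gridRot n) t)

/-- The coin operator `C_t = 2 ∑_u |ψ_u^t⟩⟨ψ_u^t| - 1`. -/
noncomputable def coinOp : Matrix (Idx n t) (Idx n t) ℂ :=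
  (2 : ℂ) • (∑ u : Vertex n, proj (psi n t u)) - 1

/-- The multi-step walk operator `W_t = S_t C_t`. -/
noncomputable def walkOp : Matrix (Idx n t) (Idx n t) ℂ := shiftOp n t * coinOp n t

/-- The oracle `O_t = 1 - 2 |ψ_m^t⟩⟨ψ_m^t|` for the marked vertex `m`. -/
noncomputable def oracleOp (m : Vertex n) : Matrix (Idx n t) (Idx n t) ℂ :=
  1 - (2 : ℂ) • proj (psi n t m)

/-- `|Φ₀^t⟩ = N^(-1/2) ∑_u |ψ_u^t⟩`. -/
noncomputable def phi0 : Idx n t → ℂ :=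
  ((1 / Real.sqrt ((n : ℝ) ^ 2) : ℝ) : ℂ) • ∑ u : Vertex n, psi n t u

end Walk

/-- Basis labels after an ancilla qubit is adjoined: `Sum.inl` stands for ancilla `|0⟩` and
`Sum.inr` for ancilla `|1⟩`. -/
abbrev AIdx (n t : ℕ) : Type := Idx n t ⊕ Idx n t

section Controlled

variable (n : ℕ) [NeZero n] (t : ℕ)

/-- The starting state `|Φ₀^t⟩|0⟩`. -/
noncomputable def startState : AIdx n t → ℂ := Sum.elim (phi0 n t) 0

/-- The target state `|ψ_m^t⟩|δ⟩` with `|δ⟩ = cos δ |0⟩ + sin δ |1⟩`. -/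
noncomputable def targetState (m : Vertex n) (δ : ℝ) : AIdx n t → ℂ :=
  Sum.elim ((Real.cos δ : ℂ) • psi n t m) ((Real.sin δ : ℂ) • psi n t m)

/-- The controlled walk operator: `W_t` if the ancilla is `|0⟩` and `-1` if it is `|1⟩`. -/
noncomputable def tulsiWalk : Matrix (AIdx n t) (AIdx n t) ℂ :=
  Matrix.fromBlocks (walkOp n t) 0 0 (-1)

/-- The controlled oracle: the reflection in the target state `|ψ_m^t⟩|δ⟩`. -/
noncomputable def tulsiOracle (m : Vertex n) (δ : ℝ) : Matrix (AIdx n t) (AIdx n t) ℂ :=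
  1 - (2 : ℂ) • proj (targetState n t m δ)

/-- The search operator, a controlled oracle call followed by a controlled walk. -/
noncomputable def searchOp (m : Vertex n) (δ : ℝ) : Matrix (AIdx n t) (AIdx n t) ℂ :=
  tulsiWalk n t * tulsiOracle n t m δ

end Controlled

/-- The smallest nonzero eigenphase (in absolute value) of a unitary matrix. -/
noncomputable def smallestEigenphase {I : Type} [Fintype I] [DecidableEq I]
    (M : Matrix I I ℂ) : ℝ :=
  sInf {x : ℝ | ∃ μ : ℂ, Module.End.HasEigenvalue (Matrix.toLin' M) μ ∧ μ ≠ 1 ∧ x = |μ.arg|}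

/-- The eigenphase `α_δ`: the smallest nonzero eigenphase of the search operator. -/
noncomputable def alpha (n : ℕ) [NeZero n] (t : ℕ) (m : Vertex n) (δ : ℝ) : ℝ :=
  smallestEigenphase (searchOp n t m δ)

/-- The number of iterations, `Q_δ = ⌊π / (2 α_δ)⌋`. -/
noncomputable def iterations (n : ℕ) [NeZero n] (t : ℕ) (m : Vertex n) (δ : ℝ) : ℕ :=
  ⌊Real.pi / (2 * alpha n t m δ)⌋₊

/-! ### The query circuit -/

/-- The gates of the circuit. An `oracle` gate is one call to the oracle that marks the target, a
`shift i` gate is one call to the rotation map of the grid; the other gates make no query. -/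
inductive Gate (t : ℕ)
  | oracle
  | shift (i : Fin t)
  | coin
  | reverse
  | rotX
  | rotXdag
  | phaseZ

/-- One call to the rotation map of the grid, on the vertex and on the `i`-th edge label. -/
def shiftAt (n t : ℕ) (i : Fin t) (p : Idx n t) : Idx n t :=
  let q := gridRot n (p.1, p.2 i)
  (q.1, Function.update p.2 i q.2)

/-- Reversal of the order of the edge labels. -/
def reverseLabels (n t : ℕ) (p : Idx n t) : Idx n t := (p.1, fun i => p.2 i.rev)

/-- A gate on the vertex and edge registers, executed only if the ancilla is `|0⟩`. -/
def ctrl {n t : ℕ} (A : Matrix (Idx n t) (Idx n t) ℂ) : Matrix (AIdx n t) (AIdx n t) ℂ :=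
  Matrix.fromBlocks A 0 0 1

/-- The ancilla rotation `X_δ`. -/
noncomputable def ancillaX (n t : ℕ) (δ : ℝ) : Matrix (AIdx n t) (AIdx n t) ℂ :=
  Matrix.fromBlocks ((Real.cos δ : ℂ) • 1) ((Real.sin δ : ℂ) • 1)
    (-((Real.sin δ : ℂ) • 1)) ((Real.cos δ : ℂ) • 1)

/-- The unitary operator that a gate performs. -/
noncomputable def Gate.op (n : ℕ) [NeZero n] {t : ℕ} (m : Vertex n) (δ : ℝ) :
    Gate t → Matrix (AIdx n t) (AIdx n t) ℂ
  | .oracle => ctrl (oracleOp n t m)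
  | .shift i => ctrl (basisMap (shiftAt n t i))
  | .coin => ctrl (coinOp n t)
  | .reverse => ctrl (basisMap (reverseLabels n t))
  | .rotX => ancillaX n t δ
  | .rotXdag => (ancillaX n t δ)ᴴ
  | .phaseZ => Matrix.fromBlocks 1 0 0 (-1)

/-- One iteration of the circuit, in temporal order: the oracle, controlled in the rotated ancilla
basis; the controlled walk (the coin, `t` calls to the rotation map, reversal of the labels);
and the phase flip `Z` on the ancilla. -/
def iteration (t : ℕ) : List (Gate t) :=
  [.rotX, .oracle, .rotXdag, .coin] ++ (List.finRange t).map Gate.shift ++ [.reverse, .phaseZ]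

/-- `Q` iterations of the circuit. -/
def circuit (t Q : ℕ) : List (Gate t) := (List.replicate Q (iteration t)).flatten

/-- The state that results when the gates of `c` are applied, first gate first, to `ψ`. -/
noncomputable def run (n : ℕ) [NeZero n] {t : ℕ} (m : Vertex n) (δ : ℝ) (c : List (Gate t))
    (ψ : AIdx n t → ℂ) : AIdx n t → ℂ :=
  c.foldl (fun φ g => g.op n m δ *ᵥ φ) ψ

def Gate.isOracle {t : ℕ} : Gate t → Bool
  | .oracle => true
  | _ => false

def Gate.isShift {t : ℕ} : Gate t → Bool
  | .shift _ => true
  | _ => false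

/-- `Q_O`: the number of calls to the target oracle made by the algorithm. -/
noncomputable def oracleQueries (n : ℕ) [NeZero n] (t : ℕ) (m : Vertex n) (δ : ℝ) : ℕ :=
  (circuit t (iterations n t m δ)).countP Gate.isOracle

/-- `Q_G`: the number of calls to the rotation map of the grid made by the algorithm. -/
noncomputable def graphQueries (n : ℕ) [NeZero n] (t : ℕ) (m : Vertex n) (δ : ℝ) : ℕ :=
  (circuit t (iterations n t m δ)).countP Gate.isShift

/-- The success probability: the probability that measuring the final state of the algorithm
yields the target state. -/
noncomputable def successProb (n : ℕ) [NeZero n] (t : ℕ) (m : Vertex n) (δ : ℝ) : ℝ :=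
  ‖star (targetState n t m δ) ⬝ᵥ
    run n m δ (circuit t (iterations n t m δ)) (startState n t)‖ ^ 2

/-- `log N` for the grid with `N = n ^ 2` vertices. -/
noncomputable def logN (n : ℕ) : ℝ := Real.log ((n : ℝ) ^ 2)

/-- `x` and `y` agree up to the constant factor `C`: an instance of `x = Θ(y)`. -/
def ThetaWith (C x y : ℝ) : Prop := x ≤ C * y ∧ y ≤ C * x

end GridSearch

/-!
The search operator `Ũ = W̃ Õ` is a perturbation of the controlled walk `W̃` by the reflection in a
single vector, so its spectrum is governed by one scalar secular equation. Everything is expressed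
through the transition matrix `D` of the `t`-step walk on the vertices, the compression of the
shift to the span of the `ψ_u^t`.

If `g` is the Green's function of `D` at energy `cos β` with source `m`, that is
`(cos β - D) g = δ_m`, then `e^{-iβ} Ψ g - S Ψ g`, together with a multiple of `ψ_m` on the second
ancilla branch, is an eigenvector of `Ũ` for `e^{iβ}` exactly when
`cos² δ sin β g(m) + sin² δ tan (β / 2) = 0` (`searchOp_mulVec_searchVec`), and below the spectral
gap of `W` every eigenphase arises in this way (`secular_of_eigenvector`). Norm and overlaps of
these eigenvectors are explicit in `g(m)` and `‖g‖²`. Characters of the torus diagonalize `D` with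
eigenvalues `λ_k^t`, `λ_k = (cos (2π k₁ / n) + cos (2π k₂ / n)) / 2`, which turns `g(m)` and `‖g‖²`
into spectral sums (`exists_isGreen`).

For odd `t = O(log N)` the gaps `1 - λ_k^t`, `k ≠ 0`, satisfy `∑ 1 / (1 - λ_k^t) = Θ(N log N / t)`
and `∑ 1 / (1 - λ_k^t)² = O(N² / t²)` (`sum_inv_gap_le`, `le_sum_inv_gap`, `sum_inv_gap_sq_le`): for
positive `λ_k` the gap is comparable with `min {1, t (1 - λ_k)}`, and for negative `λ_k` oddness of
`t` keeps it at least `1`. Hence the secular equation reads approximately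
`α² (N log N / t + N tan² δ / 4) = Θ(1)`, which determines the smallest eigenphase `α`
(`alpha_bounds`).

The two eigenvectors for `e^{±iα}` carry all but a fraction `O(1 / log² N)` of the weight of the
starting state, so after `⌊π / (2α)⌋` steps the state has turned into their other superposition,
whose overlap with the target has square `Ω(N α² / cos² δ)`. This is at least of the order of
`min {1, t (1 + tan² δ) / log N}`, hence at least `1 / log N`, and dominates the error
(`amplitude_ge`, `successProb_ge`, `min_le_successProb`). The numbers of queries are `Q` and `t Q`
with `Q = ⌊π / (2α)⌋`.
-/

namespace GridSearch

/-! ### The circuit -/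

section BasisMap

variable {I : Type} [DecidableEq I]

lemma basisMap_mul [Fintype I] (f g : I → I) : basisMap f * basisMap g = basisMap (f ∘ g) := by
  ext i j
  simp only [basisMap, Matrix.mul_apply, Matrix.of_apply, Function.comp_apply]
  rw [Finset.sum_eq_single (g j)]
  · simp
  · intro b _ hb
    simp [hb.symm]
  · simp

lemma basisMap_id : basisMap (id : I → I) = 1 := by
  ext i j
  simp [basisMap, Matrix.one_apply, eq_comm]

end BasisMap

section Shift

/-- Rotation-map calls at later positions do not touch the first edge label. -/
lemma foldl_shiftAt_succ {n t : ℕ} (l : List (Fin t)) (u : Vertex n) (d : Dir) (g : Fin t → Dir) :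
    (l.map Fin.succ).foldl (fun p i => shiftAt n (t + 1) i p) (u, Fin.cons d g) =
      ((l.foldl (fun p i => shiftAt n t i p) (u, g)).1,
        Fin.cons d (l.foldl (fun p i => shiftAt n t i p) (u, g)).2) := by
  induction l generalizing u g with
  | nil => rfl
  | cons i l ih =>
    have h : shiftAt n (t + 1) i.succ (u, Fin.cons d g) =
        ((shiftAt n t i (u, g)).1, Fin.cons d (shiftAt n t i (u, g)).2) := by
      simp only [shiftAt, Fin.cons_succ, Prod.mk.injEq, true_and]
      rw [← Fin.cons_update]
    rw [List.map_cons, List.foldl_cons, h, ih]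
    rfl

/-- Moving along the edges one after the other records the back labels in the order of the walk;
the rotation map of the power graph lists them in the opposite order. -/
lemma reverse_foldl_shiftAt {n : ℕ} (t : ℕ) (p : Idx n t) :
    reverseLabels n t ((List.finRange t).foldl (fun p i => shiftAt n t i p) p) =
      powRot (gridRot n) t p := by
  induction t with
  | zero =>
    obtain ⟨u, g⟩ := p
    simp [reverseLabels, powRot]
    exact Subsingleton.elim _ _
  | succ t ih =>
    obtain ⟨u, g⟩ := p
    have h : shiftAt n (t + 1) 0 (u, g) =
        ((gridRot n (u, g 0)).1, Fin.cons (gridRot n (u, g 0)).2 (Fin.tail g)) := by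
      simp only [shiftAt, Prod.mk.injEq, true_and]
      conv_lhs => rw [← Fin.cons_self_tail g]
      rw [Fin.update_cons_zero]
      simp
    rw [List.finRange_succ, List.foldl_cons, h, foldl_shiftAt_succ]
    have ih' := ih ((gridRot n (u, g 0)).1, Fin.tail g)
    simp only [powRot]
    rw [← ih']
    simp only [reverseLabels, Prod.mk.injEq, true_and]
    funext i
    refine Fin.lastCases ?_ (fun j => ?_) i
    · simp
    · simp [Fin.rev_castSucc]

end Shift

section Circuit

variable {n : ℕ} [NeZero n] {t : ℕ} (m : Vertex n) (δ : ℝ)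

lemma run_append (c d : List (Gate t)) (ψ : AIdx n t → ℂ) :
    run n m δ (c ++ d) ψ = run n m δ d (run n m δ c ψ) := by
  simp [run, List.foldl_append]

lemma run_cons (g : Gate t) (d : List (Gate t)) (ψ : AIdx n t → ℂ) :
    run n m δ (g :: d) ψ = run n m δ d (g.op n m δ *ᵥ ψ) := rfl

lemma run_nil (ψ : AIdx n t → ℂ) : run n m δ ([] : List (Gate t)) ψ = ψ := rfl

lemma ctrl_mul (A B : Matrix (Idx n t) (Idx n t) ℂ) : ctrl A * ctrl B = ctrl (A * B) := by
  simp [ctrl, Matrix.fromBlocks_multiply]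

/-- The basis permutation performed by a sequence of rotation-map calls. -/
lemma run_shift (l : List (Fin t)) (ψ : AIdx n t → ℂ) :
    run n m δ (l.map Gate.shift) ψ =
      ctrl (basisMap fun p : Idx n t => l.foldl (fun p i => shiftAt n t i p) p) *ᵥ ψ := by
  induction l generalizing ψ with
  | nil =>
    have h : (basisMap fun p : Idx n t => p) = 1 := basisMap_id
    simp [run, ctrl, h]
  | cons i l ih =>
    rw [List.map_cons, run_cons, ih, Matrix.mulVec_mulVec]
    simp only [Gate.op, ctrl_mul, basisMap_mul]
    rfl

lemma tulsiOracle_eq :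
    (ancillaX n t δ)ᴴ * (ctrl (oracleOp n t m) * ancillaX n t δ) = tulsiOracle n t m δ := by
  have hc : (starRingEnd ℂ) (Real.cos δ : ℂ) = Real.cos δ := Complex.conj_ofReal _
  have hs : (starRingEnd ℂ) (Real.sin δ : ℂ) = Real.sin δ := Complex.conj_ofReal _
  have hP : proj (targetState n t m δ) = Matrix.fromBlocks
      ((Real.cos δ * Real.cos δ : ℂ) • proj (psi n t m))
      ((Real.cos δ * Real.sin δ : ℂ) • proj (psi n t m))
      ((Real.sin δ * Real.cos δ : ℂ) • proj (psi n t m))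
      ((Real.sin δ * Real.sin δ : ℂ) • proj (psi n t m)) := by
    ext i j
    rcases i with i | i <;> rcases j with j | j <;>
      simp [proj, targetState, Matrix.vecMulVec_apply, hc, hs, -Complex.ofReal_cos,
        -Complex.ofReal_sin] <;> ring
  have h1 : (Real.cos δ : ℂ) * Real.cos δ + Real.sin δ * Real.sin δ = 1 := by
    exact_mod_cast (by nlinarith [Real.sin_sq_add_cos_sq δ] :
      Real.cos δ * Real.cos δ + Real.sin δ * Real.sin δ = 1)
  rw [tulsiOracle, hP, ancillaX, ctrl, oracleOp, Matrix.fromBlocks_conjTranspose,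
    Matrix.fromBlocks_multiply, Matrix.fromBlocks_multiply,
    ← Matrix.fromBlocks_one, Matrix.fromBlocks_smul, sub_eq_add_neg (Matrix.fromBlocks _ _ _ _),
    Matrix.fromBlocks_neg, Matrix.fromBlocks_add]
  generalize (Real.cos δ : ℂ) = c at *
  generalize (Real.sin δ : ℂ) = s at *
  simp only [Matrix.conjTranspose_smul, Matrix.conjTranspose_one, Matrix.conjTranspose_neg,
    starRingEnd_apply] at hc hs ⊢
  simp only [hc, hs]
  generalize proj (psi n t m) = P
  congr 1 <;>
  · ext i j
    simp [Matrix.sub_apply, Matrix.smul_apply]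
    try generalize (1 : Matrix (Idx n t) (Idx n t) ℂ) i j = e
    grind

/-- One iteration of the circuit performs the search operator. -/
lemma run_iteration (ψ : AIdx n t → ℂ) :
    run n m δ (iteration t) ψ = searchOp n t m δ *ᵥ ψ := by
  have hS : basisMap (reverseLabels n t) *
      (basisMap (fun p : Idx n t => (List.finRange t).foldl (fun p i => shiftAt n t i p) p) *
        coinOp n t) = walkOp n t := by
    rw [← Matrix.mul_assoc, basisMap_mul, walkOp, shiftOp]
    congr 2
    funext p
    exact reverse_foldl_shiftAt t p
  have hZ : Matrix.fromBlocks 1 0 0 (-1) * ctrl (walkOp n t) = tulsiWalk n t := by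
    simp [ctrl, tulsiWalk, Matrix.fromBlocks_multiply]
  rw [iteration, run_append, run_append, run_shift]
  simp only [run_cons, run_nil, Gate.op, Matrix.mulVec_mulVec, ← Matrix.mul_assoc]
  rw [searchOp, ← tulsiOracle_eq, ← hZ, ← hS, ← ctrl_mul, ← ctrl_mul]
  simp only [Matrix.mul_assoc]

lemma run_circuit (Q : ℕ) (ψ : AIdx n t → ℂ) :
    run n m δ (circuit t Q) ψ = (searchOp n t m δ ^ Q) *ᵥ ψ := by
  induction Q generalizing ψ with
  | zero => simp [circuit, run]
  | succ Q ih =>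
    have h : circuit t (Q + 1) = iteration t ++ circuit t Q := by
      simp [circuit, List.replicate_succ]
    rw [h, run_append, ih, run_iteration, pow_succ, Matrix.mulVec_mulVec]

end Circuit

lemma oracleQueries_eq (n : ℕ) [NeZero n] (t : ℕ) (m : Vertex n) (δ : ℝ) :
    oracleQueries n t m δ = iterations n t m δ := by
  have h : (iteration t).countP Gate.isOracle = 1 := by
    simp only [iteration, List.countP_append, List.countP_map]
    have h0 : (Gate.isOracle ∘ Gate.shift : Fin t → Bool) = fun _ => false := rfl
    simp [h0, List.countP_cons, Gate.isOracle]
  simp [oracleQueries, circuit, List.countP_flatten, h]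

lemma graphQueries_eq (n : ℕ) [NeZero n] (t : ℕ) (m : Vertex n) (δ : ℝ) :
    graphQueries n t m δ = iterations n t m δ * t := by
  have h : (iteration t).countP Gate.isShift = t := by
    simp only [iteration, List.countP_append, List.countP_map]
    have h0 : (Gate.isShift ∘ Gate.shift : Fin t → Bool) = fun _ => true := rfl
    simp [h0, Gate.isShift]
  simp [graphQueries, circuit, List.countP_flatten, h]

/-! ### Shift, coin and unitarity -/

section PowRot

variable {V D : Type} (R : V × D → V × D)

/-- The rotation map of a power graph, with the last step of the walk split off. -/
lemma powRot_snoc (t : ℕ) (u : V) (g : Fin t → D) (d : D) :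
    powRot R (t + 1) (u, Fin.snoc (α := fun _ => D) g d) =
      ((R ((powRot R t (u, g)).1, d)).1,
        Fin.cons (R ((powRot R t (u, g)).1, d)).2 (powRot R t (u, g)).2) := by
  induction t generalizing u with
  | zero =>
    have h : (Fin.snoc (α := fun _ => D) g d) 0 = d := by
      rw [← Fin.last_zero, Fin.snoc_last]
    simp only [powRot, h, Prod.mk.injEq, true_and]
    funext i
    obtain rfl : i = 0 := Fin.fin_one_eq_zero i
    rw [← Fin.last_zero, Fin.snoc_last, Fin.last_zero, Fin.cons_zero]
  | succ t ih =>
    have h0 : (Fin.snoc (α := fun _ => D) g d) 0 = g 0 := by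
      rw [← Fin.castSucc_zero, Fin.snoc_castSucc]
    have h1 : Fin.tail (Fin.snoc (α := fun _ => D) g d) =
        Fin.snoc (α := fun _ => D) (Fin.tail g) d := by
      conv_lhs => rw [← Fin.cons_self_tail g, ← Fin.cons_snoc_eq_snoc_cons]
      rw [Fin.tail_cons]
    rw [powRot, h0, h1, ih]
    simp only [powRot]
    rw [← Fin.cons_snoc_eq_snoc_cons]

/-- Walking a path and then walking it back leads to where it started. -/
lemma powRot_involutive (hR : Function.Involutive R) (t : ℕ) :
    Function.Involutive (powRot R t) := by
  induction t with
  | zero => intro p; rfl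
  | succ t ih =>
    rintro ⟨u, g⟩
    have h : powRot R (t + 1) (u, g) =
        ((powRot R t ((R (u, g 0)).1, Fin.tail g)).1,
          Fin.snoc (α := fun _ => D) (powRot R t ((R (u, g 0)).1, Fin.tail g)).2
            (R (u, g 0)).2) := rfl
    rw [h, powRot_snoc, Prod.mk.eta, ih, Prod.mk.eta, hR]
    simp

end PowRot

lemma gridRot_involutive (n : ℕ) : Function.Involutive (gridRot n) := by
  rintro ⟨⟨x, y⟩, d⟩
  cases d <;> simp [gridRot]

lemma basisMap_mulVec {I : Type} [Fintype I] [DecidableEq I] {f : I → I}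
    (hf : Function.Involutive f) (v : I → ℂ) : basisMap f *ᵥ v = v ∘ f := by
  funext i
  simp only [basisMap, Matrix.mulVec, dotProduct, Matrix.of_apply, Function.comp_apply]
  rw [Finset.sum_eq_single (f i)]
  · simp [hf i]
  · intro b _ hb
    rw [if_neg, zero_mul]
    rintro rfl
    exact hb (hf b).symm
  · simp

lemma basisMap_conjTranspose {I : Type} [DecidableEq I] {f : I → I}
    (hf : Function.Involutive f) : (basisMap f)ᴴ = basisMap f := by
  ext i j
  have h : f i = j ↔ f j = i := ⟨fun h => h ▸ hf i, fun h => h ▸ hf j⟩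
  simp [basisMap, h, apply_ite]

section Norms

variable {I : Type} [Fintype I]

/-- The squared Euclidean norm of a vector of amplitudes. -/
noncomputable def normSq (v : I → ℂ) : ℝ := ∑ i, ‖v i‖ ^ 2

lemma star_dotProduct_self (v : I → ℂ) : star v ⬝ᵥ v = (normSq v : ℂ) := by
  simp only [dotProduct, normSq, Complex.ofReal_sum, Pi.star_apply]
  refine Finset.sum_congr rfl fun i _ => ?_
  rw [RCLike.star_def, Complex.conj_mul', Complex.ofReal_pow]

lemma normSq_nonneg (v : I → ℂ) : 0 ≤ normSq v :=
  Finset.sum_nonneg fun _ _ => sq_nonneg _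

lemma norm_star_dotProduct_sq_le (v w : I → ℂ) :
    ‖star v ⬝ᵥ w‖ ^ 2 ≤ normSq v * normSq w := by
  have h : ‖star v ⬝ᵥ w‖ ≤ ∑ i, ‖v i‖ * ‖w i‖ := by
    refine (norm_sum_le _ _).trans (le_of_eq (Finset.sum_congr rfl fun i _ => ?_))
    rw [norm_mul, Pi.star_apply, norm_star]
  exact (pow_le_pow_left₀ (norm_nonneg _) h 2).trans
    (Finset.sum_mul_sq_le_sq_mul_sq _ _ _)

lemma star_dotProduct_comm (v w : I → ℂ) : star v ⬝ᵥ w = star (star w ⬝ᵥ v) := by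
  rw [← Matrix.star_dotProduct_star, star_star]

lemma star_dotProduct_mulVec {J : Type} [Fintype J] (A : Matrix I J ℂ) (v : I → ℂ) (w : J → ℂ) :
    star v ⬝ᵥ (A *ᵥ w) = star (Aᴴ *ᵥ v) ⬝ᵥ w := by
  rw [Matrix.star_mulVec, Matrix.conjTranspose_conjTranspose, Matrix.dotProduct_mulVec]

lemma proj_mulVec (v w : I → ℂ) : proj v *ᵥ w = (star v ⬝ᵥ w) • v := by
  rw [proj, Matrix.vecMulVec_mulVec]
  ext i
  simp [mul_comm]

variable [DecidableEq I]

lemma star_mulVec_dotProduct_mulVec {A : Matrix I I ℂ} (hA : Aᴴ * A = 1) (v w : I → ℂ) :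
    star (A *ᵥ v) ⬝ᵥ (A *ᵥ w) = star v ⬝ᵥ w := by
  rw [star_dotProduct_mulVec, Matrix.mulVec_mulVec, hA, Matrix.one_mulVec]

lemma normSq_mulVec {A : Matrix I I ℂ} (hA : Aᴴ * A = 1) (v : I → ℂ) :
    normSq (A *ᵥ v) = normSq v := by
  have h := star_mulVec_dotProduct_mulVec hA v v
  rw [star_dotProduct_self, star_dotProduct_self] at h
  exact_mod_cast h

lemma normSq_pow_mulVec {A : Matrix I I ℂ} (hA : Aᴴ * A = 1) (Q : ℕ) (v : I → ℂ) :
    normSq ((A ^ Q) *ᵥ v) = normSq v := by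
  induction Q with
  | zero => simp
  | succ Q ih => rw [pow_succ', ← Matrix.mulVec_mulVec, normSq_mulVec hA, ih]

/-- The reflection in a unit vector is unitary. -/
lemma reflection_unitary {v : I → ℂ} (hv : normSq v = 1) :
    (1 - (2 : ℂ) • proj v)ᴴ * (1 - (2 : ℂ) • proj v) = 1 := by
  have h1 : (proj v)ᴴ = proj v := by
    simp [proj, Matrix.conjTranspose_vecMulVec]
  have h2 : proj v * proj v = proj v := by
    rw [proj, Matrix.vecMulVec_mul_vecMulVec, star_dotProduct_self, hv]
    simp
  have h3 : (1 - (2 : ℂ) • proj v)ᴴ = 1 - (2 : ℂ) • proj v := by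
    rw [Matrix.conjTranspose_sub, Matrix.conjTranspose_smul, h1]
    simp
  rw [h3, sub_mul, mul_sub, mul_sub, smul_mul_smul_comm, h2, one_mul, one_mul, mul_one,
    show (2 : ℂ) * 2 = 2 + 2 by norm_num, add_smul]
  abel

end Norms

section Lift

lemma shiftOp_conjTranspose (n t : ℕ) : (shiftOp n t)ᴴ = shiftOp n t :=
  basisMap_conjTranspose (powRot_involutive _ (gridRot_involutive n) t)

variable (n : ℕ) [NeZero n] (t : ℕ)

/-- The isometry `|u⟩ ↦ |ψ_u^t⟩` from the vertex space into the path space. -/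
noncomputable def lift : Matrix (Idx n t) (Vertex n) ℂ := Matrix.of fun p u => psi n t u p

/-- The `t`-step transition matrix of the grid, compressed from the shift: its `(u, v)` entry is
`⟨ψ_u^t|S_t|ψ_v^t⟩`. -/
noncomputable def transition : Matrix (Vertex n) (Vertex n) ℂ :=
  (lift n t)ᴴ * shiftOp n t * lift n t

lemma shiftOp_mul_self : shiftOp n t * shiftOp n t = 1 := by
  have h := (powRot_involutive _ (gridRot_involutive n) t).comp_self
  rw [shiftOp, basisMap_mul, h, basisMap_id]

lemma lift_mulVec_single (u : Vertex n) : lift n t *ᵥ Pi.single u 1 = psi n t u := by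
  ext p
  simp [lift]

lemma lift_mulVec_apply (f : Vertex n → ℂ) (p : Idx n t) :
    (lift n t *ᵥ f) p = ((1 / Real.sqrt (4 ^ t) : ℝ) : ℂ) * f p.1 := by
  simp only [Matrix.mulVec, dotProduct, lift, Matrix.of_apply, psi]
  rw [Finset.sum_eq_single p.1]
  · simp
  · intro b _ hb
    simp [hb.symm]
  · simp

lemma card_labels : Fintype.card (Fin t → Dir) = 4 ^ t := by
  rw [Fintype.card_fun, Fintype.card_fin]
  rfl

lemma sqrt_four_pow_inv_sq :
    ((1 / Real.sqrt (4 ^ t) : ℝ) : ℂ) * ((1 / Real.sqrt (4 ^ t) : ℝ) : ℂ) = (4 ^ t : ℂ)⁻¹ := by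
  rw [← Complex.ofReal_mul, div_mul_div_comm, Real.mul_self_sqrt (by positivity)]
  simp

lemma lift_conjTranspose_mulVec_apply (w : Idx n t → ℂ) (u : Vertex n) :
    ((lift n t)ᴴ *ᵥ w) u =
      ((1 / Real.sqrt (4 ^ t) : ℝ) : ℂ) * ∑ g : Fin t → Dir, w (u, g) := by
  simp only [Matrix.mulVec, dotProduct, Matrix.conjTranspose_apply, lift, Matrix.of_apply, psi]
  rw [Fintype.sum_prod_type, Finset.sum_eq_single u]
  · simp only [if_true, Finset.mul_sum, RCLike.star_def, Complex.conj_ofReal]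
  · intro b _ hb
    simp [hb]
  · simp

lemma lift_isometry : (lift n t)ᴴ * lift n t = 1 := by
  refine Matrix.ext_of_mulVec_single fun v => ?_
  rw [← Matrix.mulVec_mulVec, Matrix.one_mulVec]
  funext u
  rw [lift_conjTranspose_mulVec_apply]
  simp only [lift_mulVec_apply, Finset.sum_const, Finset.card_univ, card_labels, nsmul_eq_mul]
  rw [mul_left_comm, ← mul_assoc, ← mul_assoc, mul_assoc (_ ^ _ : ℕ).cast, sqrt_four_pow_inv_sq]
  push_cast
  rw [mul_inv_cancel₀ (pow_ne_zero t (by norm_num : (4 : ℂ) ≠ 0)), one_mul]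

/-- Paths from `u` of length `t`, averaged: the transition matrix is the Markov operator of the
`t`-step walk. -/
lemma transition_mulVec_apply (f : Vertex n → ℂ) (u : Vertex n) :
    (transition n t *ᵥ f) u =
      (4 ^ t : ℂ)⁻¹ * ∑ g : Fin t → Dir, f (powRot (gridRot n) t (u, g)).1 := by
  rw [transition, ← Matrix.mulVec_mulVec, ← Matrix.mulVec_mulVec, lift_conjTranspose_mulVec_apply,
    shiftOp, basisMap_mulVec (powRot_involutive _ (gridRot_involutive n) t)]
  simp only [Function.comp_apply, lift_mulVec_apply]
  rw [← Finset.mul_sum, ← mul_assoc, sqrt_four_pow_inv_sq]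

lemma transition_conjTranspose : (transition n t)ᴴ = transition n t := by
  simp only [transition, Matrix.conjTranspose_mul, Matrix.conjTranspose_conjTranspose,
    shiftOp_conjTranspose, Matrix.mul_assoc]

lemma coinOp_eq : coinOp n t = (2 : ℂ) • (lift n t * (lift n t)ᴴ) - 1 := by
  rw [coinOp]
  congr 2
  ext p q
  simp [Matrix.sum_apply, proj, Matrix.vecMulVec_apply, Matrix.mul_apply, lift]

lemma coinOp_conjTranspose : (coinOp n t)ᴴ = coinOp n t := by
  simp [coinOp_eq]

lemma coinOp_mul_lift : coinOp n t * lift n t = lift n t := by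
  rw [coinOp_eq, Matrix.sub_mul, Matrix.smul_mul, Matrix.mul_assoc, lift_isometry,
    Matrix.mul_one, Matrix.one_mul, two_smul, add_sub_cancel_right]

lemma coinOp_mul_self : coinOp n t * coinOp n t = 1 := by
  conv_lhs => rw [coinOp_eq n t, mul_sub, mul_smul_comm, ← coinOp_eq n t, ← Matrix.mul_assoc,
    coinOp_mul_lift, mul_one]
  rw [coinOp_eq]
  abel

lemma walkOp_unitary : (walkOp n t)ᴴ * walkOp n t = 1 := by
  rw [walkOp, Matrix.conjTranspose_mul, shiftOp_conjTranspose, coinOp_conjTranspose,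
    Matrix.mul_assoc, ← Matrix.mul_assoc (shiftOp n t), shiftOp_mul_self, one_mul,
    coinOp_mul_self]

lemma star_psi_dotProduct (m : Vertex n) (f : Vertex n → ℂ) :
    star (psi n t m) ⬝ᵥ (lift n t *ᵥ f) = f m := by
  rw [star_dotProduct_mulVec, ← lift_mulVec_single, Matrix.mulVec_mulVec, lift_isometry,
    Matrix.one_mulVec]
  simp

lemma star_psi_dotProduct_psi (m : Vertex n) : star (psi n t m) ⬝ᵥ psi n t m = 1 := by
  have h := star_psi_dotProduct n t m (Pi.single m 1)
  rwa [lift_mulVec_single, Pi.single_eq_same] at h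

lemma star_lift_dotProduct_lift (f g : Vertex n → ℂ) :
    star (lift n t *ᵥ f) ⬝ᵥ (lift n t *ᵥ g) = star f ⬝ᵥ g := by
  rw [star_dotProduct_mulVec, Matrix.mulVec_mulVec, lift_isometry, Matrix.one_mulVec]

lemma phi0_eq : phi0 n t = lift n t *ᵥ fun _ => ((1 / Real.sqrt ((n : ℝ) ^ 2) : ℝ) : ℂ) := by
  ext p
  simp only [phi0, lift_mulVec_apply, Pi.smul_apply, Finset.sum_apply, psi, smul_eq_mul]
  simp [mul_comm]

lemma normSq_startState : normSq (startState n t) = 1 := by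
  have h : star (startState n t) ⬝ᵥ startState n t = 1 := by
    have hs : star (startState n t) = Sum.elim (star (phi0 n t)) 0 := by
      ext i; rcases i with i | i <;> simp [startState]
    rw [hs, startState, sumElim_dotProduct_sumElim, phi0_eq, star_lift_dotProduct_lift]
    have hn : (n : ℂ) ≠ 0 := by exact_mod_cast NeZero.ne n
    simp only [dotProduct, Pi.star_apply, RCLike.star_def, Complex.conj_ofReal,
      Real.sqrt_sq (Nat.cast_nonneg n)]
    simp [Fintype.card_prod, ZMod.card]
    field_simp
  rw [star_dotProduct_self] at h
  exact_mod_cast h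

lemma normSq_targetState (m : Vertex n) (δ : ℝ) : normSq (targetState n t m δ) = 1 := by
  have h : star (targetState n t m δ) ⬝ᵥ targetState n t m δ = 1 := by
    have hs : star (targetState n t m δ) = Sum.elim ((Real.cos δ : ℂ) • star (psi n t m))
        ((Real.sin δ : ℂ) • star (psi n t m)) := by
      ext i
      rcases i with i | i <;>
        simp [targetState, -Complex.ofReal_cos, -Complex.ofReal_sin, Complex.conj_ofReal]
    rw [hs, targetState, sumElim_dotProduct_sumElim]
    simp only [smul_dotProduct, dotProduct_smul, star_psi_dotProduct_psi, smul_eq_mul, mul_one]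
    exact_mod_cast (by nlinarith [Real.sin_sq_add_cos_sq δ] :
      Real.cos δ * Real.cos δ + Real.sin δ * Real.sin δ = 1)
  rw [star_dotProduct_self] at h
  exact_mod_cast h

lemma searchOp_unitary (m : Vertex n) (δ : ℝ) :
    (searchOp n t m δ)ᴴ * searchOp n t m δ = 1 := by
  have hW : (tulsiWalk n t)ᴴ * tulsiWalk n t = 1 := by
    rw [tulsiWalk, Matrix.fromBlocks_conjTranspose, Matrix.fromBlocks_multiply, walkOp_unitary]
    simp
  have hO := reflection_unitary (normSq_targetState n t m δ)
  rw [← tulsiOracle] at hO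
  rw [searchOp, Matrix.conjTranspose_mul, Matrix.mul_assoc, ← Matrix.mul_assoc _ (tulsiWalk n t),
    hW, one_mul, hO]

lemma successProb_eq (m : Vertex n) (δ : ℝ) :
    successProb n t m δ = ‖star (targetState n t m δ) ⬝ᵥ
      ((searchOp n t m δ ^ iterations n t m δ) *ᵥ startState n t)‖ ^ 2 := by
  rw [successProb, run_circuit]

lemma successProb_le_one (m : Vertex n) (δ : ℝ) : successProb n t m δ ≤ 1 := by
  rw [successProb_eq]
  refine (norm_star_dotProduct_sq_le _ _).trans ?_
  rw [normSq_pow_mulVec (searchOp_unitary n t m δ), normSq_targetState, normSq_startState, one_mul]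

end Lift

/-! ### Eigenvectors of the search operator from Green's functions -/

section Eigenvectors

variable {n : ℕ} [NeZero n] {t : ℕ}

/-- `g` is the Green's function of the transition matrix at energy `c` with source `m`:
`(c - D) g = δ_m`. -/
def IsGreen (t : ℕ) (c : ℝ) (m : Vertex n) (g : Vertex n → ℂ) : Prop :=
  transition n t *ᵥ g = (c : ℂ) • g - Pi.single m 1

/-- `e^{iβ}`, written out in real and imaginary part. -/
noncomputable def phase (β : ℝ) : ℂ := (Real.cos β : ℂ) + (Real.sin β : ℂ) * Complex.I

/-- The vector `e^{-iβ} Ψ g - S Ψ g` of the path space. -/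
noncomputable def pathVec (t : ℕ) (β : ℝ) (g : Vertex n → ℂ) : Idx n t → ℂ :=
  phase (-β) • (lift n t *ᵥ g) - shiftOp n t *ᵥ (lift n t *ᵥ g)

/-- The candidate eigenvector of the search operator for the eigenvalue `e^{iβ}`; the coefficient
of the second component is `2 / (1 + e^{iβ})`. -/
noncomputable def searchVec (t : ℕ) (m : Vertex n) (δ β : ℝ) (g : Vertex n → ℂ) :
    AIdx n t → ℂ :=
  Sum.elim ((Real.cos δ : ℂ) • pathVec t β g)
    (((Real.sin δ : ℂ) * (1 - Real.tan (β / 2) * Complex.I)) • psi n t m)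

lemma phase_mul_phase_neg (β : ℝ) : phase β * phase (-β) = 1 := by
  have h : (Real.sin β : ℂ) ^ 2 + (Real.cos β : ℂ) ^ 2 = 1 := by
    exact_mod_cast Real.sin_sq_add_cos_sq β
  simp only [phase, Real.cos_neg, Real.sin_neg, Complex.ofReal_neg]
  linear_combination h - (Real.sin β : ℂ) ^ 2 * Complex.I_mul_I

lemma phase_add_phase_neg (β : ℝ) : phase β + phase (-β) = 2 * (Real.cos β : ℂ) := by
  simp only [phase, Real.cos_neg, Real.sin_neg, Complex.ofReal_neg]
  ring

lemma phase_eq_exp (β : ℝ) : phase β = Complex.exp (β * Complex.I) := by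
  rw [Complex.exp_mul_I, phase, Complex.ofReal_cos, Complex.ofReal_sin]

lemma star_phase (β : ℝ) : star (phase β) = phase (-β) := by
  simp only [phase, RCLike.star_def, map_add, map_mul, Complex.conj_ofReal, Complex.conj_I,
    Real.cos_neg, Real.sin_neg, Complex.ofReal_neg]
  ring

lemma phase_pow (β : ℝ) (Q : ℕ) : phase β ^ Q = phase (Q * β) := by
  rw [phase_eq_exp, phase_eq_exp, ← Complex.exp_nat_mul]
  push_cast
  ring_nf

lemma one_add_phase_mul {β : ℝ} (hβ : Real.cos (β / 2) ≠ 0) :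
    (1 + phase β) * (1 - Real.tan (β / 2) * Complex.I) = 2 := by
  have hc : (Real.cos (β / 2) : ℂ) ≠ 0 := by exact_mod_cast hβ
  have h1 : Real.cos β = 2 * Real.cos (β / 2) ^ 2 - 1 := by
    rw [← Real.cos_two_mul]; ring_nf
  have h2 : Real.sin β = 2 * Real.sin (β / 2) * Real.cos (β / 2) := by
    rw [← Real.sin_two_mul]; ring_nf
  have h3 : (Real.sin (β / 2) : ℂ) ^ 2 + (Real.cos (β / 2) : ℂ) ^ 2 = 1 := by
    exact_mod_cast Real.sin_sq_add_cos_sq (β / 2)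
  rw [phase, h1, h2, Real.tan_eq_sin_div_cos]
  push_cast [-Complex.ofReal_cos, -Complex.ofReal_sin]
  field_simp
  linear_combination 2 * (Real.cos (β / 2) : ℂ) * h3 -
    2 * (Real.cos (β / 2) : ℂ) * (Real.sin (β / 2) : ℂ) ^ 2 * Complex.I_mul_I

lemma walkOp_mulVec_lift (f : Vertex n → ℂ) :
    walkOp n t *ᵥ (lift n t *ᵥ f) = shiftOp n t *ᵥ (lift n t *ᵥ f) := by
  rw [walkOp, Matrix.mulVec_mulVec, Matrix.mulVec_mulVec, Matrix.mul_assoc, coinOp_mul_lift]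

lemma walkOp_mulVec_shift_lift (f : Vertex n → ℂ) :
    walkOp n t *ᵥ (shiftOp n t *ᵥ (lift n t *ᵥ f)) =
      (2 : ℂ) • (shiftOp n t *ᵥ (lift n t *ᵥ (transition n t *ᵥ f))) - lift n t *ᵥ f := by
  have h : walkOp n t * (shiftOp n t * lift n t) =
      (2 : ℂ) • (shiftOp n t * (lift n t * transition n t)) - lift n t := by
    rw [walkOp, coinOp_eq, Matrix.mul_sub, Matrix.sub_mul, Matrix.mul_one, Matrix.mul_smul,
      Matrix.smul_mul, transition, ← Matrix.mul_assoc (shiftOp n t) (shiftOp n t),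
      shiftOp_mul_self, Matrix.one_mul]
    simp only [Matrix.mul_assoc]
  rw [Matrix.mulVec_mulVec, Matrix.mulVec_mulVec, Matrix.mul_assoc, h, Matrix.sub_mulVec,
    Matrix.smul_mulVec, Matrix.mulVec_mulVec, Matrix.mulVec_mulVec]
  simp only [Matrix.mul_assoc]

/-- The walk maps the path vector of a Green's function to its multiple by `e^{iβ}`, up to a source
term at the marked vertex. -/
lemma walkOp_mulVec_pathVec {β : ℝ} {m : Vertex n} {g : Vertex n → ℂ}
    (hg : IsGreen t (Real.cos β) m g) :
    walkOp n t *ᵥ pathVec t β g =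
      phase β • pathVec t β g + (2 : ℂ) • (walkOp n t *ᵥ psi n t m) := by
  rw [pathVec, Matrix.mulVec_sub, Matrix.mulVec_smul, walkOp_mulVec_shift_lift, hg,
    ← lift_mulVec_single, walkOp_mulVec_lift, walkOp_mulVec_lift, Matrix.mulVec_sub,
    Matrix.mulVec_smul, Matrix.mulVec_sub, Matrix.mulVec_smul, smul_sub, smul_sub, smul_smul,
    smul_smul, phase_mul_phase_neg, ← phase_add_phase_neg, add_smul, one_smul]
  abel

lemma tulsiWalk_mulVec (x y : Idx n t → ℂ) :
    tulsiWalk n t *ᵥ Sum.elim x y = Sum.elim (walkOp n t *ᵥ x) (-y) := by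
  rw [tulsiWalk, Matrix.fromBlocks_mulVec]
  simp [Matrix.neg_mulVec]

lemma tulsiWalk_mulVec_searchVec {β : ℝ} {m : Vertex n} {g : Vertex n → ℂ} (δ : ℝ)
    (hβ : Real.cos (β / 2) ≠ 0) (hg : IsGreen t (Real.cos β) m g) :
    tulsiWalk n t *ᵥ searchVec t m δ β g = phase β • searchVec t m δ β g +
      (2 : ℂ) • (tulsiWalk n t *ᵥ targetState n t m δ) := by
  have h := one_add_phase_mul hβ
  rw [searchVec, targetState, tulsiWalk_mulVec, tulsiWalk_mulVec, Matrix.mulVec_smul,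
    walkOp_mulVec_pathVec hg, Matrix.mulVec_smul]
  ext i
  rcases i with i | i
  · simp only [Pi.add_apply, Pi.smul_apply, Sum.elim_inl, smul_eq_mul]
    ring
  · simp only [Pi.add_apply, Pi.smul_apply, Sum.elim_inr, smul_eq_mul, Pi.neg_apply]
    linear_combination (-(Real.sin δ : ℂ) * psi n t m i) * h

lemma star_sumElim {I J : Type} (x : I → ℂ) (y : J → ℂ) :
    star (Sum.elim x y) = Sum.elim (star x) (star y) := by
  ext i; rcases i with i | i <;> simp

lemma star_real_smul {I : Type} (r : ℝ) (x : I → ℂ) :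
    star ((r : ℂ) • x) = (r : ℂ) • star x := by
  ext i; simp

lemma star_lift_dotProduct_shift_lift (f g : Vertex n → ℂ) :
    star (lift n t *ᵥ f) ⬝ᵥ (shiftOp n t *ᵥ (lift n t *ᵥ g)) =
      star f ⬝ᵥ (transition n t *ᵥ g) := by
  rw [transition, ← Matrix.mulVec_mulVec, ← Matrix.mulVec_mulVec, star_dotProduct_mulVec _ f,
    Matrix.conjTranspose_conjTranspose]

lemma star_single_dotProduct (m : Vertex n) (f : Vertex n → ℂ) :
    star (Pi.single m (1 : ℂ)) ⬝ᵥ f = f m := by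
  rw [← Pi.single_star]
  simp

lemma star_psi_dotProduct_pathVec {β : ℝ} {m : Vertex n} {g : Vertex n → ℂ}
    (hg : IsGreen t (Real.cos β) m g) :
    star (psi n t m) ⬝ᵥ pathVec t β g = 1 - Real.sin β * g m * Complex.I := by
  rw [pathVec, dotProduct_sub, dotProduct_smul, star_psi_dotProduct, ← lift_mulVec_single,
    star_lift_dotProduct_shift_lift, hg, star_single_dotProduct]
  simp only [Pi.sub_apply, Pi.smul_apply, Pi.single_eq_same, smul_eq_mul, phase, Real.cos_neg,
    Real.sin_neg, Complex.ofReal_neg]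
  ring

lemma star_target_dotProduct_searchVec {β : ℝ} {m : Vertex n} {g : Vertex n → ℂ} {G : ℝ} (δ : ℝ)
    (hg : IsGreen t (Real.cos β) m g) (hG : g m = G) :
    star (targetState n t m δ) ⬝ᵥ searchVec t m δ β g =
      1 - ((Real.cos δ ^ 2 * Real.sin β * G + Real.sin δ ^ 2 * Real.tan (β / 2) : ℝ) : ℂ) *
        Complex.I := by
  have h : (Real.sin δ : ℂ) ^ 2 + (Real.cos δ : ℂ) ^ 2 = 1 := by
    exact_mod_cast Real.sin_sq_add_cos_sq δ
  rw [targetState, searchVec, star_sumElim, sumElim_dotProduct_sumElim, star_real_smul,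
    star_real_smul, smul_dotProduct, dotProduct_smul, smul_dotProduct, dotProduct_smul,
    star_psi_dotProduct_pathVec hg, star_psi_dotProduct_psi n t, hG]
  push_cast [-Complex.ofReal_cos, -Complex.ofReal_sin, -Complex.ofReal_tan]
  simp only [smul_eq_mul]
  linear_combination h

lemma searchOp_mulVec (m : Vertex n) (δ : ℝ) (w : AIdx n t → ℂ) :
    searchOp n t m δ *ᵥ w = tulsiWalk n t *ᵥ w -
      (2 * (star (targetState n t m δ) ⬝ᵥ w)) • (tulsiWalk n t *ᵥ targetState n t m δ) := by
  rw [searchOp, ← Matrix.mulVec_mulVec, tulsiOracle, Matrix.sub_mulVec, Matrix.one_mulVec,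
    Matrix.smul_mulVec, proj_mulVec, smul_smul, Matrix.mulVec_sub, Matrix.mulVec_smul]

/-- A solution `β` of the secular equation gives an eigenvector of the search operator. -/
lemma searchOp_mulVec_searchVec {β : ℝ} {m : Vertex n} {g : Vertex n → ℂ} {G δ : ℝ}
    (hβ : Real.cos (β / 2) ≠ 0) (hg : IsGreen t (Real.cos β) m g) (hG : g m = G)
    (hE : Real.cos δ ^ 2 * Real.sin β * G + Real.sin δ ^ 2 * Real.tan (β / 2) = 0) :
    searchOp n t m δ *ᵥ searchVec t m δ β g = phase β • searchVec t m δ β g := by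
  rw [searchOp_mulVec, tulsiWalk_mulVec_searchVec δ hβ hg, star_target_dotProduct_searchVec δ hg hG,
    hE]
  simp

/-- The transition matrix has no eigenvalue at an energy where Green's functions exist. -/
lemma eq_zero_of_transition_mulVec {c : ℝ} (hc : ∀ m : Vertex n, ∃ g, IsGreen t c m g)
    {x : Vertex n → ℂ} (hx : transition n t *ᵥ x = (c : ℂ) • x) : x = 0 := by
  funext m
  obtain ⟨g, hg⟩ := hc m
  have h1 : star g ⬝ᵥ (transition n t *ᵥ x) = (c : ℂ) * (star g ⬝ᵥ x) := by
    rw [hx, dotProduct_smul, smul_eq_mul]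
  rw [star_dotProduct_mulVec, transition_conjTranspose, hg, star_sub, star_real_smul,
    sub_dotProduct, smul_dotProduct, star_single_dotProduct, smul_eq_mul] at h1
  simpa using h1

/-- An eigenvector of the walk operator with a non-real eigenvalue of real part `c` projects to an
eigenvector of the transition matrix with eigenvalue `c`; hence there is none if `c` is not in the
spectrum of the transition matrix. -/
lemma eq_zero_of_walkOp_mulVec {β : ℝ} (hβ : Real.sin β ≠ 0)
    (hc : ∀ m : Vertex n, ∃ g, IsGreen t (Real.cos β) m g)
    {w : Idx n t → ℂ} (hw : walkOp n t *ᵥ w = phase β • w) : w = 0 := by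
  set x : Vertex n → ℂ := (lift n t)ᴴ *ᵥ w with hx
  have hSS : ∀ v, shiftOp n t *ᵥ (shiftOp n t *ᵥ v) = v := fun v => by
    rw [Matrix.mulVec_mulVec, shiftOp_mul_self, Matrix.one_mulVec]
  have hC : coinOp n t *ᵥ w = (2 : ℂ) • (lift n t *ᵥ x) - w := by
    rw [coinOp_eq, Matrix.sub_mulVec, Matrix.smul_mulVec, Matrix.one_mulVec, hx,
      Matrix.mulVec_mulVec]
  have h1 : (2 : ℂ) • (shiftOp n t *ᵥ (lift n t *ᵥ x)) - shiftOp n t *ᵥ w = phase β • w := by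
    rw [← hw, walkOp, ← Matrix.mulVec_mulVec, hC, Matrix.mulVec_sub, Matrix.mulVec_smul]
  have h2 : (2 : ℂ) • (lift n t *ᵥ x) - w = phase β • (shiftOp n t *ᵥ w) := by
    have := congrArg (shiftOp n t *ᵥ ·) h1
    simpa only [Matrix.mulVec_sub, Matrix.mulVec_smul, hSS] using this
  have hL : ∀ v, (lift n t)ᴴ *ᵥ (lift n t *ᵥ v) = v := fun v => by
    rw [Matrix.mulVec_mulVec, lift_isometry, Matrix.one_mulVec]
  have hx0 : x = 0 := by
    refine eq_zero_of_transition_mulVec hc ?_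
    have h3 := congrArg ((lift n t)ᴴ *ᵥ ·) h1
    have h4 := congrArg ((lift n t)ᴴ *ᵥ ·) h2
    simp only [Matrix.mulVec_sub, Matrix.mulVec_smul, hL] at h3 h4
    have hD : (lift n t)ᴴ *ᵥ (shiftOp n t *ᵥ (lift n t *ᵥ x)) = transition n t *ᵥ x := by
      rw [transition, Matrix.mulVec_mulVec, Matrix.mulVec_mulVec, Matrix.mul_assoc]
    rw [hD] at h3
    rw [← hx] at h3 h4
    funext u
    have h3u := congrFun h3 u
    have h4u := congrFun h4 u
    simp only [Pi.sub_apply, Pi.smul_apply, smul_eq_mul] at h3u h4u ⊢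
    linear_combination (1 / 2 : ℂ) * h3u - (1 / 2 : ℂ) * phase (-β) * h4u -
      (1 / 2 : ℂ) * ((lift n t)ᴴ *ᵥ (shiftOp n t *ᵥ w)) u * phase_mul_phase_neg β +
      (1 / 2 : ℂ) * x u * phase_add_phase_neg β
  rw [hx0, Matrix.mulVec_zero, Matrix.mulVec_zero, smul_zero, zero_sub] at h1
  rw [hx0, Matrix.mulVec_zero, smul_zero, zero_sub] at h2
  funext p
  have h1p := congrFun h1 p
  have h2p := congrFun h2 p
  simp only [Pi.neg_apply, Pi.smul_apply, smul_eq_mul] at h1p h2p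
  have h5 : ((Real.sin β : ℂ) * Complex.I) * w p = 0 := by
    have h6 : phase β - phase (-β) = 2 * ((Real.sin β : ℂ) * Complex.I) := by
      simp only [phase, Real.cos_neg, Real.sin_neg, Complex.ofReal_neg]; ring
    linear_combination (-(1 / 2 : ℂ)) * w p * h6 - (1 / 2 : ℂ) * h1p +
      (1 / 2 : ℂ) * phase (-β) * h2p + (1 / 2 : ℂ) * (shiftOp n t *ᵥ w) p * phase_mul_phase_neg β
  have h7 : ((Real.sin β : ℂ) * Complex.I) ≠ 0 :=
    mul_ne_zero (by exact_mod_cast hβ) Complex.I_ne_zero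
  exact (mul_eq_zero.mp h5).resolve_left h7

lemma cos_half_ne_zero {β : ℝ} (hβ : Real.sin β ≠ 0) : Real.cos (β / 2) ≠ 0 := by
  intro h
  apply hβ
  have h2 := Real.sin_two_mul (β / 2)
  rw [h, mul_zero, mul_div_cancel₀ β two_ne_zero] at h2
  exact h2

/-- Every non-real eigenvalue of the search operator whose real part is not in the spectrum of the
transition matrix satisfies the secular equation. -/
lemma secular_of_eigenvector {β : ℝ} {m : Vertex n} {g : Vertex n → ℂ} {G δ : ℝ}
    (hβ : Real.sin β ≠ 0) (hc : ∀ m : Vertex n, ∃ g, IsGreen t (Real.cos β) m g)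
    (hg : IsGreen t (Real.cos β) m g) (hG : g m = G) {w : AIdx n t → ℂ} (hw0 : w ≠ 0)
    (hw : searchOp n t m δ *ᵥ w = phase β • w) :
    Real.cos δ ^ 2 * Real.sin β * G + Real.sin δ ^ 2 * Real.tan (β / 2) = 0 := by
  have hβ2 := cos_half_ne_zero hβ
  set x := star (targetState n t m δ) ⬝ᵥ w with hx
  set v := searchVec t m δ β g with hv
  have hd : tulsiWalk n t *ᵥ (w - x • v) = phase β • (w - x • v) := by
    rw [searchOp_mulVec, sub_eq_iff_eq_add] at hw
    rw [Matrix.mulVec_sub, Matrix.mulVec_smul, hw, hv, tulsiWalk_mulVec_searchVec δ hβ2 hg, ← hx,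
      smul_add, smul_smul, smul_sub, smul_smul, smul_smul, mul_comm x 2, mul_comm x (phase β)]
    abel
  have hd0 : w - x • v = 0 := by
    obtain ⟨a, b, hab⟩ : ∃ a b, w - x • v = Sum.elim a b :=
      ⟨_, _, (Sum.elim_comp_inl_inr _).symm⟩
    rw [hab, tulsiWalk_mulVec] at hd
    have ha : a = 0 := by
      refine eq_zero_of_walkOp_mulVec hβ hc ?_
      funext p
      simpa using congrFun hd (Sum.inl p)
    have hb : b = 0 := by
      funext p
      have h := congrFun hd (Sum.inr p)
      simp only [Sum.elim_inr, Pi.neg_apply, Pi.smul_apply, smul_eq_mul] at h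
      have h2 : (1 + phase β) * b p = 0 := by linear_combination -h
      refine (mul_eq_zero.mp h2).resolve_left fun h3 => ?_
      have h4 := one_add_phase_mul hβ2
      rw [h3, zero_mul] at h4
      norm_num at h4
    rw [hab, ha, hb]
    ext i; rcases i with i | i <;> simp
  have hwv : w = x • v := sub_eq_zero.mp hd0
  have hx0 : x ≠ 0 := fun h => hw0 (by rw [hwv, h, zero_smul])
  have h1 : x = x * (star (targetState n t m δ) ⬝ᵥ v) := by
    conv_lhs => rw [hx, hwv, dotProduct_smul, smul_eq_mul]
  rw [hv, star_target_dotProduct_searchVec δ hg hG] at h1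
  have h2 := mul_left_cancel₀ hx0 ((mul_one x).trans h1)
  have h3 := congrArg Complex.im h2
  rw [Complex.sub_im, Complex.mul_I_im, Complex.ofReal_re, Complex.one_im] at h3
  linarith

lemma transition_mulVec_const (a : ℂ) : transition n t *ᵥ (fun _ => a) = fun _ => a := by
  funext u
  rw [transition_mulVec_apply, Finset.sum_const, Finset.card_univ, card_labels, nsmul_eq_mul]
  push_cast
  rw [inv_mul_cancel_left₀ (pow_ne_zero t (by norm_num : (4 : ℂ) ≠ 0))]

/-- The overlap of the starting state with the eigenvector. -/
lemma star_start_dotProduct_searchVec {β : ℝ} {m : Vertex n} {g : Vertex n → ℂ} (δ : ℝ)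
    (hβ : Real.sin (β / 2) ≠ 0) (hg : IsGreen t (Real.cos β) m g) :
    star (startState n t) ⬝ᵥ searchVec t m δ β g =
      ((Real.cos δ / n : ℝ) : ℂ) * (1 + (Real.cos (β / 2) / Real.sin (β / 2) : ℝ) * Complex.I) := by
  have hsum : ((Real.cos β : ℂ) - 1) * ∑ u, g u = 1 := by
    have h1 : star (fun _ : Vertex n => (1 : ℂ)) ⬝ᵥ (transition n t *ᵥ g) =
        star (fun _ : Vertex n => (1 : ℂ)) ⬝ᵥ g := by
      rw [star_dotProduct_mulVec, transition_conjTranspose, transition_mulVec_const]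
    rw [hg] at h1
    simp only [dotProduct, Pi.star_apply, star_one, one_mul, Pi.sub_apply, Pi.smul_apply,
      smul_eq_mul, Finset.sum_sub_distrib, ← Finset.mul_sum, Finset.sum_pi_single',
      Finset.mem_univ, if_true] at h1
    linear_combination h1
  have hs : (Real.sin (β / 2) : ℂ) ≠ 0 := by exact_mod_cast hβ
  have hn : (n : ℂ) ≠ 0 := by exact_mod_cast NeZero.ne n
  have h1 : Real.cos β = 2 * Real.cos (β / 2) ^ 2 - 1 := by
    rw [← Real.cos_two_mul]; ring_nf
  have h2 : Real.sin β = 2 * Real.sin (β / 2) * Real.cos (β / 2) := by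
    rw [← Real.sin_two_mul]; ring_nf
  have h3 : (Real.sin (β / 2) : ℂ) ^ 2 + (Real.cos (β / 2) : ℂ) ^ 2 = 1 := by
    exact_mod_cast Real.sin_sq_add_cos_sq (β / 2)
  have hg' : ∑ u, g u = - 1 / (2 * (Real.sin (β / 2) : ℂ) ^ 2) := by
    have h4 : ((Real.cos β : ℂ) - 1) = -2 * (Real.sin (β / 2) : ℂ) ^ 2 := by
      rw [h1]
      push_cast [-Complex.ofReal_cos, -Complex.ofReal_sin]
      linear_combination 2 * h3
    rw [h4] at hsum
    field_simp
    linear_combination -hsum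
  have hΦ : star (phi0 n t) ⬝ᵥ pathVec t β g = (1 / n : ℂ) * ((phase (-β) - 1) * ∑ u, g u) := by
    rw [phi0_eq, pathVec, dotProduct_sub, dotProduct_smul, star_lift_dotProduct_lift,
      star_lift_dotProduct_shift_lift, star_dotProduct_mulVec, transition_conjTranspose,
      transition_mulVec_const, Real.sqrt_sq (Nat.cast_nonneg n)]
    simp only [dotProduct, Pi.star_apply, RCLike.star_def, Complex.conj_ofReal, smul_eq_mul,
      ← Finset.mul_sum]
    push_cast
    ring
  rw [startState, searchVec, star_sumElim, sumElim_dotProduct_sumElim, dotProduct_smul, hΦ, hg',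
    phase, Real.cos_neg, Real.sin_neg, h1, h2, smul_eq_mul]
  simp only [star_zero, zero_dotProduct, add_zero]
  push_cast [-Complex.ofReal_cos, -Complex.ofReal_sin]
  field_simp
  linear_combination -2 * (Real.cos δ : ℂ) * h3

/-- The squared norm of the eigenvector. -/
lemma normSq_searchVec {β : ℝ} {m : Vertex n} {g : Vertex n → ℂ} {G : ℝ} (δ : ℝ)
    (hβ : Real.cos (β / 2) ≠ 0) (hg : IsGreen t (Real.cos β) m g) (hG : g m = G) :
    normSq (searchVec t m δ β g) =
      Real.cos δ ^ 2 * (2 * Real.sin β ^ 2 * normSq g + 2 * Real.cos β * G) +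
        Real.sin δ ^ 2 / Real.cos (β / 2) ^ 2 := by
  have hgD : star g ⬝ᵥ (transition n t *ᵥ g) = ((Real.cos β * normSq g - G : ℝ) : ℂ) := by
    rw [hg, dotProduct_sub, dotProduct_smul, star_dotProduct_self, star_dotProduct_comm g,
      star_single_dotProduct, hG]
    simp
  have hp : star (pathVec t β g) ⬝ᵥ pathVec t β g =
      ((2 * Real.sin β ^ 2 * normSq g + 2 * Real.cos β * G : ℝ) : ℂ) := by
    have h2 : star (shiftOp n t *ᵥ (lift n t *ᵥ g)) ⬝ᵥ (lift n t *ᵥ g) =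
        ((Real.cos β * normSq g - G : ℝ) : ℂ) := by
      rw [star_dotProduct_comm, star_lift_dotProduct_shift_lift, hgD]
      exact Complex.conj_ofReal _
    have h3 : star (shiftOp n t *ᵥ (lift n t *ᵥ g)) ⬝ᵥ (shiftOp n t *ᵥ (lift n t *ᵥ g)) =
        (normSq g : ℂ) := by
      rw [star_mulVec_dotProduct_mulVec (by rw [shiftOp_conjTranspose, shiftOp_mul_self]),
        star_lift_dotProduct_lift, star_dotProduct_self]
    have h4 : (Real.sin β : ℂ) ^ 2 + (Real.cos β : ℂ) ^ 2 = 1 := by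
      exact_mod_cast Real.sin_sq_add_cos_sq β
    rw [pathVec, star_sub, star_smul, sub_dotProduct, dotProduct_sub, dotProduct_sub,
      smul_dotProduct, smul_dotProduct, dotProduct_smul, dotProduct_smul,
      star_lift_dotProduct_lift, star_lift_dotProduct_shift_lift, hgD, h2, h3,
      star_dotProduct_self, star_phase, neg_neg]
    simp only [smul_eq_mul]
    push_cast [-Complex.ofReal_cos, -Complex.ofReal_sin]
    linear_combination (normSq g : ℂ) * phase_mul_phase_neg β -
      (Real.cos β * normSq g - G : ℂ) * phase_add_phase_neg β - 2 * (normSq g : ℂ) * h4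
  have hT : (1 + Real.tan (β / 2) ^ 2) = 1 / Real.cos (β / 2) ^ 2 := by
    rw [Real.tan_eq_sin_div_cos]
    field_simp
    rw [add_comm, Real.sin_sq_add_cos_sq]
  have h : star (searchVec t m δ β g) ⬝ᵥ searchVec t m δ β g =
      ((Real.cos δ ^ 2 * (2 * Real.sin β ^ 2 * normSq g + 2 * Real.cos β * G) +
        Real.sin δ ^ 2 / Real.cos (β / 2) ^ 2 : ℝ) : ℂ) := by
    have hst : star ((Real.sin δ : ℂ) * (1 - Real.tan (β / 2) * Complex.I)) =
        (Real.sin δ : ℂ) * (1 + Real.tan (β / 2) * Complex.I) := by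
      simp only [RCLike.star_def, map_mul, map_sub, map_one, Complex.conj_ofReal, Complex.conj_I]
      ring
    rw [searchVec, star_sumElim, sumElim_dotProduct_sumElim, star_real_smul, smul_dotProduct,
      dotProduct_smul, hp, star_smul, smul_dotProduct, dotProduct_smul, star_psi_dotProduct_psi n t,
      div_eq_mul_one_div (Real.sin δ ^ 2), ← hT, hst]
    simp only [smul_eq_mul]
    push_cast [-Complex.ofReal_cos, -Complex.ofReal_sin, -Complex.ofReal_tan]
    linear_combination (-(Real.sin δ : ℂ) ^ 2 * (Real.tan (β / 2) : ℂ) ^ 2) * Complex.I_mul_I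
  rw [star_dotProduct_self] at h
  exact_mod_cast h

end Eigenvectors

/-! ### Fourier analysis on the grid -/

section Fourier

variable {n : ℕ} [NeZero n]

/-- The character `u ↦ e^{2πi (k·u)/n}` of the grid. -/
noncomputable def character (k u : Vertex n) : ℂ := ZMod.stdAddChar (k.1 * u.1 + k.2 * u.2)

/-- The eigenvalue `(cos (2π k₁/n) + cos (2π k₂/n)) / 2` of the single-step walk, each cosine being
the real part of an additive character. -/
noncomputable def eig (k : Vertex n) : ℝ :=
  ((ZMod.stdAddChar k.1 : ℂ).re + (ZMod.stdAddChar k.2 : ℂ).re) / 2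

lemma character_add (k u v : Vertex n) : character k (u + v) = character k u * character k v := by
  simp only [character, Prod.fst_add, Prod.snd_add]
  rw [← AddChar.map_add_eq_mul]
  congr 1
  ring

lemma sum_dir (f : Dir → ℂ) :
    ∑ d, f d = f Dir.right + f Dir.left + f Dir.up + f Dir.down := by
  change ∑ d ∈ {Dir.right, Dir.left, Dir.up, Dir.down}, f d = _
  rw [Finset.sum_insert (by decide), Finset.sum_insert (by decide), Finset.sum_insert (by decide),
    Finset.sum_singleton]
  ring

lemma stdAddChar_add_neg (a : ZMod n) :
    (ZMod.stdAddChar a : ℂ) + ZMod.stdAddChar (-a) = 2 * ((ZMod.stdAddChar a : ℂ).re : ℂ) := by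
  rw [AddChar.map_neg_eq_conj, Complex.add_conj]
  push_cast
  rfl

lemma sum_character_gridRot (k u : Vertex n) :
    ∑ d, character k (gridRot n (u, d)).1 = (4 * eig k : ℝ) * character k u := by
  obtain ⟨x, y⟩ := u
  have h1 := stdAddChar_add_neg k.1
  have h2 := stdAddChar_add_neg k.2
  have e1 : k.1 * (x + 1) + k.2 * y = (k.1 * x + k.2 * y) + k.1 := by ring
  have e2 : k.1 * (x - 1) + k.2 * y = (k.1 * x + k.2 * y) + -k.1 := by ring
  have e3 : k.1 * x + k.2 * (y + 1) = (k.1 * x + k.2 * y) + k.2 := by ring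
  have e4 : k.1 * x + k.2 * (y - 1) = (k.1 * x + k.2 * y) + -k.2 := by ring
  rw [sum_dir]
  simp only [gridRot, character, eig, e1, e2, e3, e4, AddChar.map_add_eq_mul]
  push_cast
  linear_combination (ZMod.stdAddChar (k.1 * x) * ZMod.stdAddChar (k.2 * y) : ℂ) * (h1 + h2)

lemma sum_character_powRot (t : ℕ) (k u : Vertex n) :
    ∑ g : Fin t → Dir, character k (powRot (gridRot n) t (u, g)).1 =
      ((4 * eig k) ^ t : ℝ) * character k u := by
  induction t generalizing u with
  | zero => simp [powRot]
  | succ t ih =>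
    rw [← (Fin.consEquiv fun _ : Fin (t + 1) => Dir).sum_comp, Fintype.sum_prod_type]
    have h : ∀ d : Dir, ∑ g : Fin t → Dir, character k (powRot (gridRot n) (t + 1)
        (u, (Fin.consEquiv fun _ : Fin (t + 1) => Dir) (d, g))).1 =
          ((4 * eig k) ^ t : ℝ) * character k (gridRot n (u, d)).1 := fun d => by
      rw [← ih]
      rfl
    rw [Finset.sum_congr rfl fun d _ => h d, ← Finset.mul_sum, sum_character_gridRot, pow_succ]
    push_cast
    ring

lemma transition_mulVec_character (t : ℕ) (k : Vertex n) :
    transition n t *ᵥ character k = ((eig k ^ t : ℝ) : ℂ) • character k := by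
  funext u
  rw [transition_mulVec_apply, sum_character_powRot, mul_pow, Pi.smul_apply, smul_eq_mul]
  push_cast
  rw [mul_assoc, inv_mul_cancel_left₀ (pow_ne_zero t (by norm_num : (4 : ℂ) ≠ 0))]

/-- The kernel `N⁻¹ ∑_k χ_k(u - m) / (c - λ_k^t)^j` of the `j`-th power of the resolvent. -/
noncomputable def resolventPow (t : ℕ) (c : ℝ) (j : ℕ) (m : Vertex n) : Vertex n → ℂ :=
  ∑ k : Vertex n, (((n : ℝ) ^ 2)⁻¹ * ((c - eig k ^ t) ^ j)⁻¹ * character k (-m)) • character k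

lemma character_self_neg (k m : Vertex n) : character k (-m) * character k m = 1 := by
  rw [← character_add, neg_add_cancel]
  simp [character]

lemma resolventPow_zero (t : ℕ) (c : ℝ) (m : Vertex n) :
    resolventPow t c 0 m = Pi.single m 1 := by
  have hn : (n : ℂ) ≠ 0 := by exact_mod_cast NeZero.ne n
  funext u
  have h1 : resolventPow t c 0 m u = ((n : ℂ) ^ 2)⁻¹ *
      ∑ k : Vertex n, ZMod.stdAddChar (k.1 * (u.1 - m.1)) * ZMod.stdAddChar (k.2 * (u.2 - m.2)) := by
    rw [resolventPow, Finset.sum_apply, Finset.mul_sum]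
    refine Finset.sum_congr rfl fun k _ => ?_
    have e : k.1 * (-m + u).1 + k.2 * (-m + u).2 = k.1 * (u.1 - m.1) + k.2 * (u.2 - m.2) := by
      simp only [Prod.fst_add, Prod.snd_add, Prod.fst_neg, Prod.snd_neg]
      ring
    rw [Pi.smul_apply, smul_eq_mul, mul_assoc, ← character_add, character, e,
      AddChar.map_add_eq_mul]
    simp
  rw [h1, Fintype.sum_prod_type]
  dsimp only
  rw [← Finset.sum_mul_sum,
    AddChar.sum_mulShift _ (ZMod.isPrimitive_stdAddChar n),
    AddChar.sum_mulShift _ (ZMod.isPrimitive_stdAddChar n), ZMod.card, Pi.single_apply]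
  simp only [Prod.ext_iff, sub_eq_zero]
  by_cases ha : u.1 = m.1 <;> by_cases hb : u.2 = m.2 <;> simp [ha, hb]
  field_simp

lemma transition_mulVec_resolventPow {t : ℕ} {c : ℝ} (hc : ∀ k : Vertex n, c - eig k ^ t ≠ 0)
    (j : ℕ) (m : Vertex n) :
    transition n t *ᵥ resolventPow t c (j + 1) m =
      (c : ℂ) • resolventPow t c (j + 1) m - resolventPow t c j m := by
  simp only [resolventPow, Matrix.mulVec_sum, Matrix.mulVec_smul, transition_mulVec_character,
    Finset.smul_sum, ← Finset.sum_sub_distrib]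
  refine Finset.sum_congr rfl fun k _ => ?_
  have h : ((c : ℂ) - (eig k : ℂ) ^ t) ≠ 0 := by exact_mod_cast hc k
  funext u
  simp only [Pi.sub_apply, Pi.smul_apply, smul_eq_mul]
  push_cast
  field_simp
  ring

lemma resolventPow_self (t : ℕ) (c : ℝ) (j : ℕ) (m : Vertex n) :
    resolventPow t c j m m =
      ((((n : ℝ) ^ 2)⁻¹ * ∑ k : Vertex n, ((c - eig k ^ t) ^ j)⁻¹ : ℝ) : ℂ) := by
  rw [resolventPow, Finset.sum_apply, Finset.mul_sum, Complex.ofReal_sum]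
  refine Finset.sum_congr rfl fun k _ => ?_
  rw [Pi.smul_apply, smul_eq_mul, mul_assoc, character_self_neg, mul_one]
  push_cast
  rfl

/-- Off the spectrum, the Green's function exists; its value at the source and its norm are
spectral sums. -/
lemma exists_isGreen {t : ℕ} {c : ℝ} (hc : ∀ k : Vertex n, c - eig k ^ t ≠ 0) (m : Vertex n) :
    ∃ g, IsGreen t c m g ∧
      g m = ((((n : ℝ) ^ 2)⁻¹ * ∑ k : Vertex n, (c - eig k ^ t)⁻¹ : ℝ) : ℂ) ∧
      normSq g = ((n : ℝ) ^ 2)⁻¹ * ∑ k : Vertex n, ((c - eig k ^ t) ^ 2)⁻¹ := by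
  have h1 := transition_mulVec_resolventPow hc 0 m
  have h2 := transition_mulVec_resolventPow hc 1 m
  have e1 := resolventPow_self t c 1 m
  have e2 := resolventPow_self t c 2 m
  simp only [zero_add, one_add_one_eq_two, pow_one, resolventPow_zero] at h1 h2 e1
  refine ⟨resolventPow t c 1 m, h1, e1, ?_⟩
  -- Self-adjointness of the resolvent turns `‖g‖²` into the diagonal entry of its square.
  have h : star (resolventPow t c 1 m) ⬝ᵥ resolventPow t c 1 m = resolventPow t c 2 m m := by
    have h3 : star (resolventPow t c 1 m) ⬝ᵥ (transition n t *ᵥ resolventPow t c 2 m) =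
        (c : ℂ) * (star (resolventPow t c 1 m) ⬝ᵥ resolventPow t c 2 m) -
          resolventPow t c 2 m m := by
      rw [star_dotProduct_mulVec, transition_conjTranspose, h1, star_sub, star_real_smul,
        sub_dotProduct, smul_dotProduct, star_single_dotProduct, smul_eq_mul]
    rw [h2, dotProduct_sub, dotProduct_smul, smul_eq_mul] at h3
    linear_combination -h3
  rw [star_dotProduct_self, e2] at h
  exact_mod_cast h

lemma eig_zero : eig (0 : Vertex n) = 1 := by
  simp [eig]

lemma stdAddChar_re (a : ZMod n) :
    (ZMod.stdAddChar a : ℂ).re = 1 - 2 * Real.sin (Real.pi * (a.valMinAbs : ℝ) / n) ^ 2 := by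
  have h : (ZMod.stdAddChar a : ℂ) =
      Complex.exp (((2 * (Real.pi * (a.valMinAbs : ℝ) / n) : ℝ) : ℂ) * Complex.I) := by
    conv_lhs => rw [← ZMod.coe_valMinAbs a, ZMod.stdAddChar_coe]
    congr 1
    push_cast
    ring
  rw [h, Complex.exp_ofReal_mul_I_re, Real.cos_two_mul, Real.cos_sq']
  ring

lemma one_sub_eig (k : Vertex n) :
    1 - eig k = Real.sin (Real.pi * (k.1.valMinAbs : ℝ) / n) ^ 2 +
      Real.sin (Real.pi * (k.2.valMinAbs : ℝ) / n) ^ 2 := by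
  rw [eig, stdAddChar_re, stdAddChar_re]
  ring

lemma abs_sin_valMinAbs_ge (a : ZMod n) :
    4 * (a.valMinAbs : ℝ) ^ 2 / n ^ 2 ≤ Real.sin (Real.pi * (a.valMinAbs : ℝ) / n) ^ 2 := by
  have hn : (0 : ℝ) < n := by exact_mod_cast NeZero.pos n
  have hm := ZMod.valMinAbs_mem_Ioc a
  have h2 : |(a.valMinAbs : ℝ)| * 2 ≤ n := by
    have h3 : |a.valMinAbs| * 2 ≤ (n : ℤ) := by
      rw [← abs_two, ← abs_mul, abs_le]
      exact ⟨hm.1.le, hm.2⟩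
    exact_mod_cast h3
  have h4 : 2 / Real.pi * (Real.pi * |(a.valMinAbs : ℝ)| / n) ≤
      Real.sin (Real.pi * |(a.valMinAbs : ℝ)| / n) := by
    refine Real.mul_le_sin (by positivity) ?_
    rw [div_le_div_iff₀ hn two_pos]
    nlinarith [Real.pi_pos]
  have h5 : 2 / Real.pi * (Real.pi * |(a.valMinAbs : ℝ)| / n) = 2 * |(a.valMinAbs : ℝ)| / n := by
    field_simp
  have h6 : Real.sin (Real.pi * (a.valMinAbs : ℝ) / n) ^ 2 =
      Real.sin (Real.pi * |(a.valMinAbs : ℝ)| / n) ^ 2 := by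
    rcases abs_choice (a.valMinAbs : ℝ) with h | h <;> rw [h]
    rw [mul_neg, neg_div, Real.sin_neg, neg_sq]
  rw [h5] at h4
  rw [h6]
  calc 4 * (a.valMinAbs : ℝ) ^ 2 / n ^ 2 = (2 * |(a.valMinAbs : ℝ)| / n) ^ 2 := by
        rw [div_pow, mul_pow, sq_abs]; norm_num
    _ ≤ _ := pow_le_pow_left₀ (by positivity) h4 2

lemma sin_sq_le_sq (x : ℝ) : Real.sin x ^ 2 ≤ x ^ 2 := by
  rw [← sq_abs (Real.sin x), ← sq_abs x]
  exact pow_le_pow_left₀ (abs_nonneg _) (Real.abs_sin_le_abs) 2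

/-- The spectral gap at `k` is at least `4 |k|² / N`. -/
lemma one_sub_eig_ge (k : Vertex n) :
    4 * ((k.1.valMinAbs : ℝ) ^ 2 + (k.2.valMinAbs : ℝ) ^ 2) / n ^ 2 ≤ 1 - eig k := by
  rw [one_sub_eig, mul_add, add_div]
  exact add_le_add (abs_sin_valMinAbs_ge _) (abs_sin_valMinAbs_ge _)

lemma one_sub_eig_le (k : Vertex n) :
    1 - eig k ≤ Real.pi ^ 2 * ((k.1.valMinAbs : ℝ) ^ 2 + (k.2.valMinAbs : ℝ) ^ 2) / n ^ 2 := by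
  rw [one_sub_eig, mul_add, add_div]
  refine add_le_add ((sin_sq_le_sq _).trans (le_of_eq ?_)) ((sin_sq_le_sq _).trans (le_of_eq ?_)) <;>
  rw [div_pow, mul_pow]

lemma neg_one_le_eig (k : Vertex n) : -1 ≤ eig k := by
  have h := one_sub_eig k
  have h1 := Real.sin_sq_le_one (Real.pi * (k.1.valMinAbs : ℝ) / n)
  have h2 := Real.sin_sq_le_one (Real.pi * (k.2.valMinAbs : ℝ) / n)
  linarith

end Fourier

/-! ### Lattice sums over the spectrum -/

section LatticeSums

lemma sum_range_inv_sq_le (i M : ℕ) :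
    ∑ j ∈ Finset.range M, (((i + 1 + j : ℕ) : ℝ) ^ 2)⁻¹ ≤ 2 / (i + 1) := by
  have h := sum_Ioo_inv_sq_le (α := ℝ) i (i + 1 + M)
  refine le_trans (le_of_eq ?_) h
  have e : Finset.Ioo i (i + 1 + M) = Finset.Ico (i + 1) (i + 1 + M) := by
    ext x; simp only [Finset.mem_Ioo, Finset.mem_Ico]; omega
  rw [e, Finset.sum_Ico_eq_sum_range, Nat.add_sub_cancel_left]

/-- The lattice sum of `1 / |x|²` over a quadrant grows at most logarithmically. The term at the
origin vanishes because `0⁻¹ = 0`. -/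
lemma quadrant_sum_inv_le (n : ℕ) :
    ∑ i ∈ Finset.range (n + 1), ∑ j ∈ Finset.range (n + 1), ((i : ℝ) ^ 2 + (j : ℝ) ^ 2)⁻¹ ≤
      6 + 4 * Real.log n := by
  rw [Finset.sum_range_succ']
  have h0 : ∑ j ∈ Finset.range (n + 1), (((0 : ℕ) : ℝ) ^ 2 + (j : ℝ) ^ 2)⁻¹ ≤ 2 := by
    rw [Finset.sum_range_succ']
    have h := sum_range_inv_sq_le 0 n
    simp only [Nat.cast_zero, zero_add, div_one] at h
    refine le_trans (le_of_eq ?_) h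
    simp [add_comm]
  have hrow : ∀ i ∈ Finset.range n,
      ∑ j ∈ Finset.range (n + 1), (((i + 1 : ℕ) : ℝ) ^ 2 + (j : ℝ) ^ 2)⁻¹ ≤
        4 * ((i + 1 : ℕ) : ℝ)⁻¹ := by
    intro i _
    have h1 : ∀ j ∈ Finset.range (n + 1), (((i + 1 : ℕ) : ℝ) ^ 2 + (j : ℝ) ^ 2)⁻¹ ≤
        2 * (((i + 1 + j : ℕ) : ℝ) ^ 2)⁻¹ := by
      intro j _
      have hi : (0 : ℝ) < ((i + 1 : ℕ) : ℝ) := by positivity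
      have hj : (0 : ℝ) ≤ (j : ℝ) := by positivity
      rw [← div_eq_mul_inv, ← one_div, div_le_div_iff₀ (by positivity) (by positivity)]
      rw [Nat.cast_add (i + 1) j]
      nlinarith [sq_nonneg (((i + 1 : ℕ) : ℝ) - j)]
    refine (Finset.sum_le_sum h1).trans ?_
    rw [← Finset.mul_sum]
    have h2 := sum_range_inv_sq_le i (n + 1)
    have h3 : (2 : ℝ) / (i + 1) = 2 * ((i + 1 : ℕ) : ℝ)⁻¹ := by push_cast; ring
    rw [h3] at h2
    linarith
  have hsum := Finset.sum_le_sum hrow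
  rw [← Finset.mul_sum] at hsum
  have hh := harmonic_le_one_add_log n
  have he : ((harmonic n : ℚ) : ℝ) = ∑ i ∈ Finset.range n, ((i + 1 : ℕ) : ℝ)⁻¹ := by
    rw [harmonic]; push_cast; rfl
  rw [he] at hh
  linarith

/-- The lattice sum of `1 / |x|⁴` over a quadrant is bounded. -/
lemma quadrant_sum_inv_sq_le (n : ℕ) :
    ∑ i ∈ Finset.range (n + 1), ∑ j ∈ Finset.range (n + 1), (((i : ℝ) ^ 2 + (j : ℝ) ^ 2) ^ 2)⁻¹ ≤
      9 := by
  set w : ℕ → ℝ := fun i => ((max 1 i : ℕ) : ℝ) ^ 2 with hw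
  have hw0 : ∀ i, 0 < w i := fun i => by
    have : 0 < max 1 i := by omega
    simp only [hw]; positivity
  have hW : ∑ i ∈ Finset.range (n + 1), (w i)⁻¹ ≤ 3 := by
    rw [Finset.sum_range_succ']
    have h := sum_range_inv_sq_le 0 n
    simp only [Nat.cast_zero, zero_add, div_one] at h
    have e : ∀ i, w (i + 1) = ((1 + i : ℕ) : ℝ) ^ 2 := fun i => by
      simp only [hw]; congr 2; omega
    simp only [e]
    have e0 : w 0 = 1 := by simp [hw]
    rw [e0]
    linarith
  have hterm : ∀ i j : ℕ, (((i : ℝ) ^ 2 + (j : ℝ) ^ 2) ^ 2)⁻¹ ≤ (w i)⁻¹ * (w j)⁻¹ := by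
    intro i j
    rw [← mul_inv]
    rcases Nat.eq_zero_or_pos (i + j) with h | h
    · have hi : i = 0 := by omega
      have hj : j = 0 := by omega
      subst hi; subst hj
      simp [hw]
    · have hq : (1 : ℝ) ≤ (i : ℝ) ^ 2 + (j : ℝ) ^ 2 := by
        have : 1 ≤ i ^ 2 + j ^ 2 := by
          rcases Nat.eq_zero_or_pos i with hi | hi
          · have : 0 < j := by omega
            nlinarith
          · nlinarith
        exact_mod_cast this
      have hle : ∀ a : ℕ, (a : ℝ) ^ 2 ≤ (i : ℝ) ^ 2 + (j : ℝ) ^ 2 →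
          w a ≤ (i : ℝ) ^ 2 + (j : ℝ) ^ 2 := by
        intro a ha
        simp only [hw]
        rcases le_total 1 a with h1 | h1
        · rwa [max_eq_right h1]
        · rw [max_eq_left h1]; simpa using hq
      refine inv_anti₀ (mul_pos (hw0 i) (hw0 j)) ?_
      rw [sq ((i : ℝ) ^ 2 + (j : ℝ) ^ 2)]
      exact mul_le_mul (hle i (le_add_of_nonneg_right (sq_nonneg _)))
        (hle j (le_add_of_nonneg_left (sq_nonneg _))) (hw0 j).le (by linarith)
  calc _ ≤ ∑ i ∈ Finset.range (n + 1), ∑ j ∈ Finset.range (n + 1), (w i)⁻¹ * (w j)⁻¹ :=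
        Finset.sum_le_sum fun i _ => Finset.sum_le_sum fun j _ => hterm i j
    _ = (∑ i ∈ Finset.range (n + 1), (w i)⁻¹) * ∑ i ∈ Finset.range (n + 1), (w i)⁻¹ := by
        rw [Finset.sum_mul_sum]
    _ ≤ 3 * 3 := mul_le_mul hW hW (Finset.sum_nonneg fun i _ => (inv_pos.mpr (hw0 i)).le)
        (by norm_num)
    _ = 9 := by norm_num

/-- The lattice sum of `1 / |x|²` over a quadrant grows at least logarithmically: the rows below
the diagonal already form a harmonic sum. -/
lemma le_quadrant_sum_inv (h : ℕ) :
    Real.log (h + 1) / 2 ≤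
      ∑ i ∈ Finset.range (h + 1), ∑ j ∈ Finset.range (h + 1), ((i : ℝ) ^ 2 + (j : ℝ) ^ 2)⁻¹ := by
  rw [Finset.sum_range_succ']
  have hnn : ∀ i j : ℕ, (0 : ℝ) ≤ ((i : ℝ) ^ 2 + (j : ℝ) ^ 2)⁻¹ := fun i j => by positivity
  have hrow : ∀ i ∈ Finset.range h, ((i + 1 : ℕ) : ℝ)⁻¹ / 2 ≤
      ∑ j ∈ Finset.range (h + 1), (((i + 1 : ℕ) : ℝ) ^ 2 + (j : ℝ) ^ 2)⁻¹ := by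
    intro i hi
    have hi' := Finset.mem_range.mp hi
    have hsub : Finset.range (i + 1) ⊆ Finset.range (h + 1) :=
      Finset.range_subset_range.mpr (by omega)
    refine le_trans ?_ (Finset.sum_le_sum_of_subset_of_nonneg hsub fun j _ _ => hnn (i + 1) j)
    have hpos : (0 : ℝ) < ((i + 1 : ℕ) : ℝ) := by positivity
    have hterm : ∀ j ∈ Finset.range (i + 1), (2 * ((i + 1 : ℕ) : ℝ) ^ 2)⁻¹ ≤
        (((i + 1 : ℕ) : ℝ) ^ 2 + (j : ℝ) ^ 2)⁻¹ := by
      intro j hj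
      have hj' : (j : ℝ) ≤ ((i + 1 : ℕ) : ℝ) := by
        exact_mod_cast (Finset.mem_range.mp hj).le
      refine inv_anti₀ (by positivity) ?_
      have := pow_le_pow_left₀ (Nat.cast_nonneg j) hj' 2
      linarith
    refine le_trans (le_of_eq ?_) (Finset.sum_le_sum hterm)
    rw [Finset.sum_const, Finset.card_range, nsmul_eq_mul]
    field_simp
  have hsum := Finset.sum_le_sum hrow
  rw [← Finset.sum_div] at hsum
  have hh := log_add_one_le_harmonic h
  have he : ((harmonic h : ℚ) : ℝ) = ∑ i ∈ Finset.range h, ((i + 1 : ℕ) : ℝ)⁻¹ := by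
    rw [harmonic]; push_cast; rfl
  rw [he] at hh
  push_cast at hh hsum
  have h0 : (0 : ℝ) ≤ ∑ j ∈ Finset.range (h + 1), (((0 : ℕ) : ℝ) ^ 2 + (j : ℝ) ^ 2)⁻¹ :=
    Finset.sum_nonneg fun j _ => hnn 0 j
  push_cast at h0 ⊢
  linarith

/-- `|k|²` for the representatives of `k₁, k₂` of smallest absolute value. -/
noncomputable def normSqIdx {n : ℕ} (k : Vertex n) : ℝ :=
  ((k.1.valMinAbs.natAbs : ℕ) : ℝ) ^ 2 + ((k.2.valMinAbs.natAbs : ℕ) : ℝ) ^ 2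

lemma normSqIdx_eq {n : ℕ} (k : Vertex n) :
    normSqIdx k = (k.1.valMinAbs : ℝ) ^ 2 + (k.2.valMinAbs : ℝ) ^ 2 := by
  simp only [normSqIdx, Nat.cast_natAbs, Int.cast_abs, sq_abs]

lemma one_le_normSqIdx {n : ℕ} {k : Vertex n} (hk : k ≠ 0) : 1 ≤ normSqIdx k := by
  have h : 1 ≤ k.1.valMinAbs.natAbs ^ 2 + k.2.valMinAbs.natAbs ^ 2 := by
    by_contra h
    have h1 : k.1.valMinAbs.natAbs = 0 := by nlinarith
    have h2 : k.2.valMinAbs.natAbs = 0 := by nlinarith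
    rw [Int.natAbs_eq_zero, ZMod.valMinAbs_eq_zero] at h1 h2
    exact hk (Prod.ext h1 h2)
  rw [normSqIdx]
  exact_mod_cast h

variable {n : ℕ} [NeZero n]

/-- Each absolute value is taken by at most two residues. -/
lemma sum_valMinAbs_le {f : ℕ → ℝ} (hf : ∀ i, 0 ≤ f i) :
    ∑ a : ZMod n, f a.valMinAbs.natAbs ≤ 2 * ∑ i ∈ Finset.range (n + 1), f i := by
  have hmaps : ∀ a ∈ (Finset.univ : Finset (ZMod n)),
      a.valMinAbs.natAbs ∈ Finset.range (n + 1) := fun a _ => by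
    have := ZMod.natAbs_valMinAbs_le a
    rw [Finset.mem_range]; omega
  rw [← Finset.sum_fiberwise_of_maps_to hmaps, Finset.mul_sum]
  refine Finset.sum_le_sum fun i _ => ?_
  rw [Finset.sum_congr rfl (g := fun _ => f i) fun a ha => by rw [(Finset.mem_filter.mp ha).2],
    Finset.sum_const, nsmul_eq_mul]
  refine mul_le_mul_of_nonneg_right ?_ (hf i)
  have hsub : (Finset.univ.filter fun a : ZMod n => a.valMinAbs.natAbs = i) ⊆
      {(i : ZMod n), -(i : ZMod n)} := by
    intro a ha
    have ha' := (Finset.mem_filter.mp ha).2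
    rw [Finset.mem_insert, Finset.mem_singleton, ← ZMod.coe_valMinAbs a]
    rcases Int.natAbs_eq_iff.mp ha' with h | h <;> rw [h] <;> simp
  exact_mod_cast (Finset.card_le_card hsub).trans Finset.card_le_two

lemma sum_range_half_le {f : ZMod n → ℝ} (hf : ∀ a, 0 ≤ f a) :
    ∑ i ∈ Finset.range (n / 2 + 1), f (i : ZMod n) ≤ ∑ a : ZMod n, f a := by
  have hinj : Set.InjOn (fun i : ℕ => (i : ZMod n)) (Finset.range (n / 2 + 1)) := by
    intro i hi j hj hij
    have hi' : i ≤ n / 2 := by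
      have := Finset.mem_range.mp (Finset.mem_coe.mp hi); omega
    have hj' : j ≤ n / 2 := by
      have := Finset.mem_range.mp (Finset.mem_coe.mp hj); omega
    have h := congrArg ZMod.valMinAbs hij
    simp only [ZMod.valMinAbs_natCast_of_le_half hi', ZMod.valMinAbs_natCast_of_le_half hj'] at h
    exact_mod_cast h
  rw [← Finset.sum_image (f := f) hinj]
  exact Finset.sum_le_sum_of_subset_of_nonneg (Finset.subset_univ _) fun a _ _ => hf a

lemma sum_vertex_le {f : ℕ → ℕ → ℝ} (hf : ∀ i j, 0 ≤ f i j) :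
    ∑ k : Vertex n, f k.1.valMinAbs.natAbs k.2.valMinAbs.natAbs ≤
      4 * ∑ i ∈ Finset.range (n + 1), ∑ j ∈ Finset.range (n + 1), f i j := by
  rw [Fintype.sum_prod_type]
  have h1 := sum_valMinAbs_le (n := n)
    (f := fun i => ∑ b : ZMod n, f i b.valMinAbs.natAbs) fun i => Finset.sum_nonneg fun b _ => hf _ _
  have h2 : ∑ i ∈ Finset.range (n + 1), ∑ b : ZMod n, f i b.valMinAbs.natAbs ≤
      ∑ i ∈ Finset.range (n + 1), 2 * ∑ j ∈ Finset.range (n + 1), f i j :=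
    Finset.sum_le_sum fun i _ => sum_valMinAbs_le (hf i)
  rw [← Finset.mul_sum] at h2
  dsimp only at h1 ⊢
  linarith

lemma one_sub_eig_pos {k : Vertex n} (hk : k ≠ 0) : 0 < 1 - eig k := by
  have hn : (0 : ℝ) < n := by exact_mod_cast NeZero.pos n
  have h1 := one_sub_eig_ge k
  rw [← normSqIdx_eq] at h1
  have h2 := one_le_normSqIdx hk
  exact lt_of_lt_of_le (by positivity) h1

lemma inv_one_sub_eig_le {k : Vertex n} (hk : k ≠ 0) :
    (1 - eig k)⁻¹ ≤ (n : ℝ) ^ 2 / 4 * (normSqIdx k)⁻¹ := by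
  have hn : (0 : ℝ) < n := by exact_mod_cast NeZero.pos n
  have h1 := one_sub_eig_ge k
  rw [← normSqIdx_eq] at h1
  have h2 := one_le_normSqIdx hk
  have h3 : (0 : ℝ) < 4 * normSqIdx k / n ^ 2 := by positivity
  refine (inv_anti₀ h3 h1).trans (le_of_eq ?_)
  rw [inv_div, div_mul_eq_div_div, div_eq_mul_inv]

/-- The nonzero momenta. -/
def momenta (n : ℕ) [NeZero n] : Finset (Vertex n) := Finset.univ.erase 0

lemma sum_inv_one_sub_eig_le : ∑ k ∈ momenta n, (1 - eig k)⁻¹ ≤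
    (n : ℝ) ^ 2 * (6 + 4 * Real.log n) := by
  have h1 : ∑ k ∈ momenta n, (1 - eig k)⁻¹ ≤ ∑ k ∈ momenta n, (n : ℝ) ^ 2 / 4 * (normSqIdx k)⁻¹ :=
    Finset.sum_le_sum fun k hk => inv_one_sub_eig_le (Finset.ne_of_mem_erase hk)
  have hnn : ∀ k : Vertex n, 0 ≤ (normSqIdx k)⁻¹ := fun k => by
    unfold normSqIdx; positivity
  have h2 : ∑ k ∈ momenta n, (normSqIdx k)⁻¹ ≤ ∑ k : Vertex n, (normSqIdx k)⁻¹ :=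
    Finset.sum_le_sum_of_subset_of_nonneg (Finset.subset_univ _) fun k _ _ => hnn k
  have h3 := sum_vertex_le (n := n) (f := fun i j => ((i : ℝ) ^ 2 + (j : ℝ) ^ 2)⁻¹)
    fun i j => by positivity
  have h4 := quadrant_sum_inv_le n
  rw [← Finset.mul_sum] at h1
  have h5 : ∑ k ∈ momenta n, (normSqIdx k)⁻¹ ≤ 4 * (6 + 4 * Real.log n) :=
    h2.trans (h3.trans (by linarith))
  calc _ ≤ _ := h1
    _ ≤ (n : ℝ) ^ 2 / 4 * (4 * (6 + 4 * Real.log n)) := by gcongr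
    _ = _ := by ring

lemma sum_inv_one_sub_eig_sq_le : ∑ k ∈ momenta n, ((1 - eig k)⁻¹) ^ 2 ≤ 3 * ((n : ℝ) ^ 2) ^ 2 := by
  have h1 : ∑ k ∈ momenta n, ((1 - eig k)⁻¹) ^ 2 ≤
      ∑ k ∈ momenta n, ((n : ℝ) ^ 2 / 4) ^ 2 * ((normSqIdx k) ^ 2)⁻¹ :=
    Finset.sum_le_sum fun k hk => by
      have hk' := Finset.ne_of_mem_erase hk
      rw [← inv_pow, ← mul_pow]
      exact pow_le_pow_left₀ (inv_pos.mpr (one_sub_eig_pos hk')).le (inv_one_sub_eig_le hk') 2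
  have hnn : ∀ k : Vertex n, 0 ≤ ((normSqIdx k) ^ 2)⁻¹ := fun k => by positivity
  have h2 : ∑ k ∈ momenta n, ((normSqIdx k) ^ 2)⁻¹ ≤ ∑ k : Vertex n, ((normSqIdx k) ^ 2)⁻¹ :=
    Finset.sum_le_sum_of_subset_of_nonneg (Finset.subset_univ _) fun k _ _ => hnn k
  have h3 := sum_vertex_le (n := n) (f := fun i j => (((i : ℝ) ^ 2 + (j : ℝ) ^ 2) ^ 2)⁻¹)
    fun i j => by positivity
  have h4 := quadrant_sum_inv_sq_le n
  rw [← Finset.mul_sum] at h1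
  have h5 : ∑ k ∈ momenta n, ((normSqIdx k) ^ 2)⁻¹ ≤ 4 * 9 := h2.trans (h3.trans (by linarith))
  calc _ ≤ _ := h1
    _ ≤ ((n : ℝ) ^ 2 / 4) ^ 2 * (4 * 9) := by gcongr
    _ ≤ _ := by nlinarith [sq_nonneg ((n : ℝ) ^ 2)]

lemma le_sum_inv_one_sub_eig (hn : 4 ≤ n) :
    (n : ℝ) ^ 2 * Real.log n / (4 * Real.pi ^ 2) ≤ ∑ k ∈ momenta n, (1 - eig k)⁻¹ := by
  have hn0 : (0 : ℝ) < n := by exact_mod_cast NeZero.pos n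
  have h1 : ∀ k ∈ momenta n, (n : ℝ) ^ 2 / Real.pi ^ 2 * (normSqIdx k)⁻¹ ≤ (1 - eig k)⁻¹ := by
    intro k hk
    have hk' := Finset.ne_of_mem_erase hk
    have hle := one_sub_eig_le k
    rw [← normSqIdx_eq] at hle
    refine le_trans (le_of_eq ?_) (inv_anti₀ (one_sub_eig_pos hk') hle)
    rw [inv_div, div_mul_eq_div_div, div_eq_mul_inv (_ / _)]
  refine le_trans ?_ (Finset.sum_le_sum h1)
  rw [← Finset.mul_sum]
  have h0 : ∑ k ∈ momenta n, (normSqIdx k)⁻¹ = ∑ k : Vertex n, (normSqIdx k)⁻¹ := by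
    refine Finset.sum_erase _ ?_
    simp [normSqIdx]
  have hnn : ∀ k : Vertex n, 0 ≤ (normSqIdx k)⁻¹ := fun k => by
    unfold normSqIdx; positivity
  have h2 : ∑ i ∈ Finset.range (n / 2 + 1), ∑ j ∈ Finset.range (n / 2 + 1),
      ((i : ℝ) ^ 2 + (j : ℝ) ^ 2)⁻¹ ≤ ∑ k : Vertex n, (normSqIdx k)⁻¹ := by
    rw [Fintype.sum_prod_type]
    refine le_trans (Finset.sum_le_sum fun i hi => ?_)
      (sum_range_half_le fun a => Finset.sum_nonneg fun b _ => hnn (a, b))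
    refine le_trans (Finset.sum_le_sum fun j hj => ?_) (sum_range_half_le fun b => hnn (_, b))
    have hi' : i ≤ n / 2 := by have := Finset.mem_range.mp hi; omega
    have hj' : j ≤ n / 2 := by have := Finset.mem_range.mp hj; omega
    simp [normSqIdx, ZMod.valMinAbs_natCast_of_le_half hi', ZMod.valMinAbs_natCast_of_le_half hj']
  have h3 := (le_quadrant_sum_inv (n / 2)).trans h2
  have h4 : Real.log n / 2 ≤ Real.log ((n / 2 : ℕ) + 1) := by
    rw [div_le_iff₀ two_pos, mul_comm, ← Nat.cast_two, ← Real.log_pow]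
    refine Real.log_le_log hn0 ?_
    have h5 : n ≤ (n / 2 + 1) ^ 2 := by
      have : n < 2 * (n / 2 + 1) := by omega
      have h6 : 2 ≤ n / 2 + 1 := by omega
      nlinarith
    exact_mod_cast h5
  have h7 : Real.log n / 4 ≤ ∑ k ∈ momenta n, (normSqIdx k)⁻¹ := by
    rw [h0]; linarith
  calc _ = (n : ℝ) ^ 2 / Real.pi ^ 2 * (Real.log n / 4) := by ring
    _ ≤ _ := by gcongr

/-! ### Spectral sums of the multi-step walk -/

/-- The gap `1 - λ_k^t` of the `t`-step walk. -/
noncomputable def gap (t : ℕ) (k : Vertex n) : ℝ := 1 - eig k ^ t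

lemma gap_le (t : ℕ) (k : Vertex n) : gap t k ≤ t * (1 - eig k) := by
  have h := one_add_mul_le_pow (a := eig k - 1) (by linarith [neg_one_le_eig k]) t
  rw [add_sub_cancel] at h
  rw [gap]
  linarith

/-- Either `λ_k ≤ 0`, and then `λ_k^t ≤ 0` since `t` is odd, or `λ_k^t ≤ 1 / (1 + t (1 - λ_k))`
by Bernoulli's inequality for `1 / λ_k`. -/
lemma gap_pos_and_inv_le {t : ℕ} (ht : Odd t) {k : Vertex n} (hk : k ≠ 0) :
    0 < gap t k ∧ (gap t k)⁻¹ ≤ 1 + (t * (1 - eig k))⁻¹ := by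
  have hgap := one_sub_eig_pos hk
  have htpos : (0 : ℝ) < t := by exact_mod_cast ht.pos
  have hy : 0 < t * (1 - eig k) := mul_pos htpos hgap
  rcases le_or_gt (eig k) 0 with h | h
  · have h1 : eig k ^ t ≤ 0 := ht.pow_nonpos_iff.mpr h
    have h2 : 1 ≤ gap t k := by rw [gap]; linarith
    refine ⟨by linarith, (inv_le_one_of_one_le₀ h2).trans ?_⟩
    have := inv_pos.mpr hy
    linarith
  · have h1 : 1 + t * ((eig k)⁻¹ - 1) ≤ ((eig k)⁻¹) ^ t := by
      have := one_add_mul_le_pow (a := (eig k)⁻¹ - 1) (by linarith [inv_pos.mpr h]) t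
      rwa [add_sub_cancel] at this
    have h2 : 1 - eig k ≤ (eig k)⁻¹ - 1 := by
      rw [← sub_nonneg]
      have : (eig k)⁻¹ - 1 - (1 - eig k) = (1 - eig k) ^ 2 / eig k := by field_simp
      rw [this]; positivity
    have h3 : 1 + t * (1 - eig k) ≤ ((eig k)⁻¹) ^ t := by nlinarith
    have hp : 0 < eig k ^ t := pow_pos h t
    have h4 : (1 + t * (1 - eig k)) * eig k ^ t ≤ 1 := by
      rw [inv_pow] at h3
      calc _ ≤ (eig k ^ t)⁻¹ * eig k ^ t := by gcongr
        _ = 1 := inv_mul_cancel₀ hp.ne'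
    have h5 : t * (1 - eig k) / (1 + t * (1 - eig k)) ≤ gap t k := by
      rw [gap, div_le_iff₀ (by linarith)]
      nlinarith
    have h6 : 0 < t * (1 - eig k) / (1 + t * (1 - eig k)) := by positivity
    refine ⟨h6.trans_le h5, (inv_anti₀ h6 h5).trans (le_of_eq ?_)⟩
    field_simp
    ring

lemma card_momenta_le : ((momenta n).card : ℝ) ≤ (n : ℝ) ^ 2 := by
  have h : (momenta n).card ≤ n ^ 2 := by
    refine (Finset.card_le_univ _).trans (le_of_eq ?_)
    rw [Fintype.card_prod, ZMod.card, sq]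
  exact_mod_cast h

lemma logN_eq (n : ℕ) : logN n = 2 * Real.log n := by
  rw [logN, Real.log_pow]; norm_num

lemma one_le_logN {n : ℕ} (hn : 4 ≤ n) : 1 ≤ logN n := by
  rw [logN_eq]
  have h1 : Real.log 2 ≤ Real.log n :=
    Real.log_le_log two_pos (by exact_mod_cast (by omega : 2 ≤ n))
  have := Real.log_two_gt_d9
  linarith

lemma logN_le {n : ℕ} (hn : 4 ≤ n) : logN n ≤ 2 * n := by
  rw [logN_eq]
  have : Real.log n ≤ n := (Real.log_le_sub_one_of_pos (by positivity)).trans (by linarith)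
  linarith

variable {t : ℕ} {K : ℝ}

lemma sum_inv_gap_le (hn : 4 ≤ n) (ht : Odd t) (htK : (t : ℝ) ≤ K * logN n) :
    ∑ k ∈ momenta n, (gap t k)⁻¹ ≤ (K + 8) * ((n : ℝ) ^ 2 * logN n / t) := by
  have htpos : (0 : ℝ) < t := by exact_mod_cast ht.pos
  have hL := one_le_logN hn
  have h1 : ∑ k ∈ momenta n, (gap t k)⁻¹ ≤ ∑ k ∈ momenta n, (1 + (t : ℝ)⁻¹ * (1 - eig k)⁻¹) :=
    Finset.sum_le_sum fun k hk => by
      rw [← mul_inv]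
      exact (gap_pos_and_inv_le ht (Finset.ne_of_mem_erase hk)).2
  rw [Finset.sum_add_distrib, ← Finset.mul_sum, Finset.sum_const, nsmul_eq_mul, mul_one] at h1
  have h2 := sum_inv_one_sub_eig_le (n := n)
  have h3 : (n : ℝ) ^ 2 * (6 + 4 * Real.log n) ≤ 8 * ((n : ℝ) ^ 2 * logN n) := by
    have : 6 + 4 * Real.log n ≤ 8 * logN n := by rw [logN_eq] at hL ⊢; linarith
    nlinarith [sq_nonneg (n : ℝ)]
  have h4 : (n : ℝ) ^ 2 ≤ K * ((n : ℝ) ^ 2 * logN n / t) := by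
    rw [mul_div_assoc', le_div_iff₀ htpos]
    nlinarith [sq_nonneg (n : ℝ)]
  have h5 : (t : ℝ)⁻¹ * ∑ k ∈ momenta n, (1 - eig k)⁻¹ ≤ 8 * ((n : ℝ) ^ 2 * logN n / t) := by
    calc _ ≤ (t : ℝ)⁻¹ * (8 * ((n : ℝ) ^ 2 * logN n)) := by gcongr; exact h2.trans h3
      _ = _ := by ring
  have h6 := card_momenta_le (n := n)
  linarith

lemma le_sum_inv_gap (hn : 4 ≤ n) (ht : Odd t) :
    (8 * Real.pi ^ 2)⁻¹ * ((n : ℝ) ^ 2 * logN n / t) ≤ ∑ k ∈ momenta n, (gap t k)⁻¹ := by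
  have htpos : (0 : ℝ) < t := by exact_mod_cast ht.pos
  have h1 : ∑ k ∈ momenta n, (t : ℝ)⁻¹ * (1 - eig k)⁻¹ ≤ ∑ k ∈ momenta n, (gap t k)⁻¹ :=
    Finset.sum_le_sum fun k hk => by
      rw [← mul_inv]
      exact inv_anti₀ (gap_pos_and_inv_le ht (Finset.ne_of_mem_erase hk)).1 (gap_le t k)
  rw [← Finset.mul_sum] at h1
  refine le_trans ?_ h1
  calc _ = (t : ℝ)⁻¹ * ((n : ℝ) ^ 2 * Real.log n / (4 * Real.pi ^ 2)) := by
        rw [logN_eq]; field_simp; ring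
    _ ≤ _ := by gcongr; exact le_sum_inv_one_sub_eig hn

lemma sum_inv_gap_sq_le (hn : 4 ≤ n) (ht : Odd t) (htK : (t : ℝ) ≤ K * logN n) :
    ∑ k ∈ momenta n, ((gap t k)⁻¹) ^ 2 ≤ (8 * K ^ 2 + 6) * ((n : ℝ) ^ 2 / t) ^ 2 := by
  have htpos : (0 : ℝ) < t := by exact_mod_cast ht.pos
  have hnpos : (0 : ℝ) < n := by exact_mod_cast NeZero.pos n
  have h1 : ∑ k ∈ momenta n, ((gap t k)⁻¹) ^ 2 ≤
      ∑ k ∈ momenta n, (2 + 2 * ((t : ℝ)⁻¹) ^ 2 * ((1 - eig k)⁻¹) ^ 2) :=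
    Finset.sum_le_sum fun k hk => by
      obtain ⟨h0, hle⟩ := gap_pos_and_inv_le ht (Finset.ne_of_mem_erase hk)
      have h2 := pow_le_pow_left₀ (inv_pos.mpr h0).le hle 2
      rw [mul_inv] at h2
      nlinarith [sq_nonneg (1 - (t : ℝ)⁻¹ * (1 - eig k)⁻¹)]
  rw [Finset.sum_add_distrib, ← Finset.mul_sum, Finset.sum_const, nsmul_eq_mul] at h1
  have h2 := sum_inv_one_sub_eig_sq_le (n := n)
  have h3 := card_momenta_le (n := n)
  have h4 : (t : ℝ) ^ 2 ≤ 4 * K ^ 2 * (n : ℝ) ^ 2 := by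
    have hK : 0 < K := by
      have hL := one_le_logN hn
      by_contra hK
      nlinarith
    have h5 : (t : ℝ) ≤ K * (2 * n) := htK.trans (by gcongr; exact logN_le hn)
    calc (t : ℝ) ^ 2 ≤ (K * (2 * n)) ^ 2 := by gcongr
      _ = _ := by ring
  have h5 : (n : ℝ) ^ 2 ≤ 4 * K ^ 2 * ((n : ℝ) ^ 2 / t) ^ 2 := by
    rw [div_pow, mul_div_assoc', le_div_iff₀ (by positivity)]
    nlinarith [sq_nonneg (n : ℝ), mul_le_mul_of_nonneg_left h4 (sq_nonneg (n : ℝ))]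
  have h6 : 2 * ((t : ℝ)⁻¹) ^ 2 * ∑ k ∈ momenta n, ((1 - eig k)⁻¹) ^ 2 ≤
      6 * ((n : ℝ) ^ 2 / t) ^ 2 := by
    calc _ ≤ 2 * ((t : ℝ)⁻¹) ^ 2 * (3 * ((n : ℝ) ^ 2) ^ 2) := by gcongr
      _ = _ := by ring
  linarith

end LatticeSums

/-! ### The secular equation -/

section Secular

variable {ι : Type} (S : Finset ι) (μ : ι → ℝ)

/-- The left-hand side of the secular equation `secular S μ y β = 1`, for spectral gaps `μ k`,
`k ∈ S`, and `y = N tan² δ`. It is the eigenphase condition multiplied by `tan (β / 2)`, which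
makes it continuous at `0`. -/
noncomputable def secular (y β : ℝ) : ℝ :=
  Real.tan (β / 2) *
    (Real.sin β * ∑ k ∈ S, (μ k - (1 - Real.cos β))⁻¹ + y * Real.tan (β / 2))

lemma secular_neg (y β : ℝ) : secular S μ y (-β) = secular S μ y β := by
  simp only [secular, neg_div, Real.tan_neg, Real.sin_neg, Real.cos_neg]
  ring

lemma half_le_tan {b : ℝ} (h0 : 0 ≤ b) (h1 : b ≤ 1) : b / 2 ≤ Real.tan (b / 2) :=
  Real.le_tan (by linarith) (by linarith [Real.pi_gt_three])

lemma tan_half_le {b : ℝ} (h0 : 0 ≤ b) (h1 : b ≤ 1) : Real.tan (b / 2) ≤ b := by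
  have hc : 1 / 2 ≤ Real.cos (b / 2) := by
    have := Real.one_sub_sq_div_two_le_cos (x := b / 2)
    nlinarith
  rw [Real.tan_eq_sin_div_cos, div_le_iff₀ (by linarith)]
  have hs : Real.sin (b / 2) ≤ b / 2 := Real.sin_le (by linarith)
  nlinarith

lemma half_le_sin {b : ℝ} (h0 : 0 ≤ b) (h1 : b ≤ 1) : b / 2 ≤ Real.sin b := by
  have h := Real.mul_le_sin h0 (by linarith [Real.pi_gt_three])
  have hp : 1 / 2 ≤ 2 / Real.pi := by
    rw [div_le_div_iff₀ two_pos Real.pi_pos]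
    linarith [Real.pi_le_four]
  nlinarith

lemma one_sub_cos_le (b : ℝ) : 1 - Real.cos b ≤ b ^ 2 / 2 := by
  linarith [Real.one_sub_sq_div_two_le_cos (x := b)]

variable {S μ}

lemma sum_inv_shift_le {b : ℝ} (hμ : ∀ k ∈ S, 0 < μ k ∧ 1 - Real.cos b ≤ μ k / 2) :
    ∑ k ∈ S, (μ k - (1 - Real.cos b))⁻¹ ≤ 2 * ∑ k ∈ S, (μ k)⁻¹ := by
  rw [Finset.mul_sum]
  refine Finset.sum_le_sum fun k hk => ?_
  obtain ⟨h0, h1⟩ := hμ k hk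
  calc (μ k - (1 - Real.cos b))⁻¹ ≤ (μ k / 2)⁻¹ := inv_anti₀ (by linarith) (by linarith)
    _ = 2 * (μ k)⁻¹ := by rw [inv_div, div_eq_mul_inv]

lemma sum_inv_shift_sq_le {b : ℝ} (hμ : ∀ k ∈ S, 0 < μ k ∧ 1 - Real.cos b ≤ μ k / 2) :
    ∑ k ∈ S, ((μ k - (1 - Real.cos b)) ^ 2)⁻¹ ≤ 4 * ∑ k ∈ S, ((μ k)⁻¹) ^ 2 := by
  rw [Finset.mul_sum]
  refine Finset.sum_le_sum fun k hk => ?_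
  obtain ⟨h0, h1⟩ := hμ k hk
  calc ((μ k - (1 - Real.cos b)) ^ 2)⁻¹ ≤ ((μ k / 2) ^ 2)⁻¹ :=
        inv_anti₀ (by positivity) (pow_le_pow_left₀ (by linarith) (by linarith) 2)
    _ = 4 * ((μ k)⁻¹) ^ 2 := by field_simp; norm_num

lemma sum_inv_le_sum_inv_shift {b : ℝ} (hμ : ∀ k ∈ S, 0 < μ k ∧ 1 - Real.cos b ≤ μ k / 2) :
    ∑ k ∈ S, (μ k)⁻¹ ≤ ∑ k ∈ S, (μ k - (1 - Real.cos b))⁻¹ :=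
  Finset.sum_le_sum fun k hk =>
    inv_anti₀ (by linarith [(hμ k hk).1, (hμ k hk).2]) (by linarith [Real.cos_le_one b])

lemma secular_le {b y : ℝ} (h0 : 0 ≤ b) (h1 : b ≤ 1) (hy : 0 ≤ y)
    (hμ : ∀ k ∈ S, 0 < μ k ∧ 1 - Real.cos b ≤ μ k / 2) :
    secular S μ y b ≤ b ^ 2 * (2 * ∑ k ∈ S, (μ k)⁻¹ + y) := by
  have ht := tan_half_le h0 h1
  have ht0 : 0 ≤ Real.tan (b / 2) := le_trans (by linarith) (half_le_tan h0 h1)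
  have hs := Real.sin_le h0
  have hs0 : 0 ≤ Real.sin b := le_trans (by linarith) (half_le_sin h0 h1)
  have hR := sum_inv_shift_le hμ
  have hP : 0 ≤ ∑ k ∈ S, (μ k)⁻¹ :=
    Finset.sum_nonneg fun k hk => (inv_pos.mpr (hμ k hk).1).le
  have hR0 := hP.trans (sum_inv_le_sum_inv_shift hμ)
  calc secular S μ y b ≤ b * (b * (2 * ∑ k ∈ S, (μ k)⁻¹) + y * b) := by
        rw [secular]; gcongr
    _ = _ := by ring

lemma le_secular {b y : ℝ} (h0 : 0 ≤ b) (h1 : b ≤ 1) (hy : 0 ≤ y)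
    (hμ : ∀ k ∈ S, 0 < μ k ∧ 1 - Real.cos b ≤ μ k / 2) :
    b ^ 2 / 4 * (∑ k ∈ S, (μ k)⁻¹ + y) ≤ secular S μ y b := by
  have ht := half_le_tan h0 h1
  have hs := half_le_sin h0 h1
  have hR := sum_inv_le_sum_inv_shift hμ
  have hP : 0 ≤ ∑ k ∈ S, (μ k)⁻¹ :=
    Finset.sum_nonneg fun k hk => (inv_pos.mpr (hμ k hk).1).le
  calc _ = b / 2 * (b / 2 * (∑ k ∈ S, (μ k)⁻¹) + y * (b / 2)) := by ring
    _ ≤ secular S μ y b := by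
        rw [secular]
        have := hP.trans hR
        have : 0 ≤ Real.sin b := le_trans (by linarith) hs
        have : 0 ≤ Real.tan (b / 2) := le_trans (by linarith) ht
        gcongr

/-- A root of the secular equation below `b`, by the intermediate value theorem. -/
lemma exists_secular_eq_one {b y : ℝ} (h0 : 0 ≤ b) (h1 : b ≤ 1)
    (hμ : ∀ k ∈ S, 0 < μ k ∧ b ^ 2 ≤ μ k) (hb : 1 ≤ secular S μ y b) :
    ∃ β, 0 < β ∧ β ≤ b ∧ secular S μ y β = 1 := by
  have hcont : ContinuousOn (secular S μ y) (Set.Icc 0 b) := by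
    have htan : ContinuousOn (fun x : ℝ => Real.tan (x / 2)) (Set.Icc 0 b) := by
      intro x hx
      have hc : Real.cos (x / 2) ≠ 0 := (Real.cos_pos_of_mem_Ioo
        ⟨by linarith [hx.1, Real.pi_pos], by linarith [hx.2, Real.pi_gt_three]⟩).ne'
      have h := (Real.continuousAt_tan.mpr hc)
      exact (ContinuousAt.comp (f := fun x : ℝ => x / 2) h
        (continuous_id.div_const 2).continuousAt).continuousWithinAt
    refine htan.mul (ContinuousOn.add (Real.continuous_sin.continuousOn.mul ?_)
      (continuousOn_const.mul htan))
    refine continuousOn_finsetSum S fun k hk => ?_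
    refine ContinuousOn.inv₀ (by fun_prop) fun x hx => ?_
    obtain ⟨hk0, hk1⟩ := hμ k hk
    have hx2 := one_sub_cos_le x
    have : x ^ 2 ≤ b ^ 2 := pow_le_pow_left₀ hx.1 hx.2 2
    have : 0 < μ k - (1 - Real.cos x) := by linarith
    exact this.ne'
  have hz : secular S μ y 0 = 0 := by simp [secular]
  obtain ⟨β, hβ, hβ1⟩ := intermediate_value_Icc h0 hcont
    (⟨by rw [hz]; norm_num, hb⟩ : (1 : ℝ) ∈ Set.Icc (secular S μ y 0) (secular S μ y b))
  refine ⟨β, lt_of_le_of_ne hβ.1 ?_, hβ.2, hβ1⟩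
  rintro rfl
  rw [hz] at hβ1
  norm_num at hβ1

end Secular

section Eigenphase

variable {n : ℕ} [NeZero n] {t : ℕ}

lemma sum_vertex_split (f : Vertex n → ℝ) :
    ∑ k : Vertex n, f k = f 0 + ∑ k ∈ momenta n, f k :=
  (Finset.add_sum_erase _ _ (Finset.mem_univ 0)).symm

lemma cos_sub_eig_pow (β : ℝ) (k : Vertex n) :
    Real.cos β - eig k ^ t = gap t k - (1 - Real.cos β) := by
  rw [gap]; ring

lemma gap_zero : gap t (0 : Vertex n) = 0 := by
  rw [gap, eig_zero, one_pow, sub_self]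

lemma cos_ne_one {β : ℝ} (hβ : Real.sin β ≠ 0) : 1 - Real.cos β ≠ 0 := by
  intro h
  have h1 : Real.cos β = 1 := by linarith
  have h2 := Real.sin_sq_add_cos_sq β
  rw [h1] at h2
  exact hβ (by nlinarith)

/-- The resolvent of the transition matrix at `cos β`, below the spectral gap. -/
lemma exists_isGreen_cos {β : ℝ} (hβ : Real.sin β ≠ 0)
    (hμ : ∀ k ∈ momenta n, 0 < gap t k ∧ 1 - Real.cos β ≤ gap t k / 2) (m : Vertex n) :
    ∃ g, IsGreen t (Real.cos β) m g ∧
      g m = ((((n : ℝ) ^ 2)⁻¹ * (-(1 - Real.cos β)⁻¹ +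
        ∑ k ∈ momenta n, (gap t k - (1 - Real.cos β))⁻¹) : ℝ) : ℂ) ∧
      normSq g = ((n : ℝ) ^ 2)⁻¹ * (((1 - Real.cos β) ^ 2)⁻¹ +
        ∑ k ∈ momenta n, ((gap t k - (1 - Real.cos β)) ^ 2)⁻¹) := by
  have h1 := cos_ne_one hβ
  have hc : ∀ k : Vertex n, Real.cos β - eig k ^ t ≠ 0 := by
    intro k
    rw [cos_sub_eig_pow]
    by_cases hk : k = 0
    · rw [hk, gap_zero, zero_sub]
      exact neg_ne_zero.mpr h1
    · obtain ⟨h2, h3⟩ := hμ k (Finset.mem_erase.mpr ⟨hk, Finset.mem_univ k⟩)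
      have : 0 < gap t k - (1 - Real.cos β) := by linarith
      exact this.ne'
  obtain ⟨g, hg, hgm, hgn⟩ := exists_isGreen hc m
  refine ⟨g, hg, ?_, ?_⟩
  · rw [hgm, sum_vertex_split]
    simp only [cos_sub_eig_pow, gap_zero, zero_sub, inv_neg]
  · rw [hgn, sum_vertex_split]
    simp only [cos_sub_eig_pow, gap_zero, zero_sub, neg_sq]

/-- The secular equation in terms of the resolvent entry is `secular = 1`. -/
lemma secular_iff {β δ R : ℝ} (hβ : Real.sin β ≠ 0) (hδ : Real.cos δ ≠ 0) :
    Real.cos δ ^ 2 * Real.sin β * (((n : ℝ) ^ 2)⁻¹ * (-(1 - Real.cos β)⁻¹ + R)) +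
        Real.sin δ ^ 2 * Real.tan (β / 2) = 0 ↔
      Real.tan (β / 2) * (Real.sin β * R + (n : ℝ) ^ 2 * Real.tan δ ^ 2 * Real.tan (β / 2)) = 1 := by
  have hn : (n : ℝ) ≠ 0 := by exact_mod_cast NeZero.ne n
  have h2 : Real.sin β = 2 * Real.sin (β / 2) * Real.cos (β / 2) := by
    rw [← Real.sin_two_mul]; ring_nf
  have hc := cos_half_ne_zero hβ
  have hs : Real.sin (β / 2) ≠ 0 := by
    intro h; rw [h2, h] at hβ; simp at hβ
  have h1 : 1 - Real.cos β = 2 * Real.sin (β / 2) ^ 2 := by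
    have := Real.cos_two_mul (β / 2)
    rw [mul_div_cancel₀ β two_ne_zero] at this
    nlinarith [Real.sin_sq_add_cos_sq (β / 2)]
  rw [h1, h2, Real.tan_eq_sin_div_cos (β / 2), Real.tan_eq_sin_div_cos δ]
  field_simp
  constructor <;> intro h
  · linear_combination h
  · linear_combination h

lemma norm_eq_one_of_eigenvector {m : Vertex n} {δ : ℝ} {μ : ℂ} {w : AIdx n t → ℂ} (hw : w ≠ 0)
    (h : searchOp n t m δ *ᵥ w = μ • w) : ‖μ‖ = 1 := by
  have h1 := normSq_mulVec (searchOp_unitary n t m δ) w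
  rw [h] at h1
  have h2 : normSq (μ • w) = ‖μ‖ ^ 2 * normSq w := by
    simp only [normSq, Pi.smul_apply, smul_eq_mul, norm_mul, mul_pow, Finset.mul_sum]
  have h3 : normSq w ≠ 0 := by
    intro h0
    apply hw
    rw [normSq, Finset.sum_eq_zero_iff_of_nonneg fun _ _ => sq_nonneg _] at h0
    funext i
    have := h0 i (Finset.mem_univ i)
    simpa using this
  rw [h2] at h1
  have h4 : ‖μ‖ ^ 2 = 1 := mul_right_cancel₀ h3 (by rw [h1, one_mul])
  nlinarith [norm_nonneg μ]

lemma phase_arg {μ : ℂ} (hμ : ‖μ‖ = 1) : phase μ.arg = μ := by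
  rw [phase_eq_exp]
  have := Complex.norm_mul_exp_arg_mul_I μ
  rwa [hμ, Complex.ofReal_one, one_mul] at this

/-- The infimum that defines `alpha` is attained, since the spectrum is finite. -/
lemma alpha_mem (m : Vertex n) (δ : ℝ) {μ : ℂ}
    (h : Module.End.HasEigenvalue (Matrix.toLin' (searchOp n t m δ)) μ) (h1 : μ ≠ 1) :
    alpha n t m δ ≤ |μ.arg| ∧ ∃ ν : ℂ, ν ≠ 1 ∧ alpha n t m δ = |ν.arg| ∧
      Module.End.HasEigenvalue (Matrix.toLin' (searchOp n t m δ)) ν := by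
  set s := {x : ℝ | ∃ μ : ℂ, Module.End.HasEigenvalue (Matrix.toLin' (searchOp n t m δ)) μ ∧
    μ ≠ 1 ∧ x = |μ.arg|} with hs
  have hfin : s.Finite := by
    refine ((Module.End.finite_hasEigenvalue
      (Matrix.toLin' (searchOp n t m δ))).image fun μ : ℂ => |μ.arg|).subset ?_
    rintro x ⟨μ, hμ, _, rfl⟩
    exact ⟨μ, hμ, rfl⟩
  have hmem : |μ.arg| ∈ s := ⟨μ, h, h1, rfl⟩
  obtain ⟨ν, hν, hν1, hν2⟩ := Set.Nonempty.csInf_mem ⟨_, hmem⟩ hfin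
  exact ⟨csInf_le hfin.bddBelow hmem, ν, hν1, hν2, hν⟩

/-- The eigenphase `alpha` is a root of the secular equation as soon as that equation has a root
below the spectral gap of the walk. -/
lemma alpha_spec {m : Vertex n} {δ b : ℝ} (hδ : Real.cos δ ≠ 0) (h0 : 0 ≤ b) (h1 : b ≤ 1)
    (hμ : ∀ k ∈ momenta n, 0 < gap t k ∧ b ^ 2 ≤ gap t k)
    (hb : 1 ≤ secular (momenta n) (gap t) ((n : ℝ) ^ 2 * Real.tan δ ^ 2) b) :
    0 < alpha n t m δ ∧ alpha n t m δ ≤ b ∧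
      secular (momenta n) (gap t) ((n : ℝ) ^ 2 * Real.tan δ ^ 2) (alpha n t m δ) = 1 := by
  have hsin : ∀ β : ℝ, β ≠ 0 → |β| ≤ b → Real.sin β ≠ 0 := by
    intro β hβ0 hβ h
    rw [Real.sin_eq_zero_iff_of_lt_of_lt] at h
    · exact hβ0 h
    · linarith [neg_abs_le β, Real.pi_gt_three]
    · linarith [le_abs_self β, Real.pi_gt_three]
  have hgap : ∀ β : ℝ, |β| ≤ b →
      ∀ k ∈ momenta n, 0 < gap t k ∧ 1 - Real.cos β ≤ gap t k / 2 := by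
    intro β hβ k hk
    refine ⟨(hμ k hk).1, (one_sub_cos_le β).trans ?_⟩
    have : β ^ 2 ≤ b ^ 2 := by rw [← sq_abs β]; exact pow_le_pow_left₀ (abs_nonneg _) hβ 2
    linarith [(hμ k hk).2]
  obtain ⟨β, hβ0, hβb, hβ1⟩ := exists_secular_eq_one h0 h1 hμ hb
  have hβabs : |β| ≤ b := by rwa [abs_of_pos hβ0]
  have hβs := hsin β hβ0.ne' hβabs
  obtain ⟨g, hg, hgm, -⟩ := exists_isGreen_cos hβs (hgap β hβabs) m
  have hE := (secular_iff (n := n) hβs hδ).mpr hβ1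
  have hev : Module.End.HasEigenvalue (Matrix.toLin' (searchOp n t m δ)) (phase β) := by
    refine Module.End.hasEigenvalue_of_hasEigenvector (x := searchVec t m δ β g) ?_
    rw [Module.End.hasEigenvector_iff, Module.End.mem_eigenspace_iff]
    refine ⟨?_, ?_⟩
    · rw [Matrix.toLin'_apply]
      exact searchOp_mulVec_searchVec (cos_half_ne_zero hβs) hg hgm hE
    · intro h
      have h2 := star_target_dotProduct_searchVec δ hg hgm
      rw [hE, h, dotProduct_zero] at h2
      simp at h2
  have harg : (phase β).arg = β := by
    rw [phase_eq_exp, Complex.arg_exp_mul_I, toIocMod_eq_self]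
    constructor <;> linarith [Real.pi_gt_three]
  have hne : phase β ≠ 1 := by
    intro h
    rw [h, Complex.arg_one] at harg
    exact hβ0.ne harg
  obtain ⟨hle, ν, hν1, hνα, hν⟩ := alpha_mem m δ hev hne
  rw [harg] at hle
  have hαb := hle.trans hβabs
  obtain ⟨w, hw⟩ := hν.exists_hasEigenvector
  have hw0 := hw.2
  have hwe : searchOp n t m δ *ᵥ w = ν • w := by
    rw [← Matrix.toLin'_apply]; exact hw.apply_eq_smul
  have hνn := norm_eq_one_of_eigenvector hw0 hwe
  have hνp := phase_arg hνn
  have hγ0 : ν.arg ≠ 0 := by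
    intro h
    rw [h] at hνp
    apply hν1
    rw [← hνp]
    simp [phase]
  have hγb : |ν.arg| ≤ b := hνα ▸ hαb
  have hγs := hsin _ hγ0 hγb
  have hgr := exists_isGreen_cos hγs (hgap _ hγb)
  obtain ⟨g', hg', hgm', -⟩ := hgr m
  have hE' := secular_of_eigenvector hγs (fun m => (hgr m).imp fun _ h => h.1) hg' hgm' hw0
    (by rw [hνp]; exact hwe)
  have hsec := (secular_iff (n := n) hγs hδ).mp hE'
  refine ⟨hνα ▸ abs_pos.mpr hγ0, hαb, ?_⟩
  rw [hνα]
  rcases abs_choice ν.arg with h | h <;> rw [h]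
  · exact hsec
  · rw [secular_neg]
    exact hsec

end Eigenphase

/-! ### The success amplitude -/

/-- Amplitude of a target `T` after `Q` steps of a unitary `A` from `s`, when `s` lies near the span
of two eigenvectors with eigenvalues `e^{±iα}`. The part of `s` outside that span contributes at
most its norm. -/
lemma amplitude_ge {I : Type} [Fintype I] [DecidableEq I] {A : Matrix I I ℂ} (hA : Aᴴ * A = 1)
    {T s v₁ v₂ : I → ℂ} {α κ ρ ν : ℝ} (hα : Real.sin α ≠ 0)
    (h₁ : A *ᵥ v₁ = phase α • v₁) (h₂ : A *ᵥ v₂ = phase (-α) • v₂)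
    (hT₁ : star T ⬝ᵥ v₁ = 1) (hT₂ : star T ⬝ᵥ v₂ = 1)
    (hs₁ : star s ⬝ᵥ v₁ = κ * (1 + ρ * Complex.I))
    (hs₂ : star s ⬝ᵥ v₂ = κ * (1 - ρ * Complex.I))
    (hν₁ : normSq v₁ = ν) (hν₂ : normSq v₂ = ν) (hν : 0 < ν)
    (hs : normSq s = 1) (hT : normSq T = 1) (Q : ℕ) :
    0 ≤ 1 - 2 * κ ^ 2 * (1 + ρ ^ 2) / ν ∧
      |2 * κ / ν * (Real.cos (Q * α) + ρ * Real.sin (Q * α))| -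
        Real.sqrt (1 - 2 * κ ^ 2 * (1 + ρ ^ 2) / ν) ≤ ‖star T ⬝ᵥ ((A ^ Q) *ᵥ s)‖ := by
  have hνc : (ν : ℂ) ≠ 0 := by exact_mod_cast hν.ne'
  -- Eigenvectors of a unitary matrix for different eigenvalues are orthogonal.
  have horth : star v₁ ⬝ᵥ v₂ = 0 := by
    have h := star_mulVec_dotProduct_mulVec hA v₁ v₂
    rw [h₁, h₂, star_smul, smul_dotProduct, dotProduct_smul, star_phase, smul_eq_mul,
      smul_eq_mul] at h
    have h3 : (phase (-α) ^ 2 - 1) * (star v₁ ⬝ᵥ v₂) = 0 := by linear_combination h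
    refine (mul_eq_zero.mp h3).resolve_left fun h4 => ?_
    have h5 : phase α = phase (-α) := by
      linear_combination (-phase α) * h4 + phase (-α) * phase_mul_phase_neg α
    have h6 := congrArg Complex.im h5
    simp only [phase, Complex.add_im, Complex.mul_I_im, Complex.ofReal_im, Complex.ofReal_re,
      Real.sin_neg] at h6
    exact hα (by linarith)
  have horth' : star v₂ ⬝ᵥ v₁ = 0 := by rw [star_dotProduct_comm, horth, star_zero]
  have hs₁' : star v₁ ⬝ᵥ s = κ * (1 - ρ * Complex.I) := by
    rw [star_dotProduct_comm, hs₁]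
    simp only [RCLike.star_def, map_mul, map_add, map_one, Complex.conj_ofReal, Complex.conj_I]
    ring
  have hs₂' : star v₂ ⬝ᵥ s = κ * (1 + ρ * Complex.I) := by
    rw [star_dotProduct_comm, hs₂]
    simp only [RCLike.star_def, map_mul, map_sub, map_one, Complex.conj_ofReal, Complex.conj_I]
    ring
  set x₁ : ℂ := κ * (1 - ρ * Complex.I) / ν with hx₁
  set x₂ : ℂ := κ * (1 + ρ * Complex.I) / ν with hx₂
  set r : I → ℂ := s - x₁ • v₁ - x₂ • v₂ with hr
  have hr₁ : star v₁ ⬝ᵥ r = 0 := by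
    rw [hr, dotProduct_sub, dotProduct_sub, dotProduct_smul, dotProduct_smul, horth, hs₁',
      star_dotProduct_self, hν₁, hx₁]
    simp only [smul_eq_mul]
    field_simp
    ring
  have hr₂ : star v₂ ⬝ᵥ r = 0 := by
    rw [hr, dotProduct_sub, dotProduct_sub, dotProduct_smul, dotProduct_smul, horth', hs₂',
      star_dotProduct_self, hν₂, hx₂]
    simp only [smul_eq_mul]
    field_simp
    ring
  have hrs : star s ⬝ᵥ r = ((1 - 2 * κ ^ 2 * (1 + ρ ^ 2) / ν : ℝ) : ℂ) := by
    rw [hr, dotProduct_sub, dotProduct_sub, dotProduct_smul, dotProduct_smul, hs₁, hs₂,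
      star_dotProduct_self, hs, hx₁, hx₂]
    simp only [smul_eq_mul]
    push_cast
    field_simp
    linear_combination (2 * (κ : ℂ) ^ 2 * (ρ : ℂ) ^ 2) * Complex.I_sq
  have hrr : normSq r = 1 - 2 * κ ^ 2 * (1 + ρ ^ 2) / ν := by
    have h : star r ⬝ᵥ r = ((1 - 2 * κ ^ 2 * (1 + ρ ^ 2) / ν : ℝ) : ℂ) := by
      have e : star r = star s - star x₁ • star v₁ - star x₂ • star v₂ := by
        rw [hr, star_sub, star_sub, star_smul, star_smul]
      rw [e, sub_dotProduct, sub_dotProduct, smul_dotProduct, smul_dotProduct, hr₁, hr₂, hrs]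
      simp
    rw [star_dotProduct_self] at h
    exact_mod_cast h
  refine ⟨hrr ▸ normSq_nonneg r, ?_⟩
  have hpow : ∀ (β : ℝ) (v : I → ℂ), A *ᵥ v = phase β • v →
      (A ^ Q) *ᵥ v = phase (Q * β) • v := by
    intro β v hv
    rw [← phase_pow]
    induction Q with
    | zero => simp
    | succ Q ih =>
      rw [pow_succ', ← Matrix.mulVec_mulVec, ih, Matrix.mulVec_smul, hv, smul_smul, pow_succ]
  have hdec : s = r + x₁ • v₁ + x₂ • v₂ := by rw [hr]; abel
  have hamp : star T ⬝ᵥ ((A ^ Q) *ᵥ s) = star T ⬝ᵥ ((A ^ Q) *ᵥ r) +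
      ((2 * κ / ν * (Real.cos (Q * α) + ρ * Real.sin (Q * α)) : ℝ) : ℂ) := by
    conv_lhs => rw [hdec, Matrix.mulVec_add, Matrix.mulVec_add, Matrix.mulVec_smul,
      Matrix.mulVec_smul, hpow _ _ h₁, hpow _ _ h₂, dotProduct_add, dotProduct_add,
      dotProduct_smul, dotProduct_smul, dotProduct_smul, dotProduct_smul, hT₁, hT₂, mul_neg]
    rw [hx₁, hx₂]
    simp only [smul_eq_mul, phase, Real.cos_neg, Real.sin_neg]
    push_cast [-Complex.ofReal_cos, -Complex.ofReal_sin]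
    field_simp
    linear_combination (-2 * (κ : ℂ) * ρ * (Real.sin (Q * α) : ℂ)) * Complex.I_sq
  have herr : ‖star T ⬝ᵥ ((A ^ Q) *ᵥ r)‖ ≤ Real.sqrt (1 - 2 * κ ^ 2 * (1 + ρ ^ 2) / ν) := by
    refine Real.le_sqrt_of_sq_le ((norm_star_dotProduct_sq_le _ _).trans ?_)
    rw [normSq_pow_mulVec hA, hT, hrr, one_mul]
  rw [hamp, add_comm (star T ⬝ᵥ _)]
  have h := norm_sub_le_norm_add
    ((2 * κ / ν * (Real.cos (Q * α) + ρ * Real.sin (Q * α)) : ℝ) : ℂ) (star T ⬝ᵥ ((A ^ Q) *ᵥ r))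
  rw [Complex.norm_real, Real.norm_eq_abs] at h
  linarith

/-- After `⌊π / (2α)⌋` steps the rotation angle `(Q + 1/2) α` is within `α / 2` of `π / 2`. -/
lemma cos_half_le_sin_floor {α : ℝ} (h0 : 0 < α) (h1 : α ≤ 1) :
    Real.cos (α / 2) ≤ Real.sin ((⌊Real.pi / (2 * α)⌋₊ + 1 / 2) * α) := by
  have hx : 0 ≤ Real.pi / (2 * α) := by positivity
  have hle := Nat.floor_le hx
  have hlt := Nat.lt_floor_add_one (Real.pi / (2 * α))
  have e : Real.pi / (2 * α) * α = Real.pi / 2 := by field_simp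
  have hle' := mul_le_mul_of_nonneg_right hle h0.le
  have hlt' := mul_lt_mul_of_pos_right hlt h0
  rw [e] at hle' hlt'
  rw [← Real.cos_sub_pi_div_two, ← Real.cos_abs (_ - _)]
  refine Real.cos_le_cos_of_nonneg_of_le_pi (abs_nonneg _) (by linarith [Real.pi_gt_three]) ?_
  rw [abs_le]
  constructor <;> linarith

section Success

variable {n : ℕ} [NeZero n] {t : ℕ}

/-- The exact norm of the eigenvector of `e^{iβ}` when the secular equation holds, written with
`s = sin (β / 2)` and `c = cos (β / 2)`. Twice the weight of the starting state is the leading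
part. -/
lemma norm_defect {p q s c R₁ R₂ y : ℝ} (hs : s ≠ 0) (hc : c ≠ 0) (hsc : s ^ 2 + c ^ 2 = 1)
    (hq : q = p * y) (hsec : 2 * s ^ 2 * R₁ + y * s ^ 2 / c ^ 2 = 1) :
    p * (2 * (2 * s * c) ^ 2 * (((2 * s ^ 2) ^ 2)⁻¹ + R₂) +
        2 * (1 - 2 * s ^ 2) * (-(2 * s ^ 2)⁻¹ + R₁)) + q / c ^ 2 - 2 * (p / s ^ 2) =
      p * (2 * (2 * s * c) ^ 2 * R₂ - 2) + 2 * q * (s / c) ^ 2 := by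
  have hR : R₁ = (1 - y * s ^ 2 / c ^ 2) / (2 * s ^ 2) := by
    field_simp at hsec ⊢
    linarith
  rw [hR, hq]
  have hc2 : c ^ 2 = 1 - s ^ 2 := by linarith
  have hc4 : c ^ 4 = (1 - s ^ 2) ^ 2 := by rw [← hc2]; ring
  field_simp
  ring_nf
  rw [hc4, hc2]
  ring

/-- Lower bound for the success probability, given that the weight of the starting state outside
the two relevant eigenspaces is small compared with the main term. -/
lemma successProb_ge {m : Vertex n} {δ : ℝ} (hδ : Real.cos δ ≠ 0) (h0 : 0 < alpha n t m δ)
    (h1 : alpha n t m δ ≤ 1)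
    (hμ : ∀ k ∈ momenta n, 0 < gap t k ∧ 1 - Real.cos (alpha n t m δ) ≤ gap t k / 2)
    (hsec : secular (momenta n) (gap t) ((n : ℝ) ^ 2 * Real.tan δ ^ 2) (alpha n t m δ) = 1)
    {e : ℝ} (he : alpha n t m δ ^ 4 * (2 * ∑ k ∈ momenta n, ((gap t k)⁻¹) ^ 2 +
      (n : ℝ) ^ 2 * Real.tan δ ^ 2 / 2) ≤ e) (he2 : e ≤ 2)
    (he4 : 4 * e ≤ (n : ℝ) ^ 2 * alpha n t m δ ^ 2 * (1 + Real.tan δ ^ 2) / 64) :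
    (n : ℝ) ^ 2 * alpha n t m δ ^ 2 * (1 + Real.tan δ ^ 2) / 256 ≤ successProb n t m δ := by
  rw [successProb_eq, iterations]
  set α := alpha n t m δ with hα
  set Q := ⌊Real.pi / (2 * α)⌋₊ with hQ
  have hn : (0 : ℝ) < n := by exact_mod_cast NeZero.pos n
  have hsinpos : 0 < Real.sin α := by linarith [half_le_sin h0.le h1]
  have hsin := hsinpos.ne'
  have hsin' : Real.sin (-α) ≠ 0 := by rw [Real.sin_neg]; exact neg_ne_zero.mpr hsin
  have hcpos : 0 < Real.cos (α / 2) := Real.cos_pos_of_mem_Ioo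
    ⟨by linarith [Real.pi_pos], by linarith [Real.pi_gt_three]⟩
  have hspos : 0 < Real.sin (α / 2) :=
    Real.sin_pos_of_pos_of_lt_pi (by linarith) (by linarith [Real.pi_gt_three])
  have hsneg : Real.sin (-α / 2) ≠ 0 := by
    rw [neg_div, Real.sin_neg]; exact neg_ne_zero.mpr hspos.ne'
  obtain ⟨g, hg, hgm, hgn⟩ := exists_isGreen_cos hsin hμ m
  have hg' : IsGreen t (Real.cos (-α)) m g := by rwa [Real.cos_neg]
  have hE := (secular_iff (n := n) hsin hδ).mpr hsec
  have hE' : Real.cos δ ^ 2 * Real.sin (-α) * (((n : ℝ) ^ 2)⁻¹ * (-(1 - Real.cos α)⁻¹ +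
      ∑ k ∈ momenta n, (gap t k - (1 - Real.cos α))⁻¹)) +
        Real.sin δ ^ 2 * Real.tan (-α / 2) = 0 := by
    rw [Real.sin_neg, neg_div, Real.tan_neg]
    linarith
  set R₁ := ∑ k ∈ momenta n, (gap t k - (1 - Real.cos α))⁻¹ with hR₁
  set R₂ := ∑ k ∈ momenta n, ((gap t k - (1 - Real.cos α)) ^ 2)⁻¹ with hR₂
  set G := ((n : ℝ) ^ 2)⁻¹ * (-(1 - Real.cos α)⁻¹ + R₁) with hG
  set c := Real.cos (α / 2) with hc
  set s := Real.sin (α / 2) with hs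
  have hsc : s ^ 2 + c ^ 2 = 1 := Real.sin_sq_add_cos_sq (α / 2)
  have hcosα : 1 - Real.cos α = 2 * s ^ 2 := by
    have := Real.cos_two_mul (α / 2)
    rw [mul_div_cancel₀ α two_ne_zero, ← hc] at this
    linarith
  have hsinα : Real.sin α = 2 * s * c := by
    rw [hs, hc, ← Real.sin_two_mul, mul_div_cancel₀ α two_ne_zero]
  set κ := Real.cos δ / n with hκ
  set ρ := c / s with hρ
  set y := (n : ℝ) ^ 2 * Real.tan δ ^ 2 with hy
  set ν := Real.cos δ ^ 2 * (2 * Real.sin α ^ 2 * normSq g + 2 * Real.cos α * G) +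
    Real.sin δ ^ 2 / c ^ 2 with hν
  have hκ0 : κ ≠ 0 := div_ne_zero hδ hn.ne'
  clear_value κ ρ y R₁ R₂
  -- `X` is the unnormalized weight of the starting state in each of the two eigenspaces.
  set X := κ ^ 2 / s ^ 2 with hX
  have hXpos : 0 < X := by positivity
  clear_value X
  have hXρ : κ ^ 2 * (1 + ρ ^ 2) = X := by
    rw [hX, hρ]
    field_simp
    linarith
  have hq : Real.sin δ ^ 2 = κ ^ 2 * y := by
    rw [hκ, hy, Real.tan_eq_sin_div_cos]
    field_simp
  have hdef : ν - 2 * X = κ ^ 2 * (2 * Real.sin α ^ 2 * R₂ - 2) +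
      2 * Real.sin δ ^ 2 * Real.tan (α / 2) ^ 2 := by
    have hsec' : 2 * s ^ 2 * R₁ + y * s ^ 2 / c ^ 2 = 1 := by
      rw [secular, Real.tan_eq_sin_div_cos, ← hs, ← hc, ← hR₁, hsinα] at hsec
      rw [← hsec]
      field_simp
    have h := norm_defect (R₂ := R₂) hspos.ne' hcpos.ne' hsc hq hsec'
    have hc1 : Real.cos α = 1 - 2 * s ^ 2 := by linarith
    have hκn : Real.cos δ ^ 2 = κ ^ 2 * (n : ℝ) ^ 2 := by rw [hκ]; field_simp
    rw [hν, hgn, hG, hcosα, hc1, hsinα, Real.tan_eq_sin_div_cos, ← hs, ← hc, ← h, hκn,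
      hX]
    field_simp
  have hsle : s ≤ α / 2 := Real.sin_le (by linarith)
  have htan := tan_half_le h0.le h1
  have htan0 : 0 ≤ Real.tan (α / 2) := le_trans (by linarith) (half_le_tan h0.le h1)
  have hy0 : 0 ≤ y := by rw [hy]; positivity
  have hR₂0 : 0 ≤ R₂ := by rw [hR₂]; exact Finset.sum_nonneg fun k hk => by positivity
  have hdefX : ν - 2 * X ≤ e * X := by
    have h2 : R₂ ≤ 4 * ∑ k ∈ momenta n, ((gap t k)⁻¹) ^ 2 := hR₂ ▸ sum_inv_shift_sq_le hμ
    have hsα : Real.sin α ≤ α := Real.sin_le h0.le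
    have h3 : ν - 2 * X ≤ X * (s ^ 2 * (2 * Real.sin α ^ 2 * R₂ + 2 * y * Real.tan (α / 2) ^ 2)) := by
      rw [hdef, hq, hX]
      have : κ ^ 2 / s ^ 2 * (s ^ 2 * (2 * Real.sin α ^ 2 * R₂ + 2 * y * Real.tan (α / 2) ^ 2)) =
          κ ^ 2 * (2 * Real.sin α ^ 2 * R₂ + 2 * y * Real.tan (α / 2) ^ 2) := by
        field_simp
      rw [this]
      refine le_trans (le_of_eq ?_) (sub_le_self _ (by positivity : 0 ≤ 2 * κ ^ 2))
      ring
    have h4 : s ^ 2 * (2 * Real.sin α ^ 2 * R₂ + 2 * y * Real.tan (α / 2) ^ 2) ≤ e := by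
      refine le_trans ?_ he
      calc s ^ 2 * (2 * Real.sin α ^ 2 * R₂ + 2 * y * Real.tan (α / 2) ^ 2) ≤
          (α / 2) ^ 2 * (2 * α ^ 2 * (4 * ∑ k ∈ momenta n, ((gap t k)⁻¹) ^ 2) +
            2 * y * α ^ 2) := by gcongr
        _ = _ := by ring
    calc ν - 2 * X ≤ _ := h3
      _ ≤ X * e := by gcongr
      _ = e * X := mul_comm _ _
  have hνpos : 0 < ν := by
    -- The norm is nonzero because the overlap with the target is `1`.
    have h2 : normSq (searchVec t m δ α g) = ν := normSq_searchVec δ hcpos.ne' hg hgm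
    rw [← h2]
    refine lt_of_le_of_ne (normSq_nonneg _) fun h3 => ?_
    have h4 := norm_star_dotProduct_sq_le (targetState n t m δ) (searchVec t m δ α g)
    rw [star_target_dotProduct_searchVec δ hg hgm, hE, ← h3] at h4
    norm_num at h4
  obtain ⟨hb, hamp⟩ := amplitude_ge (searchOp_unitary n t m δ) (T := targetState n t m δ)
    (s := startState n t) (v₁ := searchVec t m δ α g) (v₂ := searchVec t m δ (-α) g)
    (α := α) (κ := κ) (ρ := ρ) (ν := ν) hsin
    (searchOp_mulVec_searchVec hcpos.ne' hg hgm hE)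
    (searchOp_mulVec_searchVec (cos_half_ne_zero hsin') hg' hgm hE')
    (by rw [star_target_dotProduct_searchVec δ hg hgm, hE]; simp)
    (by rw [star_target_dotProduct_searchVec δ hg' hgm, hE']; simp)
    (by rw [star_start_dotProduct_searchVec δ hspos.ne' hg, hκ, hρ])
    (by
      rw [star_start_dotProduct_searchVec δ hsneg hg', neg_div, Real.sin_neg, Real.cos_neg,
        ← hs, ← hc, div_neg, ← hρ, ← hκ]
      push_cast
      ring)
    (normSq_searchVec δ hcpos.ne' hg hgm)
    (by
      rw [normSq_searchVec δ (cos_half_ne_zero hsin') hg' hgm, neg_div, Real.sin_neg, neg_sq,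
        Real.cos_neg, Real.cos_neg])
    hνpos (normSq_startState n t) (normSq_targetState n t m δ) Q
  have hε : 1 - 2 * κ ^ 2 * (1 + ρ ^ 2) / ν = (ν - 2 * X) / ν := by
    rw [mul_assoc, hXρ]
    field_simp
  rw [hε] at hb hamp
  have hνX : 2 * X ≤ ν := by
    have := (div_nonneg_iff.mp hb)
    rcases this with h | h <;> linarith [h.1, h.2]
  have hεe : (ν - 2 * X) / ν ≤ e := by
    have he0 : 0 ≤ e := nonneg_of_mul_nonneg_left ((sub_nonneg.mpr hνX).trans hdefX) hXpos
    rw [div_le_iff₀ hνpos]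
    exact hdefX.trans (mul_le_mul_of_nonneg_left (by linarith) he0)
  set M := (n : ℝ) ^ 2 * α ^ 2 * (1 + Real.tan δ ^ 2) / 64 with hM
  have hM' : M = (n * α / (8 * |Real.cos δ|)) ^ 2 := by
    have : 1 + Real.tan δ ^ 2 = (Real.cos δ ^ 2)⁻¹ := by
      rw [Real.tan_eq_sin_div_cos]
      field_simp
      rw [add_comm, Real.sin_sq_add_cos_sq]
    rw [hM, this, div_pow, mul_pow, mul_pow, sq_abs]
    field_simp
    norm_num
  have habs : 0 < |Real.cos δ| := abs_pos.mpr hδ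
  have hmain : n * α / (8 * |Real.cos δ|) ≤
      |2 * κ / ν * (Real.cos (Q * α) + ρ * Real.sin (Q * α))| := by
    have hrot : Real.cos (Q * α) + ρ * Real.sin (Q * α) =
        Real.sin ((Q + 1 / 2) * α) / s := by
      have e2 : ((Q : ℝ) + 1 / 2) * α = Q * α + α / 2 := by ring
      rw [e2, Real.sin_add, ← hs, ← hc, hρ]
      field_simp
      ring
    have hfl := cos_half_le_sin_floor h0 h1
    rw [← hQ, ← hc] at hfl
    have hν4 : ν ≤ 4 * X := by linarith [mul_le_mul_of_nonneg_right he2 hXpos.le]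
    have hκabs : 0 < |κ| := abs_pos.mpr hκ0
    have hsinp : 0 < Real.sin ((Q + 1 / 2) * α) := hcpos.trans_le hfl
    rw [hrot, abs_mul, abs_div, abs_mul, abs_two, abs_of_pos hνpos,
      abs_of_pos (div_pos hsinp hspos)]
    calc n * α / (8 * |Real.cos δ|) = α / 2 / (4 * |κ|) := by
          rw [hκ, abs_div, abs_of_pos hn]
          field_simp
          norm_num
      _ ≤ Real.sin α / (4 * |κ|) := by gcongr; exact half_le_sin h0.le h1
      _ = 2 * |κ| / (4 * X) * (c / s) := by
          rw [hsinα, hX, ← sq_abs κ]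
          field_simp
      _ ≤ 2 * |κ| / ν * (Real.sin ((Q + 1 / 2) * α) / s) := by gcongr
  have herr : Real.sqrt ((ν - 2 * X) / ν) ≤ n * α / (8 * |Real.cos δ|) / 2 := by
    rw [Real.sqrt_le_left (by positivity)]
    rw [div_pow, ← hM']
    linarith
  have hfin : n * α / (8 * |Real.cos δ|) / 2 ≤
      ‖star (targetState n t m δ) ⬝ᵥ (searchOp n t m δ ^ Q *ᵥ startState n t)‖ := by linarith
  have hsq := pow_le_pow_left₀ (by positivity) hfin 2
  rw [div_pow, ← hM', hM] at hsq
  linarith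

end Success

/-! ### Asymptotic bounds -/

lemma exists_le_logN (L₀ : ℝ) : ∃ n₀ : ℕ, 4 ≤ n₀ ∧ ∀ n : ℕ, n₀ ≤ n → L₀ ≤ logN n := by
  refine ⟨max 4 ⌈Real.exp L₀⌉₊, le_max_left _ _, fun n hn => ?_⟩
  have h4 : 4 ≤ n := (le_max_left _ _).trans hn
  have h1 : Real.exp L₀ ≤ n := Nat.ceil_le.mp ((le_max_right _ _).trans hn)
  have h2 : L₀ ≤ Real.log n := (Real.le_log_iff_exp_le (by positivity)).mpr h1
  have h3 := one_le_logN h4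
  rw [logN_eq] at h3 ⊢
  linarith

section Core

variable {n : ℕ} [NeZero n] {t : ℕ} {K : ℝ}

/-- `N log N / t + N tan² δ / 4`, the scale of `1 / α²`. -/
noncomputable def scale (n t : ℕ) (δ : ℝ) : ℝ :=
  (n : ℝ) ^ 2 * logN n / t + (n : ℝ) ^ 2 / 4 * Real.tan δ ^ 2

lemma inv_gap_le (hn : 4 ≤ n) (ht : Odd t) (htK : (t : ℝ) ≤ K * logN n) {k : Vertex n}
    (hk : k ∈ momenta n) : (gap t k)⁻¹ ≤ (8 * K ^ 2 + 6) * ((n : ℝ) ^ 2 / t) := by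
  have h1 : ((gap t k)⁻¹) ^ 2 ≤ (8 * K ^ 2 + 6) * ((n : ℝ) ^ 2 / t) ^ 2 :=
    (Finset.single_le_sum (f := fun k => ((gap t k)⁻¹) ^ 2) (fun k _ => sq_nonneg _) hk).trans
      (sum_inv_gap_sq_le hn ht htK)
  refine le_of_sq_le_sq (h1.trans ?_) (by positivity)
  rw [mul_pow]
  refine mul_le_mul_of_nonneg_right ?_ (by positivity)
  nlinarith [sq_nonneg K]

/-- The scale is at least `N log N / t`, hence at least of order `log² N`. -/
lemma le_scale (δ : ℝ) (hK : 0 < K) (hn : 4 ≤ n) (ht : Odd t) (htK : (t : ℝ) ≤ K * logN n) :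
    (n : ℝ) ^ 2 * logN n / t ≤ scale n t δ ∧ logN n ^ 2 ≤ 4 * K * scale n t δ := by
  have htpos : (0 : ℝ) < t := by exact_mod_cast ht.pos
  have hnpos : (0 : ℝ) < n := by exact_mod_cast NeZero.pos n
  have hLn := logN_le hn
  have hL := one_le_logN hn
  have hBX : (n : ℝ) ^ 2 * logN n / t ≤ scale n t δ := by
    rw [scale]
    exact le_add_of_nonneg_right (by positivity)
  have hX : (n : ℝ) ^ 2 / K ≤ (n : ℝ) ^ 2 * logN n / t := by
    rw [div_le_div_iff₀ hK htpos, mul_assoc]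
    exact mul_le_mul_of_nonneg_left (by linarith) (by positivity)
  refine ⟨hBX, ?_⟩
  have h1 := hX.trans hBX
  rw [div_le_iff₀ hK] at h1
  calc logN n ^ 2 ≤ (2 * n) ^ 2 := by gcongr
    _ = 4 * (n : ℝ) ^ 2 := by ring
    _ ≤ 4 * K * scale n t δ := by linarith

/-- Bounds for the eigenphase, once `log N` exceeds a constant that depends on `K` only. -/
lemma alpha_bounds {m : Vertex n} {δ : ℝ} {D C₂ : ℝ} (hK : 0 < K)
    (hD : D = 8 * K ^ 2 + 6) (hC₂ : C₂ = 2 * (K + 8))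
    (hn : 4 ≤ n) (ht : Odd t) (htK : (t : ℝ) ≤ K * logN n) (hδ : Real.cos δ ≠ 0)
    (hL : 512 * D + 2048 * K ≤ logN n) :
    0 < alpha n t m δ ∧ alpha n t m δ ≤ 1 ∧ alpha n t m δ ^ 2 * scale n t δ ≤ 512 ∧
      1 ≤ C₂ * (alpha n t m δ ^ 2 * scale n t δ) ∧
      (∀ k ∈ momenta n, 0 < gap t k ∧ 1 - Real.cos (alpha n t m δ) ≤ gap t k / 2) ∧
      secular (momenta n) (gap t) ((n : ℝ) ^ 2 * Real.tan δ ^ 2) (alpha n t m δ) = 1 := by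
  have htpos : (0 : ℝ) < t := by exact_mod_cast ht.pos
  have hnpos : (0 : ℝ) < n := by exact_mod_cast NeZero.pos n
  have hL1 := one_le_logN hn
  have hDpos : 0 < D := by rw [hD]; positivity
  have hC₂pos : 0 < C₂ := by rw [hC₂]; positivity
  have hsumlo := le_sum_inv_gap hn ht
  have hsumhi := sum_inv_gap_le hn ht htK
  have hinv : ∀ k ∈ momenta n, (gap t k)⁻¹ ≤ (8 * K ^ 2 + 6) * ((n : ℝ) ^ 2 / t) :=
    fun k hk => inv_gap_le hn ht htK hk
  obtain ⟨hBX, hLB⟩ := le_scale δ hK hn ht htK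
  set L := logN n with hLdef
  have hLpos : 0 < L := by linarith
  set N : ℝ := (n : ℝ) ^ 2 with hN
  have hNpos : 0 < N := by positivity
  set τ := Real.tan δ with hτ
  set B := scale n t δ with hB
  have hBdef : B = N * L / t + N / 4 * τ ^ 2 := by rw [hB, scale]
  have hBpos : 0 < B := lt_of_lt_of_le (by positivity) hBX
  clear_value L N τ B
  have hB512 : 512 ≤ B := by
    have h1 : 2048 * K ≤ L ^ 2 := by nlinarith
    have h2 : K * 512 ≤ K * B := by linarith
    exact le_of_mul_le_mul_left h2 hK
  -- A root of the secular equation lies below `b = √(512 / B)`. Here `512 = 4 · 128`, and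
  -- `1 / 128 ≤ 1 / (8π²)` is the constant in the lower bound for the spectral sum.
  set b := Real.sqrt (512 / B) with hb
  have hb2 : b ^ 2 = 512 / B := Real.sq_sqrt (by positivity)
  have hb0 : 0 ≤ b := Real.sqrt_nonneg _
  have hb1 : b ≤ 1 := by
    rw [hb, Real.sqrt_le_one, div_le_one hBpos]
    exact hB512
  have hgapb : ∀ k ∈ momenta n, 0 < gap t k ∧ b ^ 2 ≤ gap t k := by
    intro k hk
    have hpos := (gap_pos_and_inv_le ht (Finset.ne_of_mem_erase hk)).1
    refine ⟨hpos, ?_⟩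
    have h1 := hinv k hk
    rw [← hD, inv_le_iff_one_le_mul₀ hpos] at h1
    have h2 : b ^ 2 * (D * (N / t)) ≤ 1 := by
      rw [hb2, div_mul_eq_mul_div, div_le_one hBpos]
      refine le_trans ?_ hBX
      calc 512 * (D * (N / t)) = (512 * D) * (N / t) := by ring
        _ ≤ L * (N / t) := by gcongr; linarith
        _ = N * L / t := by ring
    by_contra hlt
    push Not at hlt
    have h3 : D * (N / t) * gap t k < D * (N / t) * b ^ 2 :=
      mul_lt_mul_of_pos_left hlt (by positivity)
    linarith
  have hy0 : 0 ≤ N * τ ^ 2 := by positivity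
  have hsecb : 1 ≤ secular (momenta n) (gap t) (N * τ ^ 2) b := by
    have h1 := le_secular hb0 hb1 hy0 fun k hk =>
      ⟨(hgapb k hk).1, (one_sub_cos_le b).trans (by linarith [(hgapb k hk).2])⟩
    refine le_trans ?_ h1
    have hpi : (1 : ℝ) / 128 ≤ (8 * Real.pi ^ 2)⁻¹ := by
      rw [one_div]
      refine inv_anti₀ (by positivity) ?_
      nlinarith [Real.pi_le_four, Real.pi_pos]
    have h2 : 1 / 128 * B ≤ ∑ k ∈ momenta n, (gap t k)⁻¹ + N * τ ^ 2 := by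
      have h3 : 1 / 128 * (N * L / t) ≤ (8 * Real.pi ^ 2)⁻¹ * (N * L / t) := by gcongr
      rw [hBdef]
      linarith
    calc (1 : ℝ) = b ^ 2 / 4 * (1 / 128 * B) := by rw [hb2]; field_simp; norm_num
      _ ≤ _ := by gcongr
  obtain ⟨hα0, hαb, hsec⟩ := alpha_spec (m := m) hδ hb0 hb1 hgapb
    (by rw [← hN, ← hτ]; exact hsecb)
  rw [← hN, ← hτ] at hsec
  set α := alpha n t m δ with hα
  have hα1 := hαb.trans hb1
  have hα2 : α ^ 2 ≤ 512 / B := hb2 ▸ pow_le_pow_left₀ hα0.le hαb 2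
  have hgapα : ∀ k ∈ momenta n, 0 < gap t k ∧ 1 - Real.cos α ≤ gap t k / 2 := fun k hk =>
    ⟨(hgapb k hk).1, (one_sub_cos_le α).trans (by linarith [(hgapb k hk).2])⟩
  have hup : α ^ 2 * B ≤ 512 := by rwa [le_div_iff₀ hBpos] at hα2
  have hlow : 1 ≤ C₂ * (α ^ 2 * B) := by
    have h1 := secular_le hα0.le hα1 hy0 hgapα
    rw [hsec] at h1
    have h2 : 2 * ∑ k ∈ momenta n, (gap t k)⁻¹ + N * τ ^ 2 ≤ C₂ * B := by
      rw [hBdef, hC₂]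
      have h3 : 0 ≤ K * (N / 4 * τ ^ 2) := by positivity
      have h4 : 0 ≤ N / 4 * τ ^ 2 := by positivity
      linarith
    calc (1 : ℝ) ≤ _ := h1
      _ ≤ α ^ 2 * (C₂ * B) := by gcongr
      _ = _ := by ring
  exact ⟨hα0, hα1, hup, hlow, hgapα, hsec⟩

/-- The main term of the success probability dominates `min {1, t (1 + τ²) / L}`. -/
lemma min_le_main {N L T τ B x C : ℝ} (hN : 0 < N) (hL : 0 < L) (hT : 0 < T) (hC : 0 < C)
    (hx : 0 ≤ x) (hB : B = N * L / T + N / 4 * τ ^ 2) (hlow : 1 ≤ C * (x * B)) :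
    min 1 (T * (1 + τ ^ 2) / L) ≤ 2 * C * (N * x * (1 + τ ^ 2)) := by
  set w := min 1 (T * (1 + τ ^ 2) / L) with hw
  have hw1 : w ≤ 1 := min_le_left _ _
  have hw2 : w ≤ T * (1 + τ ^ 2) / L := min_le_right _ _
  have hw0 : 0 ≤ w := le_min zero_le_one (by positivity)
  clear_value w
  have hwB : w * B ≤ 2 * (N * (1 + τ ^ 2)) := by
    have h1 : w * (N * L / T) ≤ N * (1 + τ ^ 2) := by
      calc w * (N * L / T) ≤ T * (1 + τ ^ 2) / L * (N * L / T) := by gcongr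
        _ = N * (1 + τ ^ 2) := by field_simp
    have h2 : w * (N / 4 * τ ^ 2) ≤ N * (1 + τ ^ 2) := by
      calc w * (N / 4 * τ ^ 2) ≤ 1 * (N / 4 * τ ^ 2) := by gcongr
        _ ≤ _ := by linarith [mul_nonneg hN.le (sq_nonneg τ)]
    rw [hB, mul_add]
    linarith
  calc w = w * 1 := (mul_one w).symm
    _ ≤ w * (C * (x * B)) := by gcongr
    _ = C * x * (w * B) := by ring
    _ ≤ C * x * (2 * (N * (1 + τ ^ 2))) := by gcongr
    _ = _ := by ring

/-- The weight of the starting state outside the two relevant eigenspaces is `O(1 / log² N)`. -/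
lemma error_le {N L T τ B α K D S : ℝ} (hN : 0 < N) (hL : 0 < L) (hT : 0 < T) (hBpos : 0 < B)
    (hD : 0 < D) (hB : B = N * L / T + N / 4 * τ ^ 2) (hBX : N * L / T ≤ B)
    (hLB : L ^ 2 ≤ 4 * K * B) (hα : α ^ 2 ≤ 512 / B) (hS0 : 0 ≤ S)
    (hS : S ≤ D * (N / T) ^ 2) :
    α ^ 4 * (2 * S + N * τ ^ 2 / 2) ≤ 512 ^ 2 * (2 * D + 8 * K) / L ^ 2 := by
  have h2 : α ^ 4 ≤ (512 / B) ^ 2 := by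
    calc α ^ 4 = (α ^ 2) ^ 2 := by ring
      _ ≤ _ := by gcongr
  have h3 : N * τ ^ 2 / 2 ≤ 2 * B := by
    have : 0 ≤ N * L / T := by positivity
    rw [hB]; linarith
  have h4 : (N / T) ^ 2 ≤ B ^ 2 / L ^ 2 := by
    rw [le_div_iff₀ (by positivity), ← mul_pow]
    refine pow_le_pow_left₀ (by positivity) ?_ 2
    calc N / T * L = N * L / T := by ring
      _ ≤ B := hBX
  have h5 : B ≤ 4 * K * (B ^ 2 / L ^ 2) := by
    rw [mul_div_assoc', le_div_iff₀ (by positivity)]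
    calc B * L ^ 2 ≤ B * (4 * K * B) := by gcongr
      _ = _ := by ring
  have h6 : S ≤ D * (B ^ 2 / L ^ 2) := hS.trans (by gcongr)
  have h7 : N * τ ^ 2 / 2 ≤ 2 * (4 * K * (B ^ 2 / L ^ 2)) := by linarith
  have h8 : 0 ≤ 2 * S + N * τ ^ 2 / 2 := by positivity
  calc α ^ 4 * (2 * S + N * τ ^ 2 / 2) ≤ (512 / B) ^ 2 * (2 * S + N * τ ^ 2 / 2) := by gcongr
    _ ≤ (512 / B) ^ 2 * (2 * (D * (B ^ 2 / L ^ 2)) + 2 * (4 * K * (B ^ 2 / L ^ 2))) := by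
        gcongr
    _ = _ := by
        field_simp
        ring

/-- Lower bound for the success probability, once `log N` exceeds a constant that depends on `K`
only. -/
lemma min_le_successProb {m : Vertex n} {δ : ℝ} {D E C₂ : ℝ} (hK : 0 < K)
    (hD : D = 8 * K ^ 2 + 6) (hC₂ : C₂ = 2 * (K + 8)) (hE : E = 512 ^ 2 * (2 * D + 8 * K))
    (hn : 4 ≤ n) (ht : Odd t) (htK : (t : ℝ) ≤ K * logN n) (hδ : Real.cos δ ≠ 0)
    (hL : 512 * D + 2048 * K + E + 512 * C₂ * E ≤ logN n) :
    min 1 (t * (1 + Real.tan δ ^ 2) / logN n) ≤ 512 * C₂ * successProb n t m δ := by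
  have htpos : (0 : ℝ) < t := by exact_mod_cast ht.pos
  have ht1 : (1 : ℝ) ≤ t := by exact_mod_cast ht.pos
  have hnpos : (0 : ℝ) < n := by exact_mod_cast NeZero.pos n
  have hNpos : (0 : ℝ) < (n : ℝ) ^ 2 := by positivity
  have hL1 := one_le_logN hn
  have hLpos : 0 < logN n := by linarith
  have hDpos : 0 < D := by rw [hD]; positivity
  have hC₂pos : 0 < C₂ := by rw [hC₂]; positivity
  have hEpos : 0 < E := by rw [hE]; positivity
  have hCE : 0 < 512 * C₂ * E := by positivity
  obtain ⟨hα0, hα1, hup, hlow, hgapα, hsec⟩ :=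
    alpha_bounds (m := m) hK hD hC₂ hn ht htK hδ (by linarith)
  obtain ⟨hBX, hLB⟩ := le_scale δ hK hn ht htK
  have hBpos : 0 < scale n t δ := lt_of_lt_of_le (by positivity) hBX
  have hmain := min_le_main hNpos hLpos htpos hC₂pos (sq_nonneg (alpha n t m δ)) rfl hlow
  have he := error_le hNpos hLpos htpos hBpos hDpos rfl hBX hLB
    ((le_div_iff₀ hBpos).mpr hup) (Finset.sum_nonneg fun k _ => sq_nonneg ((gap t k)⁻¹))
    (hD ▸ sum_inv_gap_sq_le hn ht htK)
  rw [← hE] at he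
  have hp := fun h2 h4 => successProb_ge (m := m) hδ hα0 hα1 hgapα hsec he h2 h4
  set P := (n : ℝ) ^ 2 * alpha n t m δ ^ 2 * (1 + Real.tan δ ^ 2) with hP
  set L := logN n with hLdef
  set w := min 1 (t * (1 + Real.tan δ ^ 2) / L) with hw
  have hwL : 1 / L ≤ w := by
    refine le_min ((div_le_one hLpos).mpr hL1) ?_
    gcongr
    exact one_le_mul_of_one_le_of_one_le ht1 (le_add_of_nonneg_right (sq_nonneg _))
  clear_value w P L
  have hEL : E / L ^ 2 = 1 / L * (E / L) := by
    rw [div_mul_div_comm, one_mul, sq]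
  have hE2 : E / L ^ 2 ≤ 2 := by
    have hEL1 : E / L ≤ 1 := by
      rw [div_le_one hLpos]
      linarith
    have h1 : 1 / L * (E / L) ≤ 1 :=
      mul_le_one₀ ((div_le_one hLpos).mpr hL1) (by positivity) hEL1
    linarith
  -- The error `O(1 / log² N)` is beaten by the main term, which is at least `1 / log N`.
  have hE4 : 4 * (E / L ^ 2) ≤ P / 64 := by
    have h1 : E / L * (512 * C₂) ≤ 1 := by
      rw [div_mul_eq_mul_div, div_le_one hLpos]
      linarith
    have h2 : E / L ^ 2 * (512 * C₂) ≤ w := by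
      calc E / L ^ 2 * (512 * C₂) = 1 / L * (E / L * (512 * C₂)) := by rw [hEL, mul_assoc]
        _ ≤ 1 / L * 1 := by gcongr
        _ ≤ w := by rw [mul_one]; exact hwL
    have h3 : 2 * C₂ * (256 * (E / L ^ 2)) ≤ 2 * C₂ * P := by linarith
    have h4 := le_of_mul_le_mul_left h3 (by positivity)
    linarith
  calc w ≤ _ := hmain
    _ = 512 * C₂ * (P / 256) := by ring
    _ ≤ _ := mul_le_mul_of_nonneg_left (hp hE2 hE4) (by positivity)

end Core

/-- Uniform form of the eigenphase and success probability bounds, with a single constant. -/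
lemma exists_uniform_bounds {K : ℝ} (hK : 0 < K) : ∃ C : ℝ, 1 ≤ C ∧ ∃ n₀ : ℕ, 4 ≤ n₀ ∧
    ∀ (n : ℕ) [NeZero n] (t : ℕ) (m : Vertex n) (δ : ℝ), n₀ ≤ n → Odd t →
      (t : ℝ) ≤ K * logN n → Real.cos δ ≠ 0 →
      0 < alpha n t m δ ∧ alpha n t m δ ≤ 1 ∧
      alpha n t m δ * Real.sqrt (scale n t δ) ≤ C ∧
      1 ≤ C * (alpha n t m δ * Real.sqrt (scale n t δ)) ∧
      C⁻¹ * min 1 (t * (1 + Real.tan δ ^ 2) / logN n) ≤ successProb n t m δ := by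
  set D : ℝ := 8 * K ^ 2 + 6 with hD
  set C₂ : ℝ := 2 * (K + 8) with hC₂
  set E : ℝ := 512 ^ 2 * (2 * D + 8 * K) with hE
  obtain ⟨n₀, h4, hn₀⟩ := exists_le_logN (512 * D + 2048 * K + E + 512 * C₂ * E)
  have hC₂1 : 1 ≤ C₂ := by linarith
  refine ⟨512 * C₂, by linarith, n₀, h4, ?_⟩
  intro n _ t m δ hn ht htK hδ
  have hEpos : 0 < E := by positivity
  have hCE : 0 < 512 * C₂ * E := by positivity
  obtain ⟨h0, h1, hup, hlow, -⟩ := alpha_bounds (m := m) hK hD hC₂ (h4.trans hn) ht htK hδ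
    (by linarith [hn₀ n hn])
  have hp := min_le_successProb (m := m) hK hD hC₂ hE (h4.trans hn) ht htK hδ (hn₀ n hn)
  have hB : 0 ≤ scale n t δ := by
    rw [scale]
    have := one_le_logN (h4.trans hn)
    positivity
  have hsq : (alpha n t m δ * Real.sqrt (scale n t δ)) ^ 2 =
      alpha n t m δ ^ 2 * scale n t δ := by
    rw [mul_pow, Real.sq_sqrt hB]
  have hx0 : 0 ≤ alpha n t m δ * Real.sqrt (scale n t δ) :=
    mul_nonneg h0.le (Real.sqrt_nonneg _)
  rw [← hsq] at hup hlow
  refine ⟨h0, h1, ?_, ?_, ?_⟩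
  · nlinarith
  · by_contra hlt
    push Not at hlt
    nlinarith
  · rw [inv_mul_le_iff₀ (by positivity)]
    exact hp

lemma ThetaWith.mono {C C' x y : ℝ} (h : ThetaWith C x y) (hx : 0 ≤ x) (hy : 0 ≤ y)
    (hC : C ≤ C') : ThetaWith C' x y :=
  ⟨h.1.trans (by gcongr), h.2.trans (by gcongr)⟩

lemma ThetaWith.trans {C A x y z : ℝ} (hC : 0 ≤ C) (hA : 0 ≤ A) (h : ThetaWith C x y)
    (h' : ThetaWith A y z) : ThetaWith (C * A) x z :=
  ⟨h.1.trans (by rw [mul_assoc]; exact mul_le_mul_of_nonneg_left h'.1 hC),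
    h'.2.trans (by rw [mul_comm C, mul_assoc]; exact mul_le_mul_of_nonneg_left h.2 hA)⟩

/-- The number of iterations is `1 / α` up to a factor of `2`. -/
lemma iterations_bounds {n : ℕ} [NeZero n] {t : ℕ} {m : Vertex n} {δ : ℝ}
    (h0 : 0 < alpha n t m δ) (h1 : alpha n t m δ ≤ 1) :
    (iterations n t m δ : ℝ) * alpha n t m δ ≤ 2 ∧
      1 ≤ 2 * ((iterations n t m δ : ℝ) * alpha n t m δ) := by
  rw [iterations]
  set α := alpha n t m δ
  have hx : 0 ≤ Real.pi / (2 * α) := by positivity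
  have e : Real.pi / (2 * α) * α = Real.pi / 2 := by field_simp
  have hle := mul_le_mul_of_nonneg_right (Nat.floor_le hx) h0.le
  have hlt := mul_lt_mul_of_pos_right (Nat.lt_floor_add_one (Real.pi / (2 * α))) h0
  rw [e] at hle hlt
  have hQ1 : (1 : ℝ) ≤ (⌊Real.pi / (2 * α)⌋₊ : ℕ) := by
    have : 1 ≤ ⌊Real.pi / (2 * α)⌋₊ := by
      rw [Nat.one_le_floor_iff, le_div_iff₀ (by positivity)]
      linarith [Real.pi_gt_three]
    exact_mod_cast this
  have hα : α ≤ (⌊Real.pi / (2 * α)⌋₊ : ℕ) * α := by nlinarith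
  constructor
  · linarith [Real.pi_le_four]
  · linarith [Real.pi_gt_three]

/-- The regime `t tan² δ = Θ(log N)`: the success probability and the numbers of queries. -/
lemma exists_balanced_bounds {K a b : ℝ} (hK : 0 < K) (ha : 0 < a) (hb : 0 < b) :
    ∃ C c : ℝ, 0 < C ∧ 0 < c ∧ ∃ n₀ : ℕ, 4 ≤ n₀ ∧
      ∀ (n : ℕ) [NeZero n] (t : ℕ) (m : Vertex n) (δ : ℝ), n₀ ≤ n → Odd t →
        (t : ℝ) ≤ K * logN n → Real.cos δ ≠ 0 →
        a * logN n ≤ t * Real.tan δ ^ 2 → t * Real.tan δ ^ 2 ≤ b * logN n →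
        c ≤ successProb n t m δ ∧
        ThetaWith C (oracleQueries n t m δ) (Real.sqrt ((n : ℝ) ^ 2 * logN n / t)) ∧
        ThetaWith C (graphQueries n t m δ) (Real.sqrt ((n : ℝ) ^ 2 * t * logN n)) ∧
        ThetaWith C ((oracleQueries n t m δ : ℝ) * (graphQueries n t m δ : ℝ))
          ((n : ℝ) ^ 2 * logN n) := by
  obtain ⟨C₀, hC₀, n₀, h4, H⟩ := exists_uniform_bounds hK
  set C : ℝ := 2 * C₀ * (1 + b) with hC
  have hC0 : 0 < C₀ := by linarith
  have hC1 : 1 ≤ C := by nlinarith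
  refine ⟨C ^ 2, C₀⁻¹ * min 1 a, by positivity, by positivity, n₀, h4, ?_⟩
  intro n _ t m δ hn ht htK hδ hlo hhi
  obtain ⟨h0, h1, hup, hlow, hp⟩ := H n t m δ hn ht htK hδ
  have hL := one_le_logN (h4.trans hn)
  have hLpos : 0 < logN n := by linarith
  have htpos : (0 : ℝ) < t := by exact_mod_cast ht.pos
  have hnpos : (0 : ℝ) < n := by exact_mod_cast NeZero.pos n
  obtain ⟨hQ1, hQ2⟩ := iterations_bounds h0 h1
  set Q : ℝ := (iterations n t m δ : ℝ) with hQ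
  set α := alpha n t m δ with hα
  set X : ℝ := (n : ℝ) ^ 2 * logN n / t with hX
  have hXpos : 0 < X := by positivity
  set Y : ℝ := Real.sqrt X with hY
  have hYpos : 0 < Y := Real.sqrt_pos.mpr hXpos
  have hYY : Y ^ 2 = X := Real.sq_sqrt hXpos.le
  set Z : ℝ := Real.sqrt (scale n t δ) with hZ
  have hZ1 : Y ≤ Z := by
    refine Real.sqrt_le_sqrt ?_
    rw [scale]
    exact le_add_of_nonneg_right (by positivity)
  have hZ2 : Z ≤ (1 + b) * Y := by
    rw [hZ, Real.sqrt_le_left (by positivity), mul_pow, hYY, scale]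
    have h2 : (n : ℝ) ^ 2 / 4 * Real.tan δ ^ 2 ≤ b / 4 * X := by
      calc (n : ℝ) ^ 2 / 4 * Real.tan δ ^ 2 = (n : ℝ) ^ 2 / (4 * t) * (t * Real.tan δ ^ 2) := by
            field_simp
        _ ≤ (n : ℝ) ^ 2 / (4 * t) * (b * logN n) := by gcongr
        _ = b / 4 * X := by rw [hX]; field_simp
    nlinarith [mul_pos hb hXpos, mul_pos (mul_pos hb hb) hXpos]
  have hQ0 : 0 ≤ Q := Nat.cast_nonneg _
  have hQY1 : Q ≤ C * Y := by
    -- `Q ≤ 2 / α` and `1 / α ≤ C₀ √B`.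
    have h2 : Q ≤ C₀ * (α * Z) * Q := by nlinarith
    calc Q ≤ C₀ * (α * Z) * Q := h2
      _ = C₀ * (Q * α) * Z := by ring
      _ ≤ C₀ * 2 * ((1 + b) * Y) := by gcongr
      _ = C * Y := by rw [hC]; ring
  have hQY2 : Y ≤ C * Q := by
    calc Y ≤ Z := hZ1
      _ = Z * 1 := (mul_one Z).symm
      _ ≤ Z * (2 * (Q * α)) := by gcongr
      _ = 2 * Q * (α * Z) := by ring
      _ ≤ 2 * Q * C₀ := by gcongr
      _ ≤ C * Q := by rw [hC]; nlinarith [mul_nonneg (mul_nonneg hQ0 hC0.le) hb.le]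
  have hCC : C ≤ C ^ 2 := by nlinarith
  have hsq : Real.sqrt ((n : ℝ) ^ 2 * t * logN n) = t * Y := by
    have : (n : ℝ) ^ 2 * t * logN n = (t * Y) ^ 2 := by
      rw [mul_pow, hYY, hX]
      field_simp
    rw [this, Real.sqrt_sq (by positivity)]
  have hprod : (n : ℝ) ^ 2 * logN n = t * Y ^ 2 := by rw [hYY, hX]; field_simp
  rw [oracleQueries_eq, graphQueries_eq, hsq, hprod]
  push_cast
  rw [← hQ]
  refine ⟨?_, ?_, ?_, ?_, ?_⟩
  · refine le_trans ?_ hp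
    gcongr
    rw [le_div_iff₀ hLpos]
    nlinarith
  · exact ThetaWith.mono ⟨hQY1, hQY2⟩ hQ0 hYpos.le hCC
  · refine ThetaWith.mono ⟨?_, ?_⟩ (by positivity) (by positivity) hCC
    · exact (mul_le_mul_of_nonneg_right hQY1 htpos.le).trans_eq (by ring)
    · exact (mul_le_mul_of_nonneg_left hQY2 htpos.le).trans_eq (by ring)
  · calc Q * (Q * t) = t * Q ^ 2 := by ring
      _ ≤ t * (C * Y) ^ 2 := by gcongr
      _ = _ := by ring
  · calc t * Y ^ 2 ≤ t * (C * Q) ^ 2 := by gcongr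
      _ = _ := by ring

end GridSearch

theorem mainTheorem8 :
    -- one iteration of the circuit performs the search operator
    (∀ (n : ℕ) [NeZero n] (t : ℕ) (m : GridSearch.Vertex n) (δ : ℝ)
        (ψ : GridSearch.AIdx n t → ℂ),
      GridSearch.run n m δ (GridSearch.iteration t) ψ = (GridSearch.searchOp n t m δ).mulVec ψ) ∧
    -- the success probability never exceeds 1, so that a constant lower bound means `Θ(1)`
    (∀ (n : ℕ) [NeZero n] (t : ℕ) (m : GridSearch.Vertex n) (δ : ℝ),
      GridSearch.successProb n t m δ ≤ 1) ∧
    -- eigenphase and success probability, for odd `t = O(log N)` and every `δ`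
    (∀ K : ℝ, 0 < K → ∃ C c : ℝ, 0 < C ∧ 0 < c ∧ ∃ n₀ : ℕ,
      ∀ (n : ℕ) [NeZero n] (t : ℕ) (m : GridSearch.Vertex n) (δ : ℝ), n₀ ≤ n → Odd t →
        (t : ℝ) ≤ K * GridSearch.logN n → Real.cos δ ≠ 0 →
        GridSearch.ThetaWith C (GridSearch.alpha n t m δ)
          (1 / Real.sqrt ((n : ℝ) ^ 2 * GridSearch.logN n / t
            + (n : ℝ) ^ 2 / 4 * Real.tan δ ^ 2)) ∧
        c * min 1 (t * (1 + Real.tan δ ^ 2) / GridSearch.logN n)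
          ≤ GridSearch.successProb n t m δ) ∧
    -- the choice `t tan² δ = Θ(log N)`
    (∀ K a b : ℝ, 0 < K → 0 < a → 0 < b → ∃ C c : ℝ, 0 < C ∧ 0 < c ∧ ∃ n₀ : ℕ,
      ∀ (n : ℕ) [NeZero n] (t : ℕ) (m : GridSearch.Vertex n) (δ : ℝ), n₀ ≤ n → Odd t →
        (t : ℝ) ≤ K * GridSearch.logN n → Real.cos δ ≠ 0 →
        a * GridSearch.logN n ≤ t * Real.tan δ ^ 2 →
        t * Real.tan δ ^ 2 ≤ b * GridSearch.logN n →
        c ≤ GridSearch.successProb n t m δ ∧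
        GridSearch.ThetaWith C (GridSearch.oracleQueries n t m δ)
          (Real.sqrt ((n : ℝ) ^ 2 * GridSearch.logN n / t)) ∧
        GridSearch.ThetaWith C (GridSearch.graphQueries n t m δ)
          (Real.sqrt ((n : ℝ) ^ 2 * t * GridSearch.logN n)) ∧
        GridSearch.ThetaWith C
          ((GridSearch.oracleQueries n t m δ : ℝ) * (GridSearch.graphQueries n t m δ : ℝ))
          ((n : ℝ) ^ 2 * GridSearch.logN n)) ∧
    -- first extreme: `t = 1` and `tan² δ = Θ(log N)`
    (∀ a b : ℝ, 0 < a → 0 < b → ∃ C c : ℝ, 0 < C ∧ 0 < c ∧ ∃ n₀ : ℕ,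
      ∀ (n : ℕ) [NeZero n] (m : GridSearch.Vertex n) (δ : ℝ), n₀ ≤ n → Real.cos δ ≠ 0 →
        a * GridSearch.logN n ≤ Real.tan δ ^ 2 → Real.tan δ ^ 2 ≤ b * GridSearch.logN n →
        c ≤ GridSearch.successProb n 1 m δ ∧
        GridSearch.oracleQueries n 1 m δ = GridSearch.graphQueries n 1 m δ ∧
        GridSearch.ThetaWith C (GridSearch.oracleQueries n 1 m δ)
          (Real.sqrt ((n : ℝ) ^ 2 * GridSearch.logN n))) ∧
    -- second extreme: `t = Θ(log N)` and `tan² δ = Θ(1)`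
    (∀ a b : ℝ, 0 < a → 0 < b → ∃ C c : ℝ, 0 < C ∧ 0 < c ∧ ∃ n₀ : ℕ,
      ∀ (n : ℕ) [NeZero n] (t : ℕ) (m : GridSearch.Vertex n) (δ : ℝ), n₀ ≤ n → Odd t →
        a * GridSearch.logN n ≤ t → (t : ℝ) ≤ b * GridSearch.logN n → Real.cos δ ≠ 0 →
        a ≤ Real.tan δ ^ 2 → Real.tan δ ^ 2 ≤ b →
        c ≤ GridSearch.successProb n t m δ ∧
        GridSearch.ThetaWith C (GridSearch.oracleQueries n t m δ)
          (Real.sqrt ((n : ℝ) ^ 2)) ∧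
        GridSearch.ThetaWith C (GridSearch.graphQueries n t m δ)
          (Real.sqrt ((n : ℝ) ^ 2) * GridSearch.logN n)) := by
  refine ⟨fun n _ t m δ ψ => GridSearch.run_iteration m δ ψ,
    fun n _ t m δ => GridSearch.successProb_le_one n t m δ, ?_, ?_, ?_, ?_⟩
  · intro K hK
    obtain ⟨C, hC, n₀, h4, H⟩ := GridSearch.exists_uniform_bounds hK
    have hC0 : 0 < C := by linarith
    refine ⟨C, C⁻¹, hC0, by positivity, n₀, ?_⟩
    intro n _ t m δ hn ht htK hδ
    obtain ⟨h0, -, hup, hlow, hp⟩ := H n t m δ hn ht htK hδ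
    refine ⟨?_, hp⟩
    change GridSearch.ThetaWith C _ (1 / Real.sqrt (GridSearch.scale n t δ))
    have hZ : 0 < Real.sqrt (GridSearch.scale n t δ) := by
      by_contra h
      have : GridSearch.alpha n t m δ * Real.sqrt (GridSearch.scale n t δ) ≤ 0 :=
        mul_nonpos_of_nonneg_of_nonpos h0.le (not_lt.mp h)
      nlinarith
    constructor
    · rw [mul_one_div, le_div_iff₀ hZ]
      exact hup
    · rw [div_le_iff₀ hZ]
      linarith
  · intro K a b hK ha hb
    obtain ⟨C, c, hC, hc, n₀, -, H⟩ := GridSearch.exists_balanced_bounds hK ha hb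
    exact ⟨C, c, hC, hc, n₀, H⟩
  · intro a b ha hb
    obtain ⟨C, c, hC, hc, n₀, h4, H⟩ := GridSearch.exists_balanced_bounds one_pos ha hb
    refine ⟨C, c, hC, hc, n₀, ?_⟩
    intro n _ m δ hn hδ hlo hhi
    have hL := GridSearch.one_le_logN (h4.trans hn)
    obtain ⟨hp, hO, -, -⟩ := H n 1 m δ hn odd_one (by simpa using hL) hδ (by simpa using hlo)
      (by simpa using hhi)
    refine ⟨hp, ?_, by simpa using hO⟩
    rw [GridSearch.oracleQueries_eq, GridSearch.graphQueries_eq, mul_one]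
  · intro a b ha hb
    -- Here `t tan² δ` lies between `a² log N` and `b² log N`.
    obtain ⟨C, c, hC, hc, n₀, h4, H⟩ :=
      GridSearch.exists_balanced_bounds hb (mul_pos ha ha) (mul_pos hb hb)
    refine ⟨C * (1 + a⁻¹ + b), c, by positivity, hc, n₀, ?_⟩
    intro n _ t m δ hn ht hta htb hδ hτa hτb
    have hL := GridSearch.one_le_logN (h4.trans hn)
    have hLpos : 0 < GridSearch.logN n := by linarith
    have htpos : (0 : ℝ) < t := by exact_mod_cast ht.pos
    obtain ⟨hp, hO, hG, -⟩ := H n t m δ hn ht htb hδ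
      (by nlinarith [mul_le_mul hta hτa ha.le htpos.le])
      (by nlinarith [mul_le_mul htb hτb (sq_nonneg (Real.tan δ)) (by positivity)])
    have hainv : 0 < a⁻¹ := inv_pos.mpr ha
    have hn0 : (0 : ℝ) ≤ n := Nat.cast_nonneg n
    have hsqrt : Real.sqrt ((n : ℝ) ^ 2) = n := Real.sqrt_sq hn0
    have hA : 0 ≤ 1 + a⁻¹ + b := by positivity
    have hab : t ≤ (1 + a⁻¹ + b) ^ 2 * GridSearch.logN n ∧
        GridSearch.logN n ≤ (1 + a⁻¹ + b) ^ 2 * t := by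
      have h1 : GridSearch.logN n ≤ a⁻¹ * t := by
        rw [← div_eq_inv_mul, le_div_iff₀ ha]
        linarith
      have h2 : b ≤ (1 + a⁻¹ + b) ^ 2 := by nlinarith [mul_pos hainv hb]
      have h3 : a⁻¹ ≤ (1 + a⁻¹ + b) ^ 2 := by nlinarith [mul_pos hainv hb]
      exact ⟨htb.trans (by gcongr), h1.trans (by gcongr)⟩
    refine ⟨hp, hO.trans hC.le hA ⟨?_, ?_⟩, hG.trans hC.le hA ⟨?_, ?_⟩⟩
    · rw [hsqrt, Real.sqrt_le_left (by positivity), mul_pow, div_le_iff₀ htpos]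
      calc (n : ℝ) ^ 2 * GridSearch.logN n ≤ (n : ℝ) ^ 2 * ((1 + a⁻¹ + b) ^ 2 * t) := by
            gcongr; exact hab.2
        _ = _ := by ring
    · rw [hsqrt]
      refine le_of_sq_le_sq ?_ (by positivity)
      rw [mul_pow, Real.sq_sqrt (by positivity), mul_div_assoc', le_div_iff₀ htpos]
      calc (n : ℝ) ^ 2 * t ≤ (n : ℝ) ^ 2 * ((1 + a⁻¹ + b) ^ 2 * GridSearch.logN n) := by
            gcongr; exact hab.1
        _ = _ := by ring
    · rw [hsqrt, Real.sqrt_le_left (by positivity), mul_pow]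
      calc (n : ℝ) ^ 2 * t * GridSearch.logN n ≤
          (n : ℝ) ^ 2 * ((1 + a⁻¹ + b) ^ 2 * GridSearch.logN n) * GridSearch.logN n := by
            gcongr; exact hab.1
        _ = _ := by ring
    · rw [hsqrt]
      refine le_of_sq_le_sq ?_ (by positivity)
      rw [mul_pow, mul_pow, Real.sq_sqrt (by positivity)]
      calc (n : ℝ) ^ 2 * GridSearch.logN n ^ 2 =
          (n : ℝ) ^ 2 * GridSearch.logN n * GridSearch.logN n := by ring
        _ ≤ (n : ℝ) ^ 2 * GridSearch.logN n * ((1 + a⁻¹ + b) ^ 2 * t) := by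
            gcongr; exact hab.2
        _ = _ := by ring
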